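/- **Setting.** Let $B=(B^1,\dots,B^d)$, $d\ge 1$, be a standard $d$-dimensional Brownian motion (started at $0$, continuous paths) on a probability space $(\Omega,\mathbb P)$, and let $\mathbb F=(\mathcal F_t)_{t\ge0}$ be the usual $\mathbb P$-augmentation of its filtration. Fix $T>0$, $\bar a>0$ and $\mathbb A=\{x\in\mathbb R^r:\max_i|x_i|\le\bar a\}$. Let $U_0^T$ be the set of $\mathbb F$-predictable $u:\,]]0,T]]\to\mathbb A$ for which $u(0+)$ exists. Controls are extended by $0$. Write $\|f\|_\infty=\sup_{0\le t\le T}\|f(t)\|$, with $\|\cdot\|$ the Euclidean norm. *Payoff (A1).* Let $\mathbf D_{n,T}$ be the set of càdlàg $f:[0,T]\to\mathbb R^n$, and let $\xi:\mathbf D_{n,T}\to\mathbb R$ satisfy $|\xi(f)-\xi(g)|\le \|\xi\|\,\|f-g\|_\infty^\gamma$ for all $f,g$, with constants $\|\xi\|>0$ and $\gamma\in(0,1]$. *State (B1).* Let $X$ assign to each $u\in U_0^T$ a continuous $\mathbb F$-adapted $\mathbb R^n$-valued process $X(\cdot,u)$ on $[0,T]$ with $\mathbb E\|X(\cdot,u)\|_\infty^2<\infty$,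 such that for each $t$ the restriction of $X(\cdot,u)$ to $[0,t]$ depends only on $u|_{(0,t]}$. Assume that for some constant $C$, for all $u,\eta\in U_0^T$, $$\mathbb E\|X(\cdot,u)-X(\cdot,\eta)\|_\infty^2\le C\,\mathbb E\int_0^T\|u(s)-\eta(s)\|^2ds .$$ *Skeleton.* Let $(\epsilon_k)$ be positive reals with $\epsilon_k\downarrow0$. Put $T^k_0=0$ and $T^k_{j}=\inf\{t>T^k_{j-1}:\max_i|B^i(t)-B^i(T^k_{j-1})|=\epsilon_k\}$ for $j\ge1$, and $A^k(t)=\sum_{j\ge1}(B(T^k_j)-B(T^k_{j-1}))\mathbf 1_{\{T^k_j\le t\}}$. Let $\mathcal F^k_{T^k_j}$ be $\sigma(A^k(s\wedge T^k_j);s\ge0)$ augmented by the null sets of the completion of $\sigma(A^k(s);s\ge 0)$. Put $e(k,T)=\lceil \epsilon_k^{-2}T/\chi_d\rceil$, where $\chi_d=\mathbb E\min_{1\le j\le d}\tau^j$ and $\tau^1,\dots,\tau^d$ are independent copies of the first time a one-dimensional standard Brownian motion has absolute value $1$. Let $U^{k,e(k,T)}_0$ be the set of processes $\phi(t)=\sum_{j=1}^{e(k,T)}v_{j-1}\mathbf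 1_{\{T^k_{j-1}<t\le T^k_j\}}$ with $v_{j-1}$ $\mathbb A$-valued and $\mathcal F^k_{T^k_{j-1}}$-measurable. Cut off at $T$ and extended by $0$, such a $\phi$ is regarded as a control on $]]0,T]]$. *Discrete structure.* For every $k$ let $X^k$ assign to each $\phi\in U^{k,e(k,T)}_0$ a process $$X^k(t,\phi)=\sum_{i\ge0}X^k(T^k_i,\phi)\mathbf 1_{\{T^k_i\le t\wedge T^k_{e(k,T)}<T^k_{i+1}\}},\qquad 0\le t\le T,$$ where $X^k(T^k_i,\phi)$ is $\mathcal F^k_{T^k_i}$-measurable and, for $0\le i<e(k,T)$, $X^k(T^k_{i+1},\phi)$ depends on $\phi$ only through $(v_0,\dots,v_i)$. Assume that for each $k$ the family $\{\|X^k(\phi)\|_\infty:\phi\in U_0^{k,e(k,T)}\}$ is uniformly integrable, that $$\lim_{k\to\infty}\ \sup_{\phi\in U_0^{k,e(k,T)}}\mathbb E\|X^k(\phi)-X(\phi)\|_\infty^\gamma=0,$$ and that each $\xi(X^k(\cdot,\phi))$ is a random variable (measurable up to a $\mathbb P$-null set). Set $$V^k(0)=\sup_{\phi\in U_0^{k,e(k,T)}}\mathbb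 E[\xi(X^k(\cdot,\phi))].$$ **Conclusion.** All expectations $\mathbb E[\xi(X(\cdot,u))]$, $u\in U_0^T$, and $\mathbb E[\xi(X^k(\cdot,\phi))]$, $\phi\in U_0^{k,e(k,T)}$, are well defined, their suprema are finite, and 1. $\displaystyle\lim_{k\to\infty}\Big|V^k(0)-\sup_{u\in U_0^T}\mathbb E[\xi(X(\cdot,u))]\Big|=0$; 2. for all $0\le\delta<\eta$ there is $k_0$ such that for every $k\ge k_0$, every $\phi\in U_0^{k,e(k,T)}$ with $\mathbb E[\xi(X^k(\cdot,\phi))]\ge V^k(0)-\delta$ belongs to $U_0^T$ and satisfies $$\mathbb E[\xi(X(\cdot,\phi))]\ge\sup_{u\in U_0^T}\mathbb E[\xi(X(\cdot,u))]-\eta .$$ -/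

import Mathlib

open MeasureTheory ProbabilityTheory Filter Topology
open scoped NNReal ENNReal

noncomputable section

namespace WienerControl

variable {Ω : Type*} {m : MeasurableSpace Ω}

/-! ### Brownian motion and its augmented filtration -/

/-- `B` is a standard `d`-dimensional Brownian motion on `(Ω, P)`: the components are independent
one-dimensional Brownian motions started at `0`, and the paths are continuous. The state space
`Fin d → ℝ` carries the maximum norm. -/
structure IsBrownianMotion {d : ℕ} (B : ℝ≥0 → Ω → Fin d → ℝ) (P : Measure Ω) : Prop where
  measurable : ∀ t, Measurable (B t)
  component : ∀ i, IsBrownianReal (fun t ω => B t ω i) P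
  indep : iIndepFun (fun (i : Fin d) (ω : Ω) (t : ℝ≥0) => B t ω i) P
  continuous_path : ∀ ω, Continuous (fun t => B t ω)

/-- The (measurable) sets that are contained in a `P`-null set of the σ-algebra `𝒢`. -/
def nullSets (P : Measure Ω) (𝒢 : MeasurableSpace Ω) : Set (Set Ω) :=
  {s | MeasurableSet[m] s ∧ ∃ t, MeasurableSet[𝒢] t ∧ P t = 0 ∧ s ⊆ t}

/-- The σ-algebra generated by the null sets of (the completion of) `𝒢`. -/
@[reducible] def nullSigma (P : Measure Ω) (𝒢 : MeasurableSpace Ω) : MeasurableSpace Ω :=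
  MeasurableSpace.generateFrom (nullSets P 𝒢)

/-- Usual augmentation of a filtration: adjoin the null sets, then make it right-continuous. -/
def usualAugmentation (P : Measure Ω) (𝓕 : Filtration ℝ≥0 m) : Filtration ℝ≥0 m :=
  Filtration.rightCont
    { seq := fun t => 𝓕 t ⊔ nullSigma P (⨆ s, 𝓕 s)
      mono' := fun _ _ h => sup_le_sup_right (𝓕.mono h) _
      le' := fun t => sup_le (𝓕.le t)
        (MeasurableSpace.generateFrom_le fun _ hs => hs.1) }

/-- The usual `P`-augmentation of the filtration generated by the Brownian motion `B`. -/
def brownianFiltration {d : ℕ} {B : ℝ≥0 → Ω → Fin d → ℝ} {P : Measure Ω}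
    (hB : IsBrownianMotion B P) : Filtration ℝ≥0 m :=
  usualAugmentation P (Filtration.natural B fun t => (hB.measurable t).stronglyMeasurable)

/-! ### Controls, paths and controlled Wiener functionals -/

/-- The action space `{x ∈ ℝ^r : max_i |x_i| ≤ a}`. -/
def actionSpace (r : ℕ) (a : ℝ) : Set (EuclideanSpace ℝ (Fin r)) :=
  {x | ∀ i, |x i| ≤ a}

/-- The admissible controls on `]]0,T]]`: predictable processes with values in the action space
having a right limit at time `0`, extended by `0` outside `]]0,T]]`. -/
def controls (𝓕 : Filtration ℝ≥0 m) (r : ℕ) (a : ℝ) (T : ℝ≥0) :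
    Set (ℝ≥0 → Ω → EuclideanSpace ℝ (Fin r)) :=
  {u | IsStronglyPredictable 𝓕 u ∧ (∀ t ω, u t ω ∈ actionSpace r a) ∧
    (∀ t ω, t ∉ Set.Ioc 0 T → u t ω = 0) ∧
    ∀ ω, ∃ l, Tendsto (fun t => u t ω) (𝓝[>] 0) (𝓝 l)}

/-- The `ℝ^n`-valued functions on `[0,T]`. -/
abbrev Path (n : ℕ) (T : ℝ≥0) : Type := Set.Icc (0 : ℝ≥0) T → EuclideanSpace ℝ (Fin n)

/-- The set `D_{n,T}` of càdlàg paths: right-continuous with left limits on `[0,T]`. -/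
def cadlag (n : ℕ) (T : ℝ≥0) : Set (Path n T) :=
  {f | ∀ t, ContinuousWithinAt f (Set.Ici t) t ∧ ∃ l, Tendsto f (𝓝[<] t) (𝓝 l)}

/-- The uniform norm `sup_{0 ≤ t ≤ T} ‖f t‖`, as an extended nonnegative number. -/
def supNorm {n : ℕ} {T : ℝ≥0} (f : Path n T) : ℝ≥0∞ := ⨆ t, ‖f t‖ₑ

/-- Assumption on the payoff: `γ`-Hölder continuity on càdlàg paths for the uniform norm. -/
def HolderPayoff {n : ℕ} {T : ℝ≥0} (ξ : Path n T → ℝ) (K γ : ℝ) : Prop :=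
  ∀ f ∈ cadlag n T, ∀ g ∈ cadlag n T, |ξ f - ξ g| ≤ K * (supNorm (f - g)).toReal ^ γ

/-- `X` is a continuous controlled Wiener functional with values in `B²`: on admissible controls it
is adapted, has continuous paths, `E ‖X(u)‖_∞² < ∞`, and up to time `t` it depends on the control
on `(0,t]` only. Its values off the admissible controls are irrelevant. -/
structure IsControlledWiener (P : Measure Ω) (𝓕 : Filtration ℝ≥0 m) {r n : ℕ} (a : ℝ) {T : ℝ≥0}
    (X : (ℝ≥0 → Ω → EuclideanSpace ℝ (Fin r)) →
      Set.Icc (0 : ℝ≥0) T → Ω → EuclideanSpace ℝ (Fin n)) : Prop where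
  adapted : ∀ u ∈ controls 𝓕 r a T, ∀ t : Set.Icc (0 : ℝ≥0) T, Measurable[𝓕 (t : ℝ≥0)] (X u t)
  continuous_path : ∀ u ∈ controls 𝓕 r a T, ∀ ω, Continuous (fun t => X u t ω)
  sq_integrable : ∀ u ∈ controls 𝓕 r a T, ∫⁻ ω, supNorm (fun t => X u t ω) ^ 2 ∂P < ∞
  nonanticipative : ∀ u ∈ controls 𝓕 r a T, ∀ v ∈ controls 𝓕 r a T, ∀ t : Set.Icc (0 : ℝ≥0) T,
    (∀ s, 0 < s → s ≤ (t : ℝ≥0) → ∀ ω, u s ω = v s ω) → ∀ s ≤ t, X u s =ᵐ[P] X v s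

/-- Assumption on the state: `E ‖X(u) - X(η)‖_∞² ≤ C E ∫_0^T ‖u(s) - η(s)‖² ds`. -/
def LipschitzState (P : Measure Ω) (𝓕 : Filtration ℝ≥0 m) {r n : ℕ} (a : ℝ) {T : ℝ≥0}
    (X : (ℝ≥0 → Ω → EuclideanSpace ℝ (Fin r)) →
      Set.Icc (0 : ℝ≥0) T → Ω → EuclideanSpace ℝ (Fin n)) (C : ℝ≥0) : Prop :=
  ∀ u ∈ controls 𝓕 r a T, ∀ η ∈ controls 𝓕 r a T,
    ∫⁻ ω, supNorm (fun t => X u t ω - X η t ω) ^ 2 ∂P ≤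
      C * ∫⁻ ω, (∫⁻ s : ℝ in Set.Ioc 0 (T : ℝ), ‖u s.toNNReal ω - η s.toNNReal ω‖ₑ ^ 2) ∂P

/-- The expected payoff `E[ξ(X(·,u))]`. -/
def value (P : Measure Ω) {r n : ℕ} {T : ℝ≥0} (ξ : Path n T → ℝ)
    (X : (ℝ≥0 → Ω → EuclideanSpace ℝ (Fin r)) →
      Set.Icc (0 : ℝ≥0) T → Ω → EuclideanSpace ℝ (Fin n))
    (u : ℝ≥0 → Ω → EuclideanSpace ℝ (Fin r)) : ℝ :=
  ∫ ω, ξ (fun t => X u t ω) ∂P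

/-- The optimal value `sup_{u} E[ξ(X(·,u))]` over all admissible controls. -/
def optimalValue (P : Measure Ω) (𝓕 : Filtration ℝ≥0 m) {r n : ℕ} (a : ℝ) {T : ℝ≥0}
    (ξ : Path n T → ℝ)
    (X : (ℝ≥0 → Ω → EuclideanSpace ℝ (Fin r)) →
      Set.Icc (0 : ℝ≥0) T → Ω → EuclideanSpace ℝ (Fin n)) : ℝ :=
  ⨆ u : controls 𝓕 r a T, value P ξ X u

/-- `u` is an `η`-optimal control. -/
def IsOptimalControl (P : Measure Ω) (𝓕 : Filtration ℝ≥0 m) {r n : ℕ} (a : ℝ) {T : ℝ≥0}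
    (ξ : Path n T → ℝ)
    (X : (ℝ≥0 → Ω → EuclideanSpace ℝ (Fin r)) →
      Set.Icc (0 : ℝ≥0) T → Ω → EuclideanSpace ℝ (Fin n)) (η : ℝ)
    (u : ℝ≥0 → Ω → EuclideanSpace ℝ (Fin r)) : Prop :=
  u ∈ controls 𝓕 r a T ∧ optimalValue P 𝓕 a ξ X - η ≤ value P ξ X u

/-! ### The discrete-type skeleton at mesh `ε` -/

section Skeleton

variable {d : ℕ} (B : ℝ≥0 → Ω → Fin d → ℝ) (ε : ℝ)

/-- The times `T_0 = 0`, `T_{n+1} = inf {t > T_n : ‖B(t) - B(T_n)‖_max = ε}`. -/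
def hitTime : ℕ → Ω → ℝ≥0∞
  | 0, _ => 0
  | n + 1, ω => sInf ((fun t : ℝ≥0 => (t : ℝ≥0∞)) ''
      {t | hitTime n ω < t ∧ ‖B t ω - B (hitTime n ω).toNNReal ω‖ = ε})

/-- The pure jump process `A(t) = ∑_{n ≥ 1} (B(T_n) - B(T_{n-1})) 1_{T_n ≤ t}`. -/
def jumpProcess (t : ℝ≥0) (ω : Ω) : Fin d → ℝ :=
  ∑' n : ℕ, Set.indicator {s : ℝ≥0 | hitTime B ε (n + 1) ω ≤ s}
    (fun _ => B (hitTime B ε (n + 1) ω).toNNReal ω - B (hitTime B ε n ω).toNNReal ω) t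

/-- The σ-algebra of the skeleton up to `T_n`: `σ(A(s ∧ T_n) : s ≥ 0)` together with the null sets
of the completion of `σ(A(s) : s ≥ 0)`. -/
@[reducible] def skeletonSigma (P : Measure Ω) (n : ℕ) : MeasurableSpace Ω :=
  (⨆ s : ℝ≥0, MeasurableSpace.comap
      (fun ω => jumpProcess B ε (min (s : ℝ≥0∞) (hitTime B ε n ω)).toNNReal ω) inferInstance) ⊔
    nullSigma P (⨆ s : ℝ≥0, MeasurableSpace.comap (jumpProcess B ε s) inferInstance)

/-- First time the `j`-th component has absolute value `1`. -/
def exitTime (j : Fin d) (ω : Ω) : ℝ≥0∞ :=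
  sInf ((fun t : ℝ≥0 => (t : ℝ≥0∞)) '' {t | 0 < t ∧ |B t ω j| = 1})

/-- `χ_d`: the mean of the minimum of the (independent) exit times of the `d` components. -/
def chi (P : Measure Ω) : ℝ := (∫⁻ ω, ⨅ j, exitTime B j ω ∂P).toReal

/-- The number of steps `⌈ε⁻² T / χ_d⌉`. -/
def numSteps (P : Measure Ω) (T : ℝ≥0) : ℕ := ⌈(ε ^ 2)⁻¹ * T / chi B P⌉₊

/-- Controls of the discrete problem with `N` steps, identified with their lists of values: the
`j`-th entry takes values in the action space and is measurable for the skeleton up to `T_j`. -/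
def discreteControls (P : Measure Ω) (N r : ℕ) (a : ℝ) :
    Set (Fin N → Ω → EuclideanSpace ℝ (Fin r)) :=
  {v | ∀ j : Fin N, Measurable[skeletonSigma B ε P j] (v j) ∧ ∀ ω, v j ω ∈ actionSpace r a}

/-- The control process `∑_{j<N} v_j 1_{T_j < t ≤ T_{j+1}}` of the list `v`, on `]]0,T]]` (and equal
to `0` outside of it). -/
def controlProcess (T : ℝ≥0) {N r : ℕ} (v : Fin N → Ω → EuclideanSpace ℝ (Fin r))
    (t : ℝ≥0) (ω : Ω) : EuclideanSpace ℝ (Fin r) :=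
  ∑ j : Fin N, Set.indicator
    {s : ℝ≥0 | hitTime B ε j ω < s ∧ (s : ℝ≥0∞) ≤ hitTime B ε (j + 1) ω ∧ s ≤ T}
    (fun _ => v j ω) t

/-- The stepwise constant process `∑_i z_i 1_{T_i ≤ t ∧ T_N < T_{i+1}}` on `[0,T]`
(the terms with `i > N` vanish). -/
def stepPath (T : ℝ≥0) (N : ℕ) {n : ℕ} (z : ℕ → Ω → EuclideanSpace ℝ (Fin n)) (ω : Ω) :
    Path n T := fun t =>
  ∑ i ∈ Finset.range (N + 1), Set.indicator
    {s : ℝ≥0∞ | hitTime B ε i ω ≤ s ∧ s < hitTime B ε (i + 1) ω}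
    (fun _ => z i ω) (min ((t : ℝ≥0) : ℝ≥0∞) (hitTime B ε N ω))

/-- One level of a controlled imbedded discrete structure with `N` steps. `Y v i` is the value at
time `T_i` of the stepwise constant process attached to the discrete control `v`. It is measurable
for the skeleton up to `T_i`, and `Y v (i+1)` depends on `v_0, …, v_i` only. -/
structure IsDiscreteStructure (P : Measure Ω) (N : ℕ) {r n : ℕ} (a : ℝ)
    (Y : (Fin N → Ω → EuclideanSpace ℝ (Fin r)) → ℕ → Ω → EuclideanSpace ℝ (Fin n)) : Prop where
  measurable : ∀ v ∈ discreteControls B ε P N r a, ∀ i, Measurable[skeletonSigma B ε P i] (Y v i)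
  nonanticipative : ∀ v ∈ discreteControls B ε P N r a, ∀ w ∈ discreteControls B ε P N r a,
    ∀ i < N, (∀ j : Fin N, (j : ℕ) ≤ i → v j = w j) → Y v (i + 1) =ᵐ[P] Y w (i + 1)

/-- The expected payoff `E[ξ(Y(·,v))]` of the discrete control `v`. -/
def discreteValue (P : Measure Ω) {N r n : ℕ} {T : ℝ≥0} (ξ : Path n T → ℝ)
    (Y : (Fin N → Ω → EuclideanSpace ℝ (Fin r)) → ℕ → Ω → EuclideanSpace ℝ (Fin n))
    (v : Fin N → Ω → EuclideanSpace ℝ (Fin r)) : ℝ :=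
  ∫ ω, ξ (stepPath B ε T N (Y v) ω) ∂P

/-- The optimal value of the discrete problem, `sup_v E[ξ(Y(·,v))]`. -/
def discreteOptimalValue (P : Measure Ω) {N r n : ℕ} (a : ℝ) {T : ℝ≥0} (ξ : Path n T → ℝ)
    (Y : (Fin N → Ω → EuclideanSpace ℝ (Fin r)) → ℕ → Ω → EuclideanSpace ℝ (Fin n)) : ℝ :=
  ⨆ v : discreteControls B ε P N r a, discreteValue B ε P ξ Y v

end Skeleton

/-- `(X, (X^k)_k)` is a strongly controlled Wiener functional, with exponent `γ`, for the skeletons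
with meshes `ε k`. -/
structure IsStronglyControlled {d : ℕ} {B : ℝ≥0 → Ω → Fin d → ℝ} {P : Measure Ω}
    (hB : IsBrownianMotion B P) (ε : ℕ → ℝ) {r n : ℕ} (a : ℝ) {T : ℝ≥0} (γ : ℝ)
    (X : (ℝ≥0 → Ω → EuclideanSpace ℝ (Fin r)) →
      Set.Icc (0 : ℝ≥0) T → Ω → EuclideanSpace ℝ (Fin n))
    (Xk : ∀ k, (Fin (numSteps B (ε k) P T) → Ω → EuclideanSpace ℝ (Fin r)) →
      ℕ → Ω → EuclideanSpace ℝ (Fin n)) : Prop where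
  controlled : IsControlledWiener P (brownianFiltration hB) a X
  discrete : ∀ k, IsDiscreteStructure B (ε k) P (numSteps B (ε k) P T) a (Xk k)
  uniformIntegrable : ∀ k, UniformIntegrable
    (fun (v : discreteControls B (ε k) P (numSteps B (ε k) P T) r a) ω =>
      (supNorm (stepPath B (ε k) T (numSteps B (ε k) P T) (Xk k v) ω)).toReal) 1 P
  tendsto : Tendsto
    (fun k => ⨆ v : discreteControls B (ε k) P (numSteps B (ε k) P T) r a,
      ∫⁻ ω, supNorm (fun t => stepPath B (ε k) T (numSteps B (ε k) P T) (Xk k v) ω t -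
        X (controlProcess B (ε k) T v.1) t ω) ^ γ ∂P) atTop (𝓝 0)

end WienerControl

end

namespace WienerControl

/-! ### Pathwise properties of the hitting times and of the skeleton. -/

section Paths

variable {Ω : Type*} {d : ℕ} {B : ℝ≥0 → Ω → Fin d → ℝ} {ε : ℝ} {ω : Ω}

/-! Everything rests on two estimates for the payoff. First, Hölder continuity bounds the difference
between the discrete payoff of `φ` and the payoff `E ξ(X(φ))` of the same control by `K E‖X^k(φ) -
X(φ)‖^γ`, which tends to `0` uniformly in `φ`. Since `φ` is admissible for the limit problem
(`controlProcess_mem_controls`), discrete values cannot asymptotically exceed the optimal value, and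
near-optimality transfers from one problem to the other. Secondly, the payoff is uniformly
continuous in the control for the `L²(P ⊗ dt)` distance (`exists_enorm_value_sub_le`), so the
reverse inequality reduces to density: every admissible control is an `L²` limit of discrete ones
(`eventually_exists_discreteControl`).

For the density, a process predictable for the augmented filtration agrees `P ⊗ dt`-a.e. with a
measurable functional of the history `(t, B(· ∧ t))` (`exists_eq_comp_history`). Bounded continuous
functions are dense in `L²` of the law of the history, so the control is close to `g(t, B(· ∧ t))`
with `g` continuous and valued in the action space. The discrete control evaluates the same `g` at
the time `T_j` and the skeleton stopped at `T_j`. These arguments are measurable for the skeleton up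
to `T_j`, because `T_j` can be read off the stopped skeleton as its last jump time
(`exists_measurable_eq_hitTime`). They converge to the history because the skeleton is uniformly
within `ε` of `B - B(0)`, and because a Brownian path is constant on no interval, which forces the
grid `T_j` to become dense (`tendsto_skeleton_history`).

It remains to see that the prescribed number `N` of steps asymptotically covers `[0,T]`
(`exists_measure_hitTime_numSteps_lt_le`). This is a Chernoff bound. With `τ` the first hitting time
at mesh `1`, one has `E e^{-cT_N} ≤ (E e^{-cρ²τ})^N` for every `0 < ρ < ε`, and `E e^{-hτ} = 1 - hχ
+ o(h)` makes the right side nearly `e^{-cT}`. Only this inequality is needed, and it follows from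
the Markov property at deterministic times, a grid and Fatou's lemma. -/

theorem hitTime_zero : hitTime B ε 0 ω = 0 := rfl

theorem hitTime_le_of_norm_eq {n : ℕ} {t : ℝ≥0} (h : hitTime B ε n ω < t)
    (h' : ‖B t ω - B (hitTime B ε n ω).toNNReal ω‖ = ε) : hitTime B ε (n + 1) ω ≤ t :=
  sInf_le ⟨t, ⟨h, h'⟩, rfl⟩

theorem hitTime_le_succ (n : ℕ) : hitTime B ε n ω ≤ hitTime B ε (n + 1) ω := by
  refine le_sInf ?_
  rintro _ ⟨t, ht, rfl⟩
  exact ht.1.le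

theorem hitTime_monotone : Monotone fun n => hitTime B ε n ω :=
  monotone_nat_of_le_succ fun n => hitTime_le_succ n

/-- Since `ε > 0`, the strict constraint `T_n < t` may be relaxed to `T_n ≤ t`. The set of
candidates is then closed, so its infimum is attained. -/
theorem hitTime_succ_mem (hc : Continuous fun t => B t ω) (hε : 0 < ε) {n : ℕ}
    (h : hitTime B ε (n + 1) ω ≠ ⊤) :
    hitTime B ε n ω < hitTime B ε (n + 1) ω ∧
      ‖B (hitTime B ε (n + 1) ω).toNNReal ω - B (hitTime B ε n ω).toNNReal ω‖ = ε := by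
  have hn : hitTime B ε n ω ≠ ⊤ := ne_top_of_le_ne_top h (hitTime_le_succ n)
  lift hitTime B ε n ω to ℝ≥0 using hn with s hs
  set S : Set ℝ≥0 := {t | s ≤ t ∧ ‖B t ω - B s ω‖ = ε} with hS
  have hS' : {t : ℝ≥0 | hitTime B ε n ω < t ∧ ‖B t ω - B (hitTime B ε n ω).toNNReal ω‖ = ε} = S := by
    ext t
    simp only [← hs, Set.mem_ofPred_eq, hS, ENNReal.toNNReal_coe, ENNReal.coe_lt_coe]
    refine ⟨fun h => ⟨h.1.le, h.2⟩, fun h => ⟨lt_of_le_of_ne h.1 ?_, h.2⟩⟩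
    rintro rfl
    simp only [sub_self, norm_zero] at h
    exact hε.ne h.2
  have heq : hitTime B ε (n + 1) ω = sInf ((fun t : ℝ≥0 => (t : ℝ≥0∞)) '' S) := by
    rw [← hS']; rfl
  have hne : S.Nonempty := by
    by_contra hne
    rw [Set.not_nonempty_iff_eq_empty] at hne
    rw [heq, hne] at h
    simp at h
  have hcl : IsClosed S :=
    (isClosed_le continuous_const continuous_id).inter
      (isClosed_eq (by fun_prop) continuous_const)
  have hmem : sInf S ∈ S := hcl.csInf_mem hne (OrderBot.bddBelow S)
  have hT : hitTime B ε (n + 1) ω = (sInf S : ℝ≥0) := by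
    rw [heq, ENNReal.coe_sInf hne, sInf_image]
  rw [hT]
  have hmem' := hS'.symm.subset hmem
  simp only [← hs, Set.mem_ofPred_eq, ENNReal.toNNReal_coe] at hmem'
  exact ⟨hmem'.1, by simpa using hmem'.2⟩

theorem hitTime_lt_succ (hc : Continuous fun t => B t ω) (hε : 0 < ε) {n : ℕ}
    (h : hitTime B ε n ω ≠ ⊤) : hitTime B ε n ω < hitTime B ε (n + 1) ω := by
  by_cases h' : hitTime B ε (n + 1) ω = ⊤
  · rw [h']; exact h.lt_top
  · exact (hitTime_succ_mem hc hε h').1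

theorem norm_sub_hitTime_lt (hc : Continuous fun t => B t ω) (hε : 0 < ε) {n : ℕ} {t : ℝ≥0}
    (h1 : hitTime B ε n ω ≤ t) (h2 : t < hitTime B ε (n + 1) ω) :
    ‖B t ω - B (hitTime B ε n ω).toNNReal ω‖ < ε := by
  by_contra! h
  have hn : hitTime B ε n ω ≠ ⊤ := ne_top_of_le_ne_top ENNReal.coe_ne_top h1
  have hst : (hitTime B ε n ω).toNNReal ≤ t := by simpa using ENNReal.toNNReal_mono ENNReal.coe_ne_top h1
  obtain ⟨s, hs, hs'⟩ := intermediate_value_Icc (f := fun t => ‖B t ω -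
    B (hitTime B ε n ω).toNNReal ω‖) hst (by fun_prop) (show ε ∈ Set.Icc _ _ by simp [hε.le, h])
  have hlt : (hitTime B ε n ω).toNNReal < s := by
    refine lt_of_le_of_ne hs.1 ?_
    rintro rfl
    simp only [sub_self, norm_zero] at hs'
    exact hε.ne hs'
  have : hitTime B ε (n + 1) ω ≤ s := by
    refine hitTime_le_of_norm_eq ?_ hs'
    rw [← ENNReal.coe_toNNReal hn]
    exact_mod_cast hlt
  have h3 := h2.trans_le this
  exact absurd hs.2 (not_le.2 (by exact_mod_cast h3))

theorem norm_sub_hitTime_le (hc : Continuous fun t => B t ω) (hε : 0 < ε) {n : ℕ} {t : ℝ≥0}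
    (h1 : hitTime B ε n ω ≤ t) (h2 : t ≤ hitTime B ε (n + 1) ω) :
    ‖B t ω - B (hitTime B ε n ω).toNNReal ω‖ ≤ ε := by
  rcases h2.lt_or_eq with h2 | h2
  · exact (norm_sub_hitTime_lt hc hε h1 h2).le
  · have := (hitTime_succ_mem hc hε (n := n) (by rw [← h2]; exact ENNReal.coe_ne_top)).2
    rw [← h2, ENNReal.toNNReal_coe] at this
    exact this.le

/-- If all `T_n` stayed below `t`, they would converge, and by continuity the increments `B(T_{n+1})
- B(T_n)` would tend to `0`, although each has norm `ε`. -/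
theorem exists_lt_hitTime (hc : Continuous fun t => B t ω) (hε : 0 < ε) (t : ℝ≥0) :
    ∃ n, t < hitTime B ε n ω := by
  by_contra! h
  set u : ℕ → ℝ≥0 := fun n => (hitTime B ε n ω).toNNReal with hu
  have hne : ∀ n, hitTime B ε n ω ≠ ⊤ := fun n => ne_top_of_le_ne_top ENNReal.coe_ne_top (h n)
  have hmono : Monotone u := fun a b hab =>
    ENNReal.toNNReal_mono (hne b) (hitTime_monotone hab)
  have hbdd : BddAbove (Set.range u) :=
    ⟨t, by rintro _ ⟨n, rfl⟩; exact by simpa using ENNReal.toNNReal_mono ENNReal.coe_ne_top (h n)⟩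
  have hlim := tendsto_atTop_ciSup hmono hbdd
  have h1 := (hc.tendsto _).comp hlim
  have h2 := (hc.tendsto _).comp (hlim.comp (tendsto_add_atTop_nat 1))
  have h3 := (h2.sub h1).norm
  simp only [sub_self, norm_zero] at h3
  have h4 : ∀ n, ‖B (u (n + 1)) ω - B (u n) ω‖ = ε := fun n => (hitTime_succ_mem hc hε (hne _)).2
  have h5 : Tendsto (fun _ : ℕ => ε) atTop (𝓝 0) := by
    refine h3.congr fun n => ?_
    exact h4 n
  exact hε.ne (tendsto_nhds_unique h5 tendsto_const_nhds)

theorem exists_hitTime_le_lt (hc : Continuous fun t => B t ω) (hε : 0 < ε) (t : ℝ≥0) :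
    ∃ n, hitTime B ε n ω ≤ t ∧ t < hitTime B ε (n + 1) ω := by
  classical
  have h := exists_lt_hitTime hc hε t
  have hpos : 0 < Nat.find h := by
    rw [Nat.pos_iff_ne_zero]
    intro h0
    have := Nat.find_spec h
    rw [h0] at this
    exact not_lt_bot this
  refine ⟨Nat.find h - 1, not_lt.1 (Nat.find_min h (by omega)), ?_⟩
  rw [Nat.sub_add_cancel hpos]
  exact Nat.find_spec h

theorem exists_hitTime_lt_le (hc : Continuous fun t => B t ω) (hε : 0 < ε) {t : ℝ≥0}
    (ht : 0 < t) : ∃ n, hitTime B ε n ω < t ∧ t ≤ hitTime B ε (n + 1) ω := by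
  classical
  have h : ∃ n, (t : ℝ≥0∞) ≤ hitTime B ε n ω := (exists_lt_hitTime hc hε t).imp fun _ => le_of_lt
  have hpos : 0 < Nat.find h := by
    rw [Nat.pos_iff_ne_zero]
    intro h0
    have := Nat.find_spec h
    rw [h0] at this
    exact absurd this (not_le.2 (by simpa [hitTime] using ht))
  refine ⟨Nat.find h - 1, not_le.1 (Nat.find_min h (by omega)), ?_⟩
  rw [Nat.sub_add_cancel hpos]
  exact Nat.find_spec h

theorem jumpProcess_eq_sum {n : ℕ} {t : ℝ≥0} (h : t < hitTime B ε (n + 1) ω) :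
    jumpProcess B ε t ω = ∑ i ∈ Finset.range n, Set.indicator {s : ℝ≥0 | hitTime B ε (i + 1) ω ≤ s}
      (fun _ => B (hitTime B ε (i + 1) ω).toNNReal ω - B (hitTime B ε i ω).toNNReal ω) t := by
  refine tsum_eq_sum fun i hi => ?_
  rw [Set.indicator_of_notMem]
  simp only [Set.mem_ofPred_eq, not_le]
  refine h.trans_le (hitTime_monotone (B := B) (ε := ε) (ω := ω) ?_)
  simp only [Finset.mem_range, not_lt] at hi
  omega

theorem jumpProcess_eq {n : ℕ} {t : ℝ≥0} (h1 : hitTime B ε n ω ≤ t)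
    (h2 : t < hitTime B ε (n + 1) ω) :
    jumpProcess B ε t ω = B (hitTime B ε n ω).toNNReal ω - B 0 ω := by
  rw [jumpProcess_eq_sum h2]
  rw [Finset.sum_congr rfl (g := fun i => B (hitTime B ε (i + 1) ω).toNNReal ω -
    B (hitTime B ε i ω).toNNReal ω)]
  · rw [Finset.sum_range_sub (fun i => B (hitTime B ε i ω).toNNReal ω)]
    simp [hitTime]
  · intro i hi
    rw [Set.indicator_of_mem]
    rw [Finset.mem_range] at hi
    exact (hitTime_monotone (B := B) (ε := ε) (ω := ω) (by omega : i + 1 ≤ n)).trans h1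

theorem norm_jumpProcess_sub_lt (hc : Continuous fun t => B t ω) (hε : 0 < ε) (t : ℝ≥0) :
    ‖ jumpProcess B ε t ω - (B t ω - B 0 ω)‖ < ε := by
  obtain ⟨n, h1, h2⟩ := exists_hitTime_le_lt hc hε t
  rw [jumpProcess_eq h1 h2, norm_sub_rev]
  rw [sub_sub_sub_cancel_right]
  exact norm_sub_hitTime_lt hc hε h1 h2

/-- On `(T_n, T_{n+1}]`, the skeleton stopped at `T_n` is close to the stopped Brownian path. -/
theorem norm_jumpProcess_min_hitTime_sub_le (hc : Continuous fun t => B t ω) (hε : 0 < ε)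
    {n : ℕ} {t : ℝ≥0} (h1 : hitTime B ε n ω < t) (h2 : t ≤ hitTime B ε (n + 1) ω) (q : ℝ≥0) :
    ‖ jumpProcess B ε (min (q : ℝ≥0∞) (hitTime B ε n ω)).toNNReal ω - (B (min q t) ω - B 0 ω)‖
      ≤ 2 * ε := by
  have hne : hitTime B ε n ω ≠ ⊤ := h1.ne_top
  have hA := (norm_jumpProcess_sub_lt hc hε (min (q : ℝ≥0∞) (hitTime B ε n ω)).toNNReal).le
  -- One `ε` comes from replacing the skeleton by `B` at time `q ∧ T_n`, the other from moving `B`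
  -- from `q ∧ T_n` to `q ∧ t`, both times being equal or in `[T_n, T_{n+1}]`.
  have hB : ‖B (min (q : ℝ≥0∞) (hitTime B ε n ω)).toNNReal ω - B (min q t) ω‖ ≤ ε := by
    rcases le_or_gt (q : ℝ≥0∞) (hitTime B ε n ω) with h | h
    · have : q ≤ t := by exact_mod_cast (h.trans h1.le)
      rw [min_eq_left h, min_eq_left this]
      simpa using hε.le
    · rw [min_eq_right h.le, norm_sub_rev]
      refine norm_sub_hitTime_le hc hε ?_ ?_
      · rw [ENNReal.coe_min]; exact le_min h.le h1.le
      · rw [ENNReal.coe_min]; exact (min_le_right _ _).trans h2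
  calc _ = ‖(jumpProcess B ε (min (q : ℝ≥0∞) (hitTime B ε n ω)).toNNReal ω -
        (B (min (q : ℝ≥0∞) (hitTime B ε n ω)).toNNReal ω - B 0 ω)) +
        (B (min (q : ℝ≥0∞) (hitTime B ε n ω)).toNNReal ω - B (min q t) ω)‖ := by congr 1; abel
    _ ≤ _ := norm_add_le _ _
    _ ≤ _ := by linarith

end Paths

end WienerControl

/-! ### Measurability and predictability of hitting times, skeleton and discrete controls. -/

namespace WienerControl

/-- The sets whose preimage under `f` has a measurable intersection with `R`. -/
@[reducible] def traceSigma {S Ω : Type*} (𝒢 : MeasurableSpace S) (R : Set S) (f : S → Ω)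
    (hR : MeasurableSet[𝒢] R) : MeasurableSpace Ω where
  MeasurableSet' A := MeasurableSet[𝒢] (R ∩ f ⁻¹' A)
  measurableSet_empty := by simp
  measurableSet_compl A hA := by
    have : R ∩ f ⁻¹' Aᶜ = R \ (R ∩ f ⁻¹' A) := by ext; simp
    rw [this]
    exact hR.diff hA
  measurableSet_iUnion A hA := by
    rw [Set.preimage_iUnion, Set.inter_iUnion]
    exact MeasurableSet.iUnion hA

theorem measurable_indicator_of_inter {S E : Type*} [MeasurableSpace S] [MeasurableSpace E] [Zero E]
    {R : Set S} {f : S → E} (hR : MeasurableSet R)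
    (h : ∀ A, MeasurableSet A → MeasurableSet (R ∩ f ⁻¹' A)) : Measurable (R.indicator f) := by
  classical
  intro A hA
  have : R.indicator f ⁻¹' A = (R ∩ f ⁻¹' A) ∪ (Rᶜ ∩ (fun _ => (0 : E)) ⁻¹' A) := by
    ext x
    by_cases hx : x ∈ R <;> simp [hx]
  rw [this]
  exact (h A hA).union (hR.compl.inter (measurable_const hA))

theorem continuous_toNNReal_min (τ : ℝ≥0∞) :
    Continuous fun s : ℝ≥0 => (min (s : ℝ≥0∞) τ).toNNReal := by
  refine ENNReal.continuousOn_toNNReal.comp_continuous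
    (ENNReal.continuous_coe.min continuous_const) fun s => ?_
  exact (min_le_left _ _).trans_lt ENNReal.coe_lt_top |>.ne

section Measurability

variable {Ω : Type*} {m : MeasurableSpace Ω} {d : ℕ} {B : ℝ≥0 → Ω → Fin d → ℝ} {ε : ℝ}
  {𝓕 : Filtration ℝ≥0 m}

theorem measurable_eval_min (hA : ∀ t, Measurable[𝓕 t] (B t))
    (hc : ∀ ω, Continuous fun t => B t ω) {τ : Ω → ℝ≥0∞}
    (hτ : ∀ t : ℝ≥0, MeasurableSet[𝓕 t] {ω | τ ω ≤ t}) (s : ℝ≥0) :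
    Measurable[𝓕 s] fun ω => B (min (s : ℝ≥0∞) (τ ω)).toNNReal ω := by
  have hA' : StronglyAdapted 𝓕 B := fun t =>
    (hA t).stronglyMeasurable
  have hτ' : IsStoppingTime 𝓕 (fun ω => (τ ω : WithTop ℝ≥0)) := hτ
  have hprog := hA'.isStronglyProgressive_of_continuous hc
  have h := IsStronglyProgressive.stronglyAdapted_stoppedProcess hprog hτ' s
  have heq : (fun ω => B (min (s : ℝ≥0∞) (τ ω)).toNNReal ω) =
      stoppedProcess B (fun ω => (τ ω : WithTop ℝ≥0)) s := by
    funext ω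
    have hne : (min (s : ℝ≥0∞) (τ ω)) ≠ ⊤ :=
      ((min_le_left _ _).trans_lt ENNReal.coe_lt_top).ne
    show _ = B (WithTop.untopA (min (s : ℝ≥0∞) (τ ω) : ℝ≥0∞)) ω
    lift min (s : ℝ≥0∞) (τ ω) to ℝ≥0 using hne with x
    rfl
  rw [heq]
  exact h.measurable

/-- The right side says that `‖B(s) - B(s ∧ T_n)‖` has supremum at least `ε` over `s ≤ t`. The
difference vanishes before `T_n`, so the constraint `T_n < s` need not be tested, and only values of
`B` and of stopped `B` up to time `t` occur. The tolerance `1 / (k + 1)` is what allows a countable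
dense set of times. -/
theorem hitTime_succ_le_iff {ω : Ω} (hc : Continuous fun t => B t ω) (hε : 0 < ε) {n : ℕ}
    {t : ℝ≥0} : hitTime B ε (n + 1) ω ≤ t ↔
      ∀ k : ℕ, ∃ i : ℕ, ε - 1 / (k + 1) < ‖B (min (TopologicalSpace.denseSeq ℝ≥0 i) t) ω -
        B (min (((min (TopologicalSpace.denseSeq ℝ≥0 i) t : ℝ≥0)) : ℝ≥0∞)
          (hitTime B ε n ω)).toNNReal ω‖ := by
  set f : ℝ≥0 → ℝ := fun s => ‖B (min s t) ω -
    B (min ((min s t : ℝ≥0) : ℝ≥0∞) (hitTime B ε n ω)).toNNReal ω‖ with hf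
  have hfc : Continuous f := by
    have h1 : Continuous fun s : ℝ≥0 => min s t := by fun_prop
    exact ((hc.comp h1).sub (hc.comp ((continuous_toNNReal_min (hitTime B ε n ω)).comp h1))).norm
  constructor
  · intro h k
    have hne : hitTime B ε (n + 1) ω ≠ ⊤ := ne_top_of_le_ne_top ENNReal.coe_ne_top h
    obtain ⟨hlt, heq⟩ := hitTime_succ_mem hc hε hne
    have hft : f (hitTime B ε (n + 1) ω).toNNReal = ε := by
      have h1 : min (hitTime B ε (n + 1) ω).toNNReal t = (hitTime B ε (n + 1) ω).toNNReal :=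
        min_eq_left (by simpa using ENNReal.toNNReal_mono ENNReal.coe_ne_top h)
      simp only [hf, h1, ENNReal.coe_toNNReal hne, min_eq_right hlt.le, heq]
    have hopen : IsOpen {s | ε - 1 / ((k : ℝ) + 1) < f s} := isOpen_lt continuous_const hfc
    obtain ⟨_, hs, i, rfl⟩ := (TopologicalSpace.denseRange_denseSeq ℝ≥0).inter_open_nonempty _ hopen
      ⟨(hitTime B ε (n + 1) ω).toNNReal, by
        simp only [Set.mem_ofPred_eq, hft]
        have : (0 : ℝ) < 1 / ((k : ℝ) + 1) := by positivity
        linarith⟩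
    exact ⟨i, hs⟩
  · intro h
    obtain ⟨s, hs, hmax⟩ := (isCompact_Icc (a := (0 : ℝ≥0)) (b := t)).exists_isMaxOn
      ⟨0, by simp⟩ hfc.continuousOn
    have hst : min s t = s := min_eq_left hs.2
    have hfs : ε ≤ f s := by
      refine le_of_forall_pos_lt_add fun δ hδ => ?_
      obtain ⟨k, hk⟩ := exists_nat_one_div_lt hδ
      obtain ⟨i, hi⟩ := h k
      have h1 : f (min (TopologicalSpace.denseSeq ℝ≥0 i) t) ≤ f s :=
        hmax ⟨zero_le, min_le_right _ _⟩
      have h2 : f (min (TopologicalSpace.denseSeq ℝ≥0 i) t) =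
          f (TopologicalSpace.denseSeq ℝ≥0 i) := by
        simp only [hf, min_assoc, min_self]
      rw [h2] at h1
      have h3 : ε - 1 / ((k : ℝ) + 1) < f (TopologicalSpace.denseSeq ℝ≥0 i) := hi
      linarith
    simp only [hf, hst] at hfs
    have hlt : hitTime B ε n ω ≤ s := by
      by_contra! hcon
      rw [min_eq_left hcon.le] at hfs
      simp at hfs
      linarith
    rw [min_eq_right hlt] at hfs
    by_contra! hcon
    exact absurd (norm_sub_hitTime_lt hc hε hlt ((by exact_mod_cast hs.2 : (s : ℝ≥0∞) ≤ t).trans_lt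
      hcon)) (not_lt.2 hfs)

theorem measurableSet_hitTime_le (hA : ∀ t, Measurable[𝓕 t] (B t))
    (hc : ∀ ω, Continuous fun t => B t ω) (hε : 0 < ε) (n : ℕ) (t : ℝ≥0) :
    MeasurableSet[𝓕 t] {ω | hitTime B ε n ω ≤ t} := by
  induction n generalizing t with
  | zero => simp [hitTime]
  | succ n ih =>
    simp_rw [hitTime_succ_le_iff (hc _) hε]
    rw [Set.ofPred_forall]
    refine MeasurableSet.iInter fun k => ?_
    rw [Set.ofPred_exists]
    refine MeasurableSet.iUnion fun i => ?_
    have hle : min (TopologicalSpace.denseSeq ℝ≥0 i) t ≤ t := min_le_right _ _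
    have h1 : Measurable[𝓕 t] (B (min (TopologicalSpace.denseSeq ℝ≥0 i) t)) :=
      (hA _).mono (𝓕.mono hle) le_rfl
    have h2 := (measurable_eval_min hA hc ih (min (TopologicalSpace.denseSeq ℝ≥0 i) t)).mono
      (𝓕.mono hle) le_rfl
    have h3 : Measurable[𝓕 t] fun ω => ‖B (min (TopologicalSpace.denseSeq ℝ≥0 i) t) ω -
        B (min (((min (TopologicalSpace.denseSeq ℝ≥0 i) t : ℝ≥0)) : ℝ≥0∞)
          (hitTime B ε n ω)).toNNReal ω‖ :=
      measurable_norm.comp (h1.sub h2)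
    exact h3 measurableSet_Ioi

theorem measurableSet_hitTime_lt (hA : ∀ t, Measurable[𝓕 t] (B t))
    (hc : ∀ ω, Continuous fun t => B t ω) (hε : 0 < ε) (n : ℕ) (t : ℝ≥0) :
    MeasurableSet[𝓕 t] {ω | hitTime B ε n ω < t} := by
  have hτ : IsStoppingTime 𝓕 (fun ω => (hitTime B ε n ω : WithTop ℝ≥0)) :=
    measurableSet_hitTime_le hA hc hε n
  exact hτ.measurableSet_lt t

theorem measurable_hitTime (hB : ∀ t, Measurable (B t))
    (hc : ∀ ω, Continuous fun t => B t ω) (hε : 0 < ε) (n : ℕ) :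
    Measurable (hitTime B ε n) := by
  refine measurable_of_Iic fun x => ?_
  induction x with
  | top => simp
  | coe x =>
    exact (Filtration.natural B fun t => (hB t).stronglyMeasurable).le x _
      (measurableSet_hitTime_le (𝓕 := Filtration.natural B fun t => (hB t).stronglyMeasurable)
        (fun t => (Filtration.stronglyAdapted_natural
          (fun t => (hB t).stronglyMeasurable) t).measurable) hc hε n x)

/-- The partial sums of the skeleton, with increments stopped at `q`. -/
theorem measurable_partialSum (hA : ∀ t, Measurable[𝓕 t] (B t))
    (hc : ∀ ω, Continuous fun t => B t ω) (hε : 0 < ε) (n : ℕ) {s q : ℝ≥0} (hsq : s ≤ q) :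
    Measurable[𝓕 q] fun ω => ∑ i ∈ Finset.range n,
      Set.indicator {ω | hitTime B ε (i + 1) ω ≤ s}
        (fun ω => B (min (q : ℝ≥0∞) (hitTime B ε (i + 1) ω)).toNNReal ω -
          B (min (q : ℝ≥0∞) (hitTime B ε i ω)).toNNReal ω) ω := by
  refine Finset.measurable_sum _ fun i _ => ?_
  refine Measurable.indicator ?_ (𝓕.mono hsq _ (measurableSet_hitTime_le hA hc hε _ s))
  exact (measurable_eval_min hA hc (measurableSet_hitTime_le hA hc hε _) q).sub
    (measurable_eval_min hA hc (measurableSet_hitTime_le hA hc hε _) q)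

/-- Stopping at `q` makes the summands measurable at time `q`, and it is invisible here because the
indicators force `T_{i+1} ≤ s ≤ q`. -/
theorem partialSum_eq {ω : Ω} {n : ℕ} {s q : ℝ≥0} (hsq : s ≤ q) :
    ∑ i ∈ Finset.range n, Set.indicator {ω | hitTime B ε (i + 1) ω ≤ s}
        (fun ω => B (min (q : ℝ≥0∞) (hitTime B ε (i + 1) ω)).toNNReal ω -
          B (min (q : ℝ≥0∞) (hitTime B ε i ω)).toNNReal ω) ω =
    ∑ i ∈ Finset.range n, Set.indicator {s : ℝ≥0 | hitTime B ε (i + 1) ω ≤ s}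
      (fun _ => B (hitTime B ε (i + 1) ω).toNNReal ω - B (hitTime B ε i ω).toNNReal ω) s := by
  refine Finset.sum_congr rfl fun i _ => ?_
  have hsq' : (s : ℝ≥0∞) ≤ q := by exact_mod_cast hsq
  by_cases h : hitTime B ε (i + 1) ω ≤ s
  · rw [Set.indicator_of_mem (by exact h), Set.indicator_of_mem (by exact h),
      min_eq_right (h.trans hsq'), min_eq_right ((hitTime_le_succ i).trans (h.trans hsq'))]
  · rw [Set.indicator_of_notMem (by exact h), Set.indicator_of_notMem (by exact h)]

theorem measurable_jumpProcess (hA : ∀ t, Measurable[𝓕 t] (B t))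
    (hc : ∀ ω, Continuous fun t => B t ω) (hε : 0 < ε) (s : ℝ≥0) :
    Measurable[𝓕 s] (jumpProcess B ε s) := by
  refine @measurable_of_tendsto_metrizable _ _ (𝓕 s) _ _ _ _ _ _
    (fun n => measurable_partialSum hA hc hε n le_rfl) ?_
  rw [tendsto_pi_nhds]
  intro ω
  obtain ⟨n, h1, h2⟩ := exists_hitTime_le_lt (hc ω) hε s
  refine tendsto_const_nhds.congr' ?_
  filter_upwards [eventually_ge_atTop n] with k hk
  rw [partialSum_eq le_rfl]
  exact jumpProcess_eq_sum (h2.trans_le (hitTime_monotone (B := B) (by omega)))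

/-- This is the link from the skeleton σ-algebra at `T_j` to the filtration at a fixed time. The
sets with measurable trace on `{T_j < q}` form a σ-algebra, so it suffices to check generators. On
`{T_j < q}` the stopped skeleton is the sum of the first `j` jumps, and these occur before `q`. -/
theorem measurableSet_hitTime_lt_inter (hA : ∀ t, Measurable[𝓕 t] (B t))
    (hc : ∀ ω, Continuous fun t => B t ω) (hε : 0 < ε) {P : Measure Ω}
    (hnull : nullSigma P (⨆ s : ℝ≥0, MeasurableSpace.comap (jumpProcess B ε s) inferInstance) ≤ 𝓕 0)
    {j : ℕ} {E : Set Ω} (hE : MeasurableSet[skeletonSigma B ε P j] E) (q : ℝ≥0) :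
    MeasurableSet[𝓕 q] ({ω | hitTime B ε j ω < q} ∩ E) := by
  have hR := measurableSet_hitTime_lt hA hc hε j q
  suffices h : skeletonSigma B ε P j ≤ traceSigma (𝓕 q) {ω | hitTime B ε j ω < q} id hR from
    h E hE
  refine sup_le (iSup_le fun s => ?_) ?_
  · rintro _ ⟨A, hA', rfl⟩
    have hH := measurable_partialSum hA hc hε j (min_le_right s q)
    change MeasurableSet[𝓕 q] ({ω | hitTime B ε j ω < q} ∩ id ⁻¹' _)
    convert hR.inter (hH hA') using 1
    ext ω
    simp only [Set.mem_inter_iff, Set.mem_ofPred_eq]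
    refine and_congr_right fun hlt => ?_
    simp only [Set.mem_preimage, id]
    rw [partialSum_eq (min_le_right s q), jumpProcess_eq_sum (n := j)]
    · refine iff_of_eq (congrArg (· ∈ A) (Finset.sum_congr rfl fun i hi => ?_))
      have hi' : hitTime B ε (i + 1) ω ≤ hitTime B ε j ω :=
        hitTime_monotone (B := B) (Finset.mem_range.1 hi)
      refine Set.indicator_eq_indicator ?_ rfl
      simp only [Set.mem_ofPred_eq]
      rw [ENNReal.coe_toNNReal ((min_le_left _ _).trans_lt ENNReal.coe_lt_top).ne, le_min_iff,
        ENNReal.coe_min, le_min_iff]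
      exact and_congr_right fun _ => iff_of_true hi' (hi'.trans hlt.le)
    · rw [ENNReal.coe_toNNReal ((min_le_left _ _).trans_lt ENNReal.coe_lt_top).ne]
      exact (min_le_right _ _).trans_lt (hitTime_lt_succ (hc ω) hε hlt.ne_top)
  · intro s hs
    exact hR.inter (𝓕.mono zero_le _ (hnull s hs))

/-- Inserting a time of a dense sequence between `T_j(ω)` and `t` writes the set as a countable
union of predictable rectangles. -/
theorem measurableSet_predictable_hitTime_lt {j : ℕ} {E : Set Ω}
    (hE : ∀ q : ℝ≥0, MeasurableSet[𝓕 q] ({ω | hitTime B ε j ω < q} ∩ E)) :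
    MeasurableSet[𝓕.predictable] {p : ℝ≥0 × Ω | hitTime B ε j p.2 < p.1 ∧ p.2 ∈ E} := by
  have : {p : ℝ≥0 × Ω | hitTime B ε j p.2 < p.1 ∧ p.2 ∈ E} =
      ⋃ i : ℕ, Set.Ioi (TopologicalSpace.denseSeq ℝ≥0 i) ×ˢ
        ({ω | hitTime B ε j ω < TopologicalSpace.denseSeq ℝ≥0 i} ∩ E) := by
    ext ⟨t, ω⟩
    simp only [Set.mem_ofPred_eq, Set.mem_iUnion, Set.mem_prod, Set.mem_Ioi, Set.mem_inter_iff]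
    constructor
    · rintro ⟨h, hω⟩
      have hlt : (hitTime B ε j ω).toNNReal < t := by
        rw [← ENNReal.coe_lt_coe, ENNReal.coe_toNNReal h.ne_top]; exact h
      obtain ⟨_, hs, i, rfl⟩ := (TopologicalSpace.denseRange_denseSeq ℝ≥0).inter_open_nonempty _
        isOpen_Ioo (Set.nonempty_Ioo.2 hlt)
      refine ⟨i, hs.2, ?_, hω⟩
      rw [← ENNReal.coe_toNNReal h.ne_top]
      exact_mod_cast hs.1
    · rintro ⟨i, h1, h2, h3⟩
      exact ⟨h2.trans (by exact_mod_cast h1), h3⟩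
  rw [this]
  exact MeasurableSet.iUnion fun i => measurableSet_predictable_Ioi_prod (hE _)

/-! ### Values and admissibility of the control process. -/

section ControlProcess

variable {T : ℝ≥0} {N r : ℕ} {v : Fin N → Ω → EuclideanSpace ℝ (Fin r)} {ω : Ω} {t : ℝ≥0}

theorem controlProcess_eq (j : Fin N) (h1 : hitTime B ε j ω < t)
    (h2 : t ≤ hitTime B ε (j + 1) ω) (hT : t ≤ T) : controlProcess B ε T v t ω = v j ω := by
  rw [controlProcess, Finset.sum_eq_single j, Set.indicator_of_mem (by exact ⟨h1, h2, hT⟩)]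
  · intro i _ hij
    rw [Set.indicator_of_notMem]
    rintro ⟨h3, h4, -⟩
    rcases lt_or_gt_of_ne (fun h => hij (Fin.ext h) : (i : ℕ) ≠ j) with h | h
    · exact absurd (h1.trans_le (h4.trans (hitTime_monotone (B := B) h))) (lt_irrefl _)
    · exact absurd (h3.trans_le (h2.trans (hitTime_monotone (B := B) h))) (lt_irrefl _)
  · simp

theorem controlProcess_mem {S : Set _} (h0 : 0 ∈ S)
    (hv : ∀ j, v j ω ∈ S) : controlProcess B ε T v t ω ∈ S := by
  by_cases h : ∃ j : Fin N, hitTime B ε j ω < t ∧ t ≤ hitTime B ε (j + 1) ω ∧ t ≤ T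
  · obtain ⟨j, h1, h2, h3⟩ := h
    rw [controlProcess_eq j h1 h2 h3]
    exact hv j
  · push Not at h
    rw [controlProcess, Finset.sum_eq_zero]
    · exact h0
    · intro j _
      rw [Set.indicator_of_notMem]
      rintro ⟨h1, h2, h3⟩
      exact absurd h3 (not_le.2 (h j h1 h2))

end ControlProcess

theorem le_usualAugmentation (P : Measure Ω) (𝓕 : Filtration ℝ≥0 m) (t : ℝ≥0) :
    𝓕 t ⊔ nullSigma P (⨆ s, 𝓕 s) ≤ usualAugmentation P 𝓕 t :=
  Filtration.le_rightCont (ι := ℝ≥0) (m := m) ⟨fun t => 𝓕 t ⊔ nullSigma P (⨆ s, 𝓕 s), _, _⟩ t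

theorem natural_le_brownianFiltration {P : Measure Ω} (hB : IsBrownianMotion B P) (t : ℝ≥0) :
    (Filtration.natural B fun t => (hB.measurable t).stronglyMeasurable) t ≤
      brownianFiltration hB t :=
  le_trans le_sup_left (le_usualAugmentation P _ t)

theorem measurable_brownianFiltration {P : Measure Ω} (hB : IsBrownianMotion B P) (t : ℝ≥0) :
    Measurable[brownianFiltration hB t] (B t) :=
  Measurable.mono (Filtration.stronglyAdapted_natural
    (fun t => (hB.measurable t).stronglyMeasurable) t).measurable
    (natural_le_brownianFiltration hB t) le_rfl

theorem measurable_natural {P : Measure Ω} (hB : IsBrownianMotion B P) (t : ℝ≥0) :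
    Measurable[(Filtration.natural B fun t => (hB.measurable t).stronglyMeasurable) t] (B t) :=
  (Filtration.stronglyAdapted_natural (fun t => (hB.measurable t).stronglyMeasurable) t).measurable

theorem nullSigma_mono {P : Measure Ω} {𝒢 𝓗 : MeasurableSpace Ω} (h : 𝒢 ≤ 𝓗) :
    nullSigma P 𝒢 ≤ nullSigma P 𝓗 :=
  MeasurableSpace.generateFrom_mono fun _ hs =>
    ⟨hs.1, hs.2.imp fun t ht => ⟨h t ht.1, ht.2⟩⟩

theorem nullSigma_jumpProcess_le {P : Measure Ω} (hB : IsBrownianMotion B P) (hε : 0 < ε) :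
    nullSigma P (⨆ s : ℝ≥0, MeasurableSpace.comap (jumpProcess B ε s) inferInstance) ≤
      brownianFiltration hB 0 := by
  refine le_trans (nullSigma_mono (iSup_le fun s => ?_))
    (le_trans le_sup_right (le_usualAugmentation P _ 0))
  refine le_trans ?_ (le_iSup _ s)
  exact (measurable_jumpProcess (measurable_natural hB) hB.continuous_path hε s).comap_le

theorem zero_mem_actionSpace {r : ℕ} {a : ℝ} (ha : 0 ≤ a) :
    (0 : EuclideanSpace ℝ (Fin r)) ∈ actionSpace r a := fun i => by simpa using ha

/-- Discrete controls are admissible for the original problem. -/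
theorem controlProcess_mem_controls {P : Measure Ω} (hB : IsBrownianMotion B P) (hε : 0 < ε)
    {a : ℝ} (ha : 0 ≤ a) {T : ℝ≥0} (hT : 0 < T) {N r : ℕ}
    {v : Fin N → Ω → EuclideanSpace ℝ (Fin r)} (hv : v ∈ discreteControls B ε P N r a) :
    controlProcess B ε T v ∈ controls (brownianFiltration hB) r a T := by
  refine ⟨?_, ?_, ?_, ?_⟩
  · have hA := measurable_brownianFiltration hB
    have hc := hB.continuous_path
    have hlt : ∀ j, MeasurableSet[(brownianFiltration hB).predictable]
        {p : ℝ≥0 × Ω | hitTime B ε j p.2 < p.1} := fun j => by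
      have := measurableSet_predictable_hitTime_lt (B := B) (ε := ε) (j := j)
        (𝓕 := brownianFiltration hB) (E := Set.univ)
        (fun q => by simpa using measurableSet_hitTime_lt hA hc hε j q)
      simpa using this
    refine Measurable.stronglyMeasurable ?_
    have hsum : Function.uncurry (controlProcess B ε T v) = fun p => ∑ j : Fin N,
        Set.indicator {p : ℝ≥0 × Ω | hitTime B ε j p.2 < p.1 ∧
          (p.1 : ℝ≥0∞) ≤ hitTime B ε (j + 1) p.2 ∧ p.1 ≤ T} (fun p => v j p.2) p := by
      funext p
      rfl
    rw [hsum]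
    refine Finset.measurable_sum _ fun j _ => ?_
    have hD : MeasurableSet[(brownianFiltration hB).predictable]
        {p : ℝ≥0 × Ω | (p.1 : ℝ≥0∞) ≤ hitTime B ε (j + 1) p.2 ∧ p.1 ≤ T} := by
      have h1 : {p : ℝ≥0 × Ω | (p.1 : ℝ≥0∞) ≤ hitTime B ε (j + 1) p.2 ∧ p.1 ≤ T} =
          {p : ℝ≥0 × Ω | hitTime B ε (j + 1) p.2 < p.1}ᶜ ∩ (Set.Ioi T ×ˢ Set.univ)ᶜ := by
        ext p; simp
      rw [h1]
      exact (hlt _).compl.inter (measurableSet_predictable_Ioi_prod MeasurableSet.univ).compl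
    -- The coefficient `v j` need not be predictable as a constant-in-time process. It is so only on
    -- the trace of `{T_j < t}`, hence the test on intersections.
    refine @measurable_indicator_of_inter _ _ (brownianFiltration hB).predictable _ _ _ _ ?_ ?_
    · exact (hlt j).inter hD
    · intro A hA'
      have hE := measurableSet_predictable_hitTime_lt (measurableSet_hitTime_lt_inter hA hc hε
        (nullSigma_jumpProcess_le hB hε) ((hv j).1 hA'))
      convert hE.inter hD using 1
      ext p
      simp only [Set.mem_inter_iff, Set.mem_ofPred_eq, Set.mem_preimage]
      tauto
  · intro t ω
    exact controlProcess_mem (zero_mem_actionSpace ha)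
      fun j => (hv j).2 ω
  · intro t ω ht
    refine Finset.sum_eq_zero fun j _ => Set.indicator_of_notMem ?_ _
    rintro ⟨h1, -, h3⟩
    refine ht ⟨?_, h3⟩
    exact_mod_cast (zero_le.trans_lt h1 : (0 : ℝ≥0∞) < t)
  · intro ω
    have h1 : (0 : ℝ≥0∞) < hitTime B ε 1 ω :=
      hitTime_lt_succ (n := 0) (hB.continuous_path ω) hε (by simp [hitTime])
    rcases Nat.eq_zero_or_pos N with rfl | hN
    -- Without steps the control is `0`. Otherwise it equals `v_0` on `(0, T_1 ∧ T]`, and `T_1 > 0`.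
    · exact ⟨0, tendsto_const_nhds.congr fun t => by simp [controlProcess]⟩
    · refine ⟨v ⟨0, hN⟩ ω, tendsto_const_nhds.congr' ?_⟩
      have hev : ∀ᶠ t : ℝ≥0 in 𝓝 0, (t : ℝ≥0∞) < hitTime B ε 1 ω ∧ t < T :=
        (ENNReal.continuous_coe.continuousAt.eventually_lt continuousAt_const
          (by simpa using h1)).and (Iio_mem_nhds hT)
      filter_upwards [nhdsWithin_le_nhds hev, self_mem_nhdsWithin] with t ht ht0
      refine (controlProcess_eq ⟨0, hN⟩ ?_ ht.1.le ht.2.le).symm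
      simpa [hitTime] using ht0

/-- The hitting times are functionals of the stopped skeleton. -/
theorem exists_measurable_eq_hitTime (hc : ∀ ω, Continuous fun t => B t ω) (hε : 0 < ε)
    (P : Measure Ω) (j : ℕ) : ∃ R : Ω → ℝ≥0, Measurable[skeletonSigma B ε P j] R ∧
      ∀ ω, hitTime B ε j ω ≠ ⊤ → (R ω : ℝ≥0∞) = hitTime B ε j ω := by
  classical
  set q := TopologicalSpace.denseSeq ℝ≥0
  set A : ℝ≥0 → Ω → Fin d → ℝ := fun s ω =>
    jumpProcess B ε (min (s : ℝ≥0∞) (hitTime B ε j ω)).toNNReal ω with hAdef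
  have hA : ∀ s, Measurable[skeletonSigma B ε P j] (A s) := fun s =>
    Measurable.mono (comap_measurable _) (le_trans (le_iSup (fun s : ℝ≥0 => MeasurableSpace.comap
      (A s) inferInstance) s) le_sup_left) le_rfl
  -- `C i` is the event that the stopped skeleton does not move after `q i`, tested along the dense
  -- sequence. The infimum `R'` of the `q i` with `ω ∈ C i` is the last jump time, and this is
  -- `T_j`: the skeleton is frozen from `T_j` on, and its jump at `T_j` has norm `ε ≠ 0` when `j ≥
  -- 1`.
  set C : ℕ → Set Ω := fun i => {ω | ∀ l, q i ≤ q l → A (q l) ω = A (q i) ω} with hC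
  have hCm : ∀ i, MeasurableSet[skeletonSigma B ε P j] (C i) := fun i => by
    simp only [hC]
    rw [Set.ofPred_forall]
    refine MeasurableSet.iInter fun l => ?_
    by_cases hl : q i ≤ q l
    · simp only [hl, forall_const]
      have h1 := ((hA (q l)).sub (hA (q i))) (measurableSet_singleton 0)
      convert h1 using 1
      ext ω
      simp [sub_eq_zero]
    · simp [hl]
  set R' : Ω → ℝ≥0∞ := fun ω => ⨅ i, (C i).indicator (fun _ => (q i : ℝ≥0∞)) ω +
    (C i)ᶜ.indicator (fun _ => ⊤) ω with hR'
  have hR'm : Measurable[skeletonSigma B ε P j] R' := by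
    refine Measurable.iInf fun i => ?_
    exact (measurable_const.indicator (hCm i)).add (measurable_const.indicator (hCm i).compl)
  refine ⟨fun ω => (R' ω).toNNReal, hR'm.ennreal_toNNReal, fun ω hω => ?_⟩
  suffices h : R' ω = hitTime B ε j ω by
    simp only [h]
    exact ENNReal.coe_toNNReal hω
  have hmin : ∀ s : ℝ≥0, hitTime B ε j ω ≤ s → A s ω = B (hitTime B ε j ω).toNNReal ω - B 0 ω := by
    intro s hs
    simp only [hAdef, min_eq_right hs]
    refine jumpProcess_eq ?_ ?_ <;> rw [ENNReal.coe_toNNReal hω]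
    exact hitTime_lt_succ (hc ω) hε hω
  have hdense : ∀ x y : ℝ≥0, x < y → ∃ i, x < q i ∧ q i < y := fun x y hxy => by
    obtain ⟨_, hs, i, rfl⟩ := (TopologicalSpace.denseRange_denseSeq ℝ≥0).inter_open_nonempty _
      isOpen_Ioo (Set.nonempty_Ioo.2 hxy)
    exact ⟨i, hs⟩
  refine le_antisymm ?_ ?_
  · refine le_of_forall_gt fun b hb => ?_
    obtain ⟨y, hy, hyb⟩ := ENNReal.lt_iff_exists_nnreal_btwn.1 hb
    obtain ⟨i, hi, hi'⟩ := hdense (hitTime B ε j ω).toNNReal y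
      (by rw [← ENNReal.coe_lt_coe, ENNReal.coe_toNNReal hω]; exact hy)
    have hi2 : hitTime B ε j ω ≤ q i := by
      rw [← ENNReal.coe_toNNReal hω]; exact_mod_cast hi.le
    have hmem : ω ∈ C i := fun l hl => by
      rw [hmin _ hi2, hmin _ (hi2.trans (by exact_mod_cast hl))]
    refine (iInf_le _ i).trans_lt ?_
    rw [Set.indicator_of_mem hmem, Set.indicator_of_notMem (by simpa using hmem), add_zero]
    exact lt_trans (by exact_mod_cast hi') hyb
  · refine le_iInf fun i => ?_
    by_cases hmem : ω ∈ C i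
    · rw [Set.indicator_of_mem hmem, Set.indicator_of_notMem (by simpa using hmem), add_zero]
      by_contra! hlt
      rcases j with - | j
      · simp [hitTime] at hlt
      obtain ⟨hprev, hjump⟩ := hitTime_succ_mem (hc ω) hε hω
      have hpne : hitTime B ε j ω ≠ ⊤ := hprev.ne_top
      -- Two dense times after `q i`, one just before the last jump and one after it: membership in
      -- `C i` would make the skeleton agree there.
      obtain ⟨l, hl1, hl2⟩ := hdense (max (hitTime B ε j ω).toNNReal (q i))
        (hitTime B ε (j + 1) ω).toNNReal (max_lt ((ENNReal.toNNReal_lt_toNNReal hpne hω).2 hprev)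
          (by rw [← ENNReal.coe_lt_coe, ENNReal.coe_toNNReal hω]; exact hlt))
      obtain ⟨l', hl'1, -⟩ := hdense (hitTime B ε (j + 1) ω).toNNReal
        ((hitTime B ε (j + 1) ω).toNNReal + 1) (by simp)
      have hl3 : (q l : ℝ≥0∞) < hitTime B ε (j + 1) ω := by
        rw [← ENNReal.coe_toNNReal hω]; exact_mod_cast hl2
      have hl4 : hitTime B ε j ω ≤ q l := by
        rw [← ENNReal.coe_toNNReal hpne]; exact_mod_cast (le_max_left _ _).trans hl1.le
      have hl5 : hitTime B ε (j + 1) ω ≤ q l' := by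
        rw [← ENNReal.coe_toNNReal hω]; exact_mod_cast hl'1.le
      have e1 := hmem l ((le_max_right _ _).trans hl1.le)
      have e2 := hmem l' (by exact_mod_cast hlt.le.trans hl5)
      have e3 : A (q l) ω = B (hitTime B ε j ω).toNNReal ω - B 0 ω := by
        simp only [hAdef, min_eq_left hl3.le, ENNReal.toNNReal_coe]
        exact jumpProcess_eq hl4 hl3
      rw [← e2, hmin _ hl5, e3, sub_left_inj] at e1
      rw [e1, sub_self, norm_zero] at hjump
      exact hε.ne hjump
    · rw [Set.indicator_of_notMem hmem, Set.indicator_of_mem (by simpa using hmem)]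
      simp

end Measurability

end WienerControl

namespace WienerControl

/-! ### Invariance, Markov property and nondegeneracy of Brownian motion. -/

section Brownian

variable {Ω : Type*} {m : MeasurableSpace Ω} {P : Measure Ω} {d : ℕ}
  {B : ℝ≥0 → Ω → Fin d → ℝ}

/-- Finite-dimensional marginals fix the law of each component, and independence makes the joint law
their product. Shift and scaling invariance then reduce to the one-dimensional statements. -/
theorem map_eq_of_isPreBrownianReal [IsProbabilityMeasure P] {X Y : ℝ≥0 → Ω → Fin d → ℝ}
    (hX : ∀ t, Measurable (X t)) (hY : ∀ t, Measurable (Y t))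
    (hX1 : ∀ i, IsPreBrownianReal (fun t ω => X t ω i) P)
    (hY1 : ∀ i, IsPreBrownianReal (fun t ω => Y t ω i) P)
    (hX2 : iIndepFun (fun (i : Fin d) (ω : Ω) (t : ℝ≥0) => X t ω i) P)
    (hY2 : iIndepFun (fun (i : Fin d) (ω : Ω) (t : ℝ≥0) => Y t ω i) P) :
    P.map (fun ω t => X t ω) = P.map (fun ω t => Y t ω) := by
  have key : ∀ Z : ℝ≥0 → Ω → Fin d → ℝ, (∀ t, Measurable (Z t)) →
      ∀ i, Measurable fun ω (t : ℝ≥0) => Z t ω i := fun Z hZ i =>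
    measurable_pi_lambda _ fun t => (measurable_pi_apply i).comp (hZ t)
  have hlaw : ∀ i, P.map (fun ω (t : ℝ≥0) => X t ω i) = P.map (fun ω (t : ℝ≥0) => Y t ω i) := by
    intro i
    refine (map_eq_iff_forall_finset_map_restrict_eq (X := fun t ω => X t ω i)
      (Y := fun t ω => Y t ω i) (key X hX i).aemeasurable (key Y hY i).aemeasurable).2 fun I => ?_
    rw [((hX1 i).hasLaw I).map_eq, ((hY1 i).hasLaw I).map_eq]
  have h1 := (iIndepFun_iff_map_fun_eq_pi_map fun i => (key X hX i).aemeasurable).1 hX2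
  have h2 := (iIndepFun_iff_map_fun_eq_pi_map fun i => (key Y hY i).aemeasurable).1 hY2
  simp_rw [hlaw] at h1
  have h3 := h1.trans h2.symm
  have hswap : Measurable fun (w : Fin d → ℝ≥0 → ℝ) (t : ℝ≥0) (i : Fin d) => w i t := by fun_prop
  have h4 := congrArg (Measure.map fun (w : Fin d → ℝ≥0 → ℝ) (t : ℝ≥0) (i : Fin d) => w i t) h3
  rw [Measure.map_map hswap (measurable_pi_lambda _ (key X hX)),
    Measure.map_map hswap (measurable_pi_lambda _ (key Y hY))] at h4
  exact h4

theorem map_shift_eq [IsProbabilityMeasure P] (hB : IsBrownianMotion B P) (r : ℝ≥0) :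
    P.map (fun ω t => B (r + t) ω - B r ω) = P.map (fun ω t => B t ω) := by
  refine map_eq_of_isPreBrownianReal (X := fun t ω => B (r + t) ω - B r ω)
    (fun t => (hB.measurable _).sub (hB.measurable _)) hB.measurable
    (fun i => (hB.component i).toIsPreBrownianReal.shift r)
    (fun i => (hB.component i).toIsPreBrownianReal) ?_ hB.indep
  exact hB.indep.comp (fun _ w t => w (r + t) - w r) fun _ => by fun_prop

theorem map_scale_eq [IsProbabilityMeasure P] (hB : IsBrownianMotion B P) {c : ℝ≥0} (hc : c ≠ 0) :
    P.map (fun ω t => (√(c : ℝ))⁻¹ • B (c * t) ω) = P.map (fun ω t => B t ω) := by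
  refine map_eq_of_isPreBrownianReal (X := fun t ω => (√(c : ℝ))⁻¹ • B (c * t) ω)
    (fun t => (hB.measurable (c * t)).const_smul ((√(c : ℝ))⁻¹)) hB.measurable
    (fun i => (hB.component i).toIsPreBrownianReal.smul hc)
    (fun i => (hB.component i).toIsPreBrownianReal) ?_ hB.indep
  exact hB.indep.comp (fun _ w t => (√(c : ℝ))⁻¹ * w (c * t)) fun _ => by fun_prop

theorem measurable_path (hB : IsBrownianMotion B P) : Measurable fun ω t => B t ω :=
  measurable_pi_lambda _ hB.measurable

theorem lintegral_scale [IsProbabilityMeasure P] (hB : IsBrownianMotion B P) {c : ℝ≥0} (hc : c ≠ 0)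
    {Φ : (ℝ≥0 → Fin d → ℝ) → ℝ≥0∞} (hΦ : Measurable Φ) :
    ∫⁻ ω, Φ (fun t => (√(c : ℝ))⁻¹ • B (c * t) ω) ∂P = ∫⁻ ω, Φ (fun t => B t ω) ∂P := by
  rw [← lintegral_map hΦ (measurable_path hB), ← map_scale_eq hB hc, lintegral_map hΦ]
  exact measurable_pi_lambda _ fun t => (hB.measurable (c * t)).const_smul ((√(c : ℝ))⁻¹)

/-- The weak Markov property: the increments after time `r` are independent of the past. -/
theorem indepFun_shift [IsProbabilityMeasure P] (hB : IsBrownianMotion B P) (r : ℝ≥0) :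
    IndepFun (fun ω t => B (r + t) ω - B r ω) (fun ω (t : Set.Iic r) => B t ω) P := by
  have hX : ∀ i, Measurable fun ω (t : ℝ≥0) => B (r + t) ω i - B r ω i := fun i =>
    measurable_pi_lambda _ fun t => ((measurable_pi_apply i).comp (hB.measurable _)).sub
      ((measurable_pi_apply i).comp (hB.measurable _))
  have hY : ∀ i, Measurable fun ω (t : Set.Iic r) => B t ω i := fun i =>
    measurable_pi_lambda _ fun t => (measurable_pi_apply i).comp (hB.measurable _)
  have h1 : iIndepFun (fun i ω => ((fun t : ℝ≥0 => B (r + t) ω i - B r ω i),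
      (fun t : Set.Iic r => B t ω i))) P :=
    hB.indep.comp (fun _ w => ((fun t => w (r + t) - w r), fun t : Set.Iic r => w t))
      fun _ => by fun_prop
  have h2 := (iIndepFun_iff_map_fun_eq_pi_map
    fun i => ((hX i).prodMk (hY i)).aemeasurable).1 h1
  have h3 : ∀ i, P.map (fun ω => ((fun t : ℝ≥0 => B (r + t) ω i - B r ω i),
      (fun t : Set.Iic r => B t ω i))) = (P.map fun ω (t : ℝ≥0) => B (r + t) ω i - B r ω i).prod
        (P.map fun ω (t : Set.Iic r) => B t ω i) := fun i =>
    (indepFun_iff_map_prod_eq_prod_map_map (hX i).aemeasurable (hY i).aemeasurable).1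
      ((hB.component i).toIsPreBrownianReal.indepFun_shift r)
  simp_rw [h3] at h2
  have hpX : ∀ i, IsProbabilityMeasure (P.map fun ω (t : ℝ≥0) => B (r + t) ω i - B r ω i) :=
    fun i => Measure.isProbabilityMeasure_map (hX i).aemeasurable
  have hpY : ∀ i, IsProbabilityMeasure (P.map fun ω (t : Set.Iic r) => B t ω i) :=
    fun i => Measure.isProbabilityMeasure_map (hY i).aemeasurable
  -- The pairs (future, past) are independent over components, and within each pair future and past
  -- are independent. Regrouping the product of products yields independence of the vector future
  -- from the vector past.
  have h4 := (measurePreserving_arrowProdEquivProdArrow _ _ _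
    (fun i => P.map fun ω (t : ℝ≥0) => B (r + t) ω i - B r ω i)
    (fun i => P.map fun ω (t : Set.Iic r) => B t ω i)).map_eq
  rw [← h2, Measure.map_map (MeasurableEquiv.measurable _)
    (measurable_pi_lambda _ fun i => (hX i).prodMk (hY i))] at h4
  have h5X := (iIndepFun_iff_map_fun_eq_pi_map fun i => (hX i).aemeasurable).1
    (hB.indep.comp (fun _ w t => w (r + t) - w r) fun _ => by fun_prop)
  have h5Y := (iIndepFun_iff_map_fun_eq_pi_map fun i => (hY i).aemeasurable).1
    (hB.indep.comp (fun _ w (t : Set.Iic r) => w t) fun _ => by fun_prop)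
  rw [← h5X, ← h5Y] at h4
  have h6 : IndepFun (fun ω i (t : ℝ≥0) => B (r + t) ω i - B r ω i)
      (fun ω i (t : Set.Iic r) => B t ω i) P :=
    (indepFun_iff_map_prod_eq_prod_map_map (measurable_pi_lambda _ hX).aemeasurable
      (measurable_pi_lambda _ hY).aemeasurable).2 h4
  exact h6.comp (φ := fun w t i => w i t) (ψ := fun w t i => w i t) (by fun_prop) (by fun_prop)

theorem setLIntegral_shift [IsProbabilityMeasure P] (hB : IsBrownianMotion B P) (r : ℝ≥0) {A : Set Ω}
    (hA : MeasurableSet[(Filtration.natural B fun t => (hB.measurable t).stronglyMeasurable) r] A)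
    {Φ : (ℝ≥0 → Fin d → ℝ) → ℝ≥0∞} (hΦ : Measurable Φ) :
    ∫⁻ ω in A, Φ (fun t => B (r + t) ω - B r ω) ∂P = P A * ∫⁻ ω, Φ (fun t => B t ω) ∂P := by
  have hAm : MeasurableSet A := Filtration.le _ r _ hA
  have hsm : Measurable fun ω t => B (r + t) ω - B r ω :=
    measurable_pi_lambda _ fun t => (hB.measurable _).sub (hB.measurable _)
  rw [Filtration.natural_eq_comap] at hA
  obtain ⟨S, hS, rfl⟩ := hA
  have hind := (indepFun_shift hB r).comp (_mγ' := ENNReal.measurableSpace) (φ := Φ)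
    (ψ := S.indicator (fun _ => (1 : ℝ≥0∞))) hΦ (measurable_const.indicator hS)
  have hYm : Measurable fun ω (t : Set.Iic r) => B t ω :=
    measurable_pi_lambda _ fun t => hB.measurable _
  have h1 := lintegral_mul_eq_lintegral_mul_lintegral_of_indepFun (hΦ.comp hsm)
    ((measurable_const.indicator hS).comp hYm) hind
  rw [← lintegral_indicator hAm]
  calc _ = ∫⁻ ω, ((Φ ∘ fun ω t => B (r + t) ω - B r ω) * ((S.indicator fun _ => (1 : ℝ≥0∞)) ∘
        fun ω (t : Set.Iic r) => B t ω)) ω ∂P := by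
        refine lintegral_congr fun ω => ?_
        by_cases h : (fun (t : Set.Iic r) => B t ω) ∈ S
        · simp [Set.indicator, h]
        · simp [Set.indicator, h]
    _ = _ := by
        rw [h1, mul_comm]
        congr 1
        · rw [← lintegral_indicator_one hAm]
          rfl
        · rw [← lintegral_map hΦ (measurable_path hB), ← map_shift_eq hB r, lintegral_map hΦ hsm]
          rfl

theorem ae_eval_zero (hB : IsBrownianMotion B P) : ∀ᵐ ω ∂P, B 0 ω = 0 := by
  have h : ∀ᵐ ω ∂P, ∀ i, B 0 ω i = 0 :=
    ae_all_iff.2 fun i => (hB.component i).toIsPreBrownianReal.eval_zero_ae_eq_zero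
  filter_upwards [h] with ω h using funext h

/-- The increment has a Gaussian law of nonzero variance, hence no atom. Over a dense sequence of
times this rules out intervals of constancy. -/
theorem ae_eval_ne (hd : 0 < d) (hB : IsBrownianMotion B P) {p q : ℝ≥0} (h : p ≠ q) :
    ∀ᵐ ω ∂P, B p ω ≠ B q ω := by
  have h1 := (hB.component ⟨0, hd⟩).toIsPreBrownianReal.hasLaw_sub p q
  have hv : nndist (p : ℝ) q ≠ 0 := by
    simpa [nndist_eq_zero] using h
  have := nullSingletonClass_gaussianReal (μ := 0) hv
  have h2 : ∀ᵐ x ∂(gaussianReal 0 (nndist (p : ℝ) q)), x ≠ 0 := by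
    simp [ae_iff]
  have h3 := h1.ae_iff (p := fun x => x ≠ 0) (by measurability) |>.2 h2
  filter_upwards [h3] with ω hω heq
  exact hω (by simp [heq])

theorem measure_abs_le_two_lt_one (hd : 0 < d) (hB : IsBrownianMotion B P) :
    P {ω | |B 1 ω ⟨0, hd⟩| ≤ 2} < 1 := by
  have h1 := (hB.component ⟨0, hd⟩).toIsPreBrownianReal.hasLaw_eval 1
  have hm : MeasurableSet {x : ℝ | |x| ≤ 2} := (isClosed_le (by fun_prop) (by fun_prop)).measurableSet
  have h2 : P {ω | |B 1 ω ⟨0, hd⟩| ≤ 2} = gaussianReal 0 1 {x : ℝ | |x| ≤ 2} := by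
    rw [← h1.map_eq, Measure.map_apply_of_aemeasurable h1.aemeasurable hm]
    rfl
  rw [h2]
  refine lt_of_le_of_ne prob_le_one fun h => ?_
  have h3 : gaussianReal 0 1 {x : ℝ | |x| ≤ 2}ᶜ = 0 := (prob_compl_eq_zero_iff hm).2 h
  have h4 := gaussianReal_absolutelyContinuous' 0 (one_ne_zero (α := ℝ≥0)) h3
  have h5 : volume (Set.Ioo (2 : ℝ) 3) ≤ volume ({x : ℝ | |x| ≤ 2}ᶜ) := by
    refine measure_mono fun x hx => ?_
    simp only [Set.mem_compl_iff, Set.mem_ofPred_eq, not_le]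
    exact hx.1.trans_le (le_abs_self x)
  rw [h4, Real.volume_Ioo] at h5
  norm_num at h5

/-- The unit increments are independent and identically distributed. The resulting geometric decay
gives `T_1` a finite mean at mesh `1`. -/
theorem measure_increments_le_two [IsProbabilityMeasure P] (hd : 0 < d) (hB : IsBrownianMotion B P) (n : ℕ) :
    P {ω | ∀ i < n, |B (i + 1) ω ⟨0, hd⟩ - B i ω ⟨0, hd⟩| ≤ 2} =
      P {ω | |B 1 ω ⟨0, hd⟩| ≤ 2} ^ n := by
  induction n with
  | zero => simp
  | succ n ih =>
    set A := {ω | ∀ i < n, |B (i + 1) ω ⟨0, hd⟩ - B i ω ⟨0, hd⟩| ≤ 2} with hA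
    have hAm : MeasurableSet[(Filtration.natural B
        fun t => (hB.measurable t).stronglyMeasurable) n] A := by
      simp only [hA]
      rw [Set.ofPred_forall]
      refine MeasurableSet.iInter fun i => ?_
      by_cases hi : i < n
      · simp only [hi, forall_const]
        have hb : ∀ j : ℕ, j ≤ n → Measurable[(Filtration.natural B
            fun t => (hB.measurable t).stronglyMeasurable) n] fun ω => B j ω ⟨0, hd⟩ := fun j hj =>
          (measurable_pi_apply _).comp (Measurable.mono (measurable_natural hB j)
            (Filtration.mono _ (by exact_mod_cast hj)) le_rfl)
        have h1 := (hb (i + 1) hi).sub (hb i hi.le)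
        rw [Nat.cast_add, Nat.cast_one] at h1
        exact h1 (isClosed_le continuous_abs continuous_const).measurableSet
      · simp [hi]
    have hS : MeasurableSet {w : ℝ≥0 → Fin d → ℝ | |w 1 ⟨0, hd⟩| ≤ 2} := by
      have : Measurable fun w : ℝ≥0 → Fin d → ℝ => w 1 ⟨0, hd⟩ := by fun_prop
      exact this (isClosed_le continuous_abs continuous_const).measurableSet
    have h2 := setLIntegral_shift hB n hAm (Φ := {w : ℝ≥0 → Fin d → ℝ | |w 1 ⟨0, hd⟩| ≤ 2}.indicator fun _ => 1)
      (measurable_const.indicator hS)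
    rw [pow_succ, ← ih]
    have hm1 : MeasurableSet {ω | |B 1 ω ⟨0, hd⟩| ≤ 2} := measurable_path hB hS
    have hsm : Measurable fun ω t => B (n + t) ω - B n ω :=
      measurable_pi_lambda _ fun t => (hB.measurable _).sub (hB.measurable _)
    have h3 : ∫⁻ ω, {w : ℝ≥0 → Fin d → ℝ | |w 1 ⟨0, hd⟩| ≤ 2}.indicator (fun _ => (1 : ℝ≥0∞))
        (fun t => B t ω) ∂P = P {ω | |B 1 ω ⟨0, hd⟩| ≤ 2} := by
      rw [← lintegral_indicator_one hm1]
      rfl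
    have h4 : ∫⁻ ω in A, {w : ℝ≥0 → Fin d → ℝ | |w 1 ⟨0, hd⟩| ≤ 2}.indicator (fun _ => (1 : ℝ≥0∞))
        (fun t => B (n + t) ω - B n ω) ∂P =
        P ({ω | |B (n + 1) ω ⟨0, hd⟩ - B n ω ⟨0, hd⟩| ≤ 2} ∩ A) := by
      have hm2 : MeasurableSet {ω | |B (n + 1) ω ⟨0, hd⟩ - B n ω ⟨0, hd⟩| ≤ 2} := hsm hS
      rw [← Measure.restrict_apply hm2, ← lintegral_indicator_one hm2]
      rfl
    rw [h3, h4] at h2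
    rw [← h2]
    congr 1
    ext ω
    simp only [hA, Set.mem_ofPred_eq, Set.mem_inter_iff, Nat.lt_succ_iff_lt_or_eq]
    constructor
    · exact fun h => ⟨h n (Or.inr rfl), fun i hi => h i (Or.inl hi)⟩
    · rintro ⟨h1, h2⟩ i (hi | rfl)
      exacts [h2 i hi, h1]

end Brownian

end WienerControl

noncomputable section

namespace WienerControl

/-! ### Laplace transforms of random times -/

/-- The function `t ↦ e^{-ct}` on extended times. -/
def expNeg (c : ℝ) (t : ℝ≥0∞) : ℝ≥0∞ :=
  if t = ⊤ then 0 else ENNReal.ofReal (Real.exp (-(c * t.toReal)))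

section ExpNeg

variable {c : ℝ}

theorem expNeg_top : expNeg c ⊤ = 0 := by simp [expNeg]

theorem expNeg_of_ne_top {t : ℝ≥0∞} (h : t ≠ ⊤) :
    expNeg c t = ENNReal.ofReal (Real.exp (-(c * t.toReal))) := by simp [expNeg, h]

theorem expNeg_antitone (hc : 0 ≤ c) : Antitone (expNeg c) := by
  intro s t hst
  by_cases ht : t = ⊤
  · simp [ht, expNeg_top]
  · have hs : s ≠ ⊤ := ne_top_of_le_ne_top ht hst
    rw [expNeg_of_ne_top ht, expNeg_of_ne_top hs]
    gcongr

theorem measurable_expNeg (hc : 0 ≤ c) : Measurable (expNeg c) := (expNeg_antitone hc).measurable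

theorem expNeg_zero : expNeg c 0 = 1 := by simp [expNeg]

theorem expNeg_add (s t : ℝ≥0∞) : expNeg c (s + t) = expNeg c s * expNeg c t := by
  by_cases hs : s = ⊤
  · simp [hs, expNeg_top]
  by_cases ht : t = ⊤
  · simp [ht, expNeg_top]
  rw [expNeg_of_ne_top hs, expNeg_of_ne_top ht, expNeg_of_ne_top (ENNReal.add_ne_top.2 ⟨hs, ht⟩),
    ← ENNReal.ofReal_mul (Real.exp_pos _).le, ← Real.exp_add, ENNReal.toReal_add hs ht]
  congr 2
  ring

theorem expNeg_mul {x : ℝ≥0} (hx : x ≠ 0) (t : ℝ≥0∞) : expNeg c (x * t) = expNeg (c * x) t := by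
  by_cases ht : t = ⊤
  · simp [ht, ENNReal.mul_top, hx, expNeg_top]
  rw [expNeg_of_ne_top ht, expNeg_of_ne_top (ENNReal.mul_ne_top ENNReal.coe_ne_top ht),
    ENNReal.toReal_mul, ENNReal.coe_toReal, mul_assoc]

end ExpNeg

/-- The first time (along a countable dense set) at which the path `w` leaves the closed cube of
size `ρ`. -/
def passageTime {d : ℕ} (ρ : ℝ) (w : ℝ≥0 → Fin d → ℝ) : ℝ≥0∞ :=
  ⨅ i : ℕ, {w : ℝ≥0 → Fin d → ℝ | ‖w (TopologicalSpace.denseSeq ℝ≥0 i)‖ ≤ ρ}.indicator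
    (fun _ => ⊤) w + (TopologicalSpace.denseSeq ℝ≥0 i : ℝ≥0∞)

section PassageTime

variable {d : ℕ} {ρ : ℝ}

/-- The countable infimum gives measurability on the whole product space, where the laws of shifted
and scaled paths are compared. Continuity of the path enters only in `passageTime_le`. -/
theorem measurable_passageTime : Measurable (passageTime (d := d) ρ) := by
  refine Measurable.iInf fun i => (measurable_const.indicator ?_).add measurable_const
  have : Measurable fun w : ℝ≥0 → Fin d → ℝ => ‖w (TopologicalSpace.denseSeq ℝ≥0 i)‖ :=
    (measurable_pi_apply _).norm
  exact this measurableSet_Iic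

theorem passageTime_le_denseSeq {w : ℝ≥0 → Fin d → ℝ} {i : ℕ}
    (h : ρ < ‖w (TopologicalSpace.denseSeq ℝ≥0 i)‖) :
    passageTime ρ w ≤ TopologicalSpace.denseSeq ℝ≥0 i := by
  refine (iInf_le _ i).trans ?_
  rw [Set.indicator_of_notMem (by simpa using h), zero_add]

theorem le_passageTime {w : ℝ≥0 → Fin d → ℝ} {x : ℝ≥0∞}
    (h : ∀ t : ℝ≥0, ρ < ‖w t‖ → x ≤ t) : x ≤ passageTime ρ w := by
  refine le_iInf fun i => ?_
  by_cases hi : ‖w (TopologicalSpace.denseSeq ℝ≥0 i)‖ ≤ ρ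
  · rw [Set.indicator_of_mem (by exact hi)]
    simp
  · rw [Set.indicator_of_notMem (by exact hi), zero_add]
    exact h _ (not_le.1 hi)

theorem exists_denseSeq_mem {U : Set ℝ≥0} (hU : IsOpen U) {t : ℝ≥0} (ht : t ∈ U) {y : ℝ≥0}
    (hy : t < y) : ∃ i, t < TopologicalSpace.denseSeq ℝ≥0 i ∧ TopologicalSpace.denseSeq ℝ≥0 i < y ∧
      TopologicalSpace.denseSeq ℝ≥0 i ∈ U := by
  have h1 : ∀ᶠ s in 𝓝[>] t, s ∈ U ∧ s ∈ Set.Ioo t y :=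
    ((hU.eventually_mem ht).filter_mono nhdsWithin_le_nhds).and (Ioo_mem_nhdsGT hy)
  obtain ⟨s, hs1, hs2⟩ := h1.exists
  obtain ⟨_, hs, i, rfl⟩ := (TopologicalSpace.denseRange_denseSeq ℝ≥0).inter_open_nonempty _
    (hU.inter isOpen_Ioo) ⟨s, hs1, hs2⟩
  exact ⟨i, hs.2.1, hs.2.2, hs.1⟩

theorem passageTime_le {w : ℝ≥0 → Fin d → ℝ} (hw : Continuous w) {t : ℝ≥0} (h : ρ < ‖w t‖) :
    passageTime ρ w ≤ t := by
  refine le_of_forall_gt fun b hb => ?_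
  obtain ⟨y, hy, hyb⟩ := ENNReal.lt_iff_exists_nnreal_btwn.1 hb
  obtain ⟨i, -, hi2, hi3⟩ := exists_denseSeq_mem (isOpen_lt continuous_const hw.norm) h
    (by exact_mod_cast hy : t < y)
  exact (passageTime_le_denseSeq hi3).trans_lt (lt_trans (by exact_mod_cast hi2) hyb)

end PassageTime

/-! ### Laplace transform of `T_n` and the time covered by the skeleton. -/

section Skeleton

variable {Ω : Type*} {m : MeasurableSpace Ω} {P : Measure Ω} {d : ℕ}
  {B : ℝ≥0 → Ω → Fin d → ℝ} {ε c ρ : ℝ}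

/-- Scaling and comparison with the skeleton of mesh `1`. -/
theorem lintegral_expNeg_passageTime_le [IsProbabilityMeasure P] (hB : IsBrownianMotion B P)
    (hc : 0 ≤ c) (hρ : 0 < ρ) :
    ∫⁻ ω, expNeg c (passageTime ρ fun t => B t ω) ∂P ≤
      ∫⁻ ω, expNeg (c * ρ ^ 2) (hitTime B 1 1 ω) ∂P := by
  lift ρ to ℝ≥0 using hρ.le
  have hρ' : ρ ≠ 0 := by rintro rfl; simp at hρ
  have hρ2 : ρ ^ 2 ≠ 0 := pow_ne_zero 2 hρ'
  have hc2 : 0 ≤ c * (ρ : ℝ) ^ 2 := by positivity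
  have hsqrt : √((ρ ^ 2 : ℝ≥0) : ℝ) = ρ := by
    rw [NNReal.coe_pow]
    exact Real.sqrt_sq ρ.2
  calc ∫⁻ ω, expNeg c (passageTime ρ fun t => B t ω) ∂P
      ≤ ∫⁻ ω, expNeg (c * ρ ^ 2) (passageTime 1
          fun t => (√((ρ ^ 2 : ℝ≥0) : ℝ))⁻¹ • B (ρ ^ 2 * t) ω) ∂P := by
        refine lintegral_mono fun ω => ?_
        have hcont := hB.continuous_path ω
        -- Brownian scaling by `ρ²` turns passage beyond radius `ρ` into passage beyond radius `1`.
        -- One inequality suffices, since `expNeg` is antitone.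
        have h1 : ((ρ ^ 2 : ℝ≥0) : ℝ≥0∞) * passageTime 1
            (fun t => (√((ρ ^ 2 : ℝ≥0) : ℝ))⁻¹ • B (ρ ^ 2 * t) ω) ≤
              passageTime ρ fun t => B t ω := by
          refine le_passageTime fun t ht => ?_
          have h2 : passageTime 1 (fun t => (√((ρ ^ 2 : ℝ≥0) : ℝ))⁻¹ • B (ρ ^ 2 * t) ω) ≤
              ((ρ ^ 2)⁻¹ * t : ℝ≥0) := by
            refine passageTime_le (by fun_prop) ?_
            rw [mul_inv_cancel_left₀ hρ2, hsqrt, norm_smul, norm_inv, NNReal.norm_eq,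
              lt_inv_mul_iff₀ hρ, mul_one]
            exact ht
          calc _ ≤ ((ρ ^ 2 : ℝ≥0) : ℝ≥0∞) * ((ρ ^ 2)⁻¹ * t : ℝ≥0) := by gcongr
            _ = t := by rw [← ENNReal.coe_mul, mul_inv_cancel_left₀ hρ2]
        have h3 := expNeg_antitone hc h1
        rw [expNeg_mul hρ2] at h3
        exact_mod_cast h3
    _ = ∫⁻ ω, expNeg (c * ρ ^ 2) (passageTime 1 fun t => B t ω) ∂P :=
        lintegral_scale (Φ := fun w => expNeg (c * ρ ^ 2) (passageTime 1 w)) hB hρ2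
          ((measurable_expNeg hc2).comp measurable_passageTime)
    _ ≤ _ := by
        refine lintegral_mono_ae ?_
        filter_upwards [ae_eval_zero hB] with ω h0
        refine expNeg_antitone hc2 (le_passageTime fun t ht => ?_)
        by_contra! hcon
        have := norm_sub_hitTime_lt (n := 0) (hB.continuous_path ω) one_pos (by simp [hitTime]) hcon
        simp only [hitTime, ENNReal.toNNReal_zero, h0, sub_zero] at this
        exact lt_asymm ht this

/-- The discretisation of the `n`-th hitting time to the grid of size `h`. -/
def hitGrid (B : ℝ≥0 → Ω → Fin d → ℝ) (ε : ℝ) (n : ℕ) (h : ℝ≥0) (k : ℕ) : Set Ω :=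
  {ω | ((k * h : ℝ≥0) : ℝ≥0∞) ≤ hitTime B ε n ω ∧ hitTime B ε n ω < ((k + 1) * h : ℝ≥0)}

theorem measurableSet_hitGrid (hB : IsBrownianMotion B P) (hε : 0 < ε) (n : ℕ) (h : ℝ≥0) (k : ℕ) :
    MeasurableSet[(Filtration.natural B fun t => (hB.measurable t).stronglyMeasurable)
      ((k + 1) * h)] (hitGrid B ε n h k) := by
  have h1 := measurableSet_hitTime_lt (measurable_natural hB) hB.continuous_path hε n (k * h)
  have h2 := measurableSet_hitTime_lt (measurable_natural hB) hB.continuous_path hε n ((k + 1) * h)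
  have hle : (k * h : ℝ≥0) ≤ (k + 1) * h := by gcongr; simp
  convert ((Filtration.natural B fun t => (hB.measurable t).stronglyMeasurable).mono hle _
    h1).compl.inter h2 using 1
  ext ω
  simp [hitGrid]

/-- `T_n` is rounded up to a grid of size `h`, where the Markov property at deterministic times
applies cell by cell. Restarting slightly after `T_n` perturbs the increment that reaches norm `ε`.
The margin `ρ < ε` keeps it above `ρ`, and the slack `δ` absorbs the delay. Fatou's lemma then
removes the grid. -/
theorem lintegral_expNeg_add_le [IsProbabilityMeasure P] (hB : IsBrownianMotion B P) (hc : 0 ≤ c)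
    (hρε : ρ < ε) (hε : 0 < ε) (n : ℕ) {δ : ℝ≥0} (hδ : 0 < δ) :
    ∫⁻ ω, expNeg c (hitTime B ε (n + 1) ω + δ) ∂P ≤
      (∫⁻ ω, expNeg c (hitTime B ε n ω) ∂P) *
        ∫⁻ ω, expNeg c (passageTime ρ fun t => B t ω) ∂P := by
  set h : ℕ → ℝ≥0 := fun l => 1 / (l + 1) with hh
  have hpos : ∀ l, 0 < h l := fun l => by simp only [hh]; positivity
  have hgm : ∀ l k, MeasurableSet (hitGrid B ε n (h l) k) := fun l k =>
    Filtration.le _ _ _ (measurableSet_hitGrid hB hε n (h l) k)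
  have hΦm : Measurable fun w : ℝ≥0 → Fin d → ℝ => expNeg c (passageTime ρ w) :=
    (measurable_expNeg hc).comp measurable_passageTime
  have hsm : ∀ s, Measurable fun ω t => B (s + t) ω - B s ω := fun s =>
    measurable_pi_lambda _ fun t => (hB.measurable _).sub (hB.measurable _)
  -- On the cell `kh ≤ T_n < (k+1)h`, `G l` is the product of `e^{-c(k+1)h}` and the Laplace factor
  -- of the path restarted at `(k+1)h`. The cell belongs to the past of `(k+1)h`, so expectations
  -- factor.
  set G : ℕ → Ω → ℝ≥0∞ := fun l ω => ∑' k : ℕ, (hitGrid B ε n (h l) k).indicator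
    (fun ω => expNeg c ((k + 1) * h l : ℝ≥0) *
      expNeg c (passageTime ρ fun t => B ((k + 1) * h l + t) ω - B ((k + 1) * h l) ω)) ω with hG
  have hterm : ∀ (l : ℕ) (k : ℕ), Measurable fun ω => expNeg c ((k + 1) * h l : ℝ≥0) *
      expNeg c (passageTime ρ fun t => B ((k + 1) * h l + t) ω - B ((k + 1) * h l) ω) :=
    fun l k => measurable_const.mul (hΦm.comp (hsm _))
  have hGm : ∀ l, Measurable (G l) := fun l =>
    Measurable.tsum fun k => (hterm l k).indicator (hgm l k)
  have hGint : ∀ l, ∫⁻ ω, G l ω ∂P ≤ (∫⁻ ω, expNeg c (hitTime B ε n ω) ∂P) *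
      ∫⁻ ω, expNeg c (passageTime ρ fun t => B t ω) ∂P := by
    intro l
    have hdisj : Pairwise (Function.onFun Disjoint (hitGrid B ε n (h l))) := by
      refine (pairwise_disjoint_on _).2 fun i j hij => Set.disjoint_left.2 fun ω h1 h2 => ?_
      have h3 : ((i + 1) * h l : ℝ≥0) ≤ j * h l := by
        gcongr
        exact_mod_cast hij
      exact absurd ((ENNReal.coe_le_coe.2 h3).trans h2.1) (not_le.2 h1.2)
    calc ∫⁻ ω, G l ω ∂P = ∑' k : ℕ, ∫⁻ ω in hitGrid B ε n (h l) k,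
          expNeg c ((k + 1) * h l : ℝ≥0) * expNeg c (passageTime ρ
            fun t => B ((k + 1) * h l + t) ω - B ((k + 1) * h l) ω) ∂P := by
          rw [lintegral_tsum fun k => ((hterm l k).indicator (hgm l k)).aemeasurable]
          exact tsum_congr fun k => lintegral_indicator (hgm l k) _
      _ = ∑' k : ℕ, (expNeg c ((k + 1) * h l : ℝ≥0) * P (hitGrid B ε n (h l) k)) *
          ∫⁻ ω, expNeg c (passageTime ρ fun t => B t ω) ∂P := by
          refine tsum_congr fun k => ?_
          rw [lintegral_const_mul _ (by exact hΦm.comp (hsm _)),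
            setLIntegral_shift (Φ := fun w => expNeg c (passageTime ρ w)) hB _
              (measurableSet_hitGrid hB hε n (h l) k) hΦm, mul_assoc]
      _ = (∑' k : ℕ, expNeg c ((k + 1) * h l : ℝ≥0) * P (hitGrid B ε n (h l) k)) *
          ∫⁻ ω, expNeg c (passageTime ρ fun t => B t ω) ∂P := ENNReal.tsum_mul_right
      _ ≤ _ := by
          gcongr
          calc _ ≤ ∑' k : ℕ, ∫⁻ ω in hitGrid B ε n (h l) k, expNeg c (hitTime B ε n ω) ∂P := by
                refine ENNReal.tsum_le_tsum fun k => ?_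
                rw [← setLIntegral_const]
                exact setLIntegral_mono_ae' (hgm l k)
                  (Eventually.of_forall fun ω hω => expNeg_antitone hc hω.2.le)
            _ = ∫⁻ ω in ⋃ k, hitGrid B ε n (h l) k, expNeg c (hitTime B ε n ω) ∂P :=
                (lintegral_iUnion (hgm l) hdisj _).symm
            _ ≤ _ := setLIntegral_le_lintegral _ _
  have hpt : ∀ ω, expNeg c (hitTime B ε (n + 1) ω + δ) ≤ liminf (fun l => G l ω) atTop := by
    intro ω
    by_cases htop : hitTime B ε (n + 1) ω = ⊤
    · simp [htop, expNeg_top]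
    have hcont := hB.continuous_path ω
    obtain ⟨hlt, hjump⟩ := hitTime_succ_mem hcont hε htop
    have hne := hlt.ne_top
    obtain ⟨S, hS⟩ : ∃ S : ℝ≥0, hitTime B ε n ω = S := ⟨_, (ENNReal.coe_toNNReal hne).symm⟩
    obtain ⟨S', hS'⟩ : ∃ S' : ℝ≥0, hitTime B ε (n + 1) ω = S' :=
      ⟨_, (ENNReal.coe_toNNReal htop).symm⟩
    rw [hS, hS', ENNReal.coe_lt_coe] at hlt
    rw [hS, hS', ENNReal.toNNReal_coe, ENNReal.toNNReal_coe] at hjump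
    have hD : S + (S' - S) = S' := add_tsub_cancel_of_le hlt.le
    -- A dense time `q` slightly above `T_{n+1} - T_n` at which the increment from `S = T_n` still
    -- exceeds `ρ`. By openness the same `q` serves for all starting points near `S`.
    obtain ⟨i, -, hi2, hi3⟩ := exists_denseSeq_mem (U := {s | ρ < ‖B (S + s) ω - B S ω‖})
      (isOpen_lt continuous_const (by fun_prop)) (t := S' - S) (by
        simp only [Set.mem_ofPred_eq, hD, hjump]
        exact hρε) (y := S' - S + δ / 2) (by simp [hδ])
    set q := TopologicalSpace.denseSeq ℝ≥0 i with hq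
    have hopen : IsOpen {s : ℝ≥0 | ρ < ‖B (s + q) ω - B s ω‖} :=
      isOpen_lt continuous_const (by fun_prop)
    have hball := Metric.isOpen_iff.1 hopen S hi3
    obtain ⟨η, hη, hηs⟩ := hball
    have hlim : Tendsto h atTop (𝓝 0) := tendsto_one_div_add_atTop_nhds_zero_nat (𝕜 := ℝ≥0)
    have hev : ∀ᶠ l in atTop, h l < δ / 2 ∧ h l < ⟨η, hη.le⟩ :=
      (hlim.eventually_lt_const (by positivity)).and (hlim.eventually_lt_const hη)
    refine le_liminf_of_le (by isBoundedDefault) ?_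
    filter_upwards [hev] with l ⟨hl1, hl2⟩
    set k := ⌊S / h l⌋₊ with hk
    have hk1 : k * h l ≤ S := by
      rw [← le_div_iff₀ (hpos l)]
      exact Nat.floor_le zero_le
    have hk2 : S < (k + 1) * h l := by
      rw [← div_lt_iff₀ (hpos l)]
      exact Nat.lt_floor_add_one _
    have hmem : ω ∈ hitGrid B ε n (h l) k := by
      simp only [hitGrid, Set.mem_ofPred_eq, hS]
      exact ⟨by exact_mod_cast hk1, by exact_mod_cast hk2⟩
    refine le_trans ?_ (ENNReal.le_tsum k)
    rw [Set.indicator_of_mem hmem, ← expNeg_add, hS']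
    refine expNeg_antitone hc ?_
    have hk3 : (k + 1) * h l ≤ S + h l := by
      rw [add_mul, one_mul]
      gcongr
    have hball2 : ((k + 1) * h l : ℝ≥0) ∈ Metric.ball S η := by
      rw [Metric.mem_ball, NNReal.dist_eq, abs_of_nonneg (sub_nonneg.2 (by exact_mod_cast hk2.le))]
      have : (((k + 1) * h l : ℝ≥0) : ℝ) ≤ S + h l := by exact_mod_cast hk3
      have h3 : (h l : ℝ) < η := hl2
      linarith
    have hpass := passageTime_le_denseSeq (w := fun t => B ((k + 1) * h l + t) ω -
      B ((k + 1) * h l) ω) (i := i) (hηs hball2)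
    calc _ ≤ (((k + 1) * h l : ℝ≥0) : ℝ≥0∞) + q := by gcongr
      _ ≤ ((S + δ / 2 : ℝ≥0) : ℝ≥0∞) + (S' - S + δ / 2 : ℝ≥0) := by
          gcongr
          exact hk3.trans (by gcongr)
      _ = S' + δ := by
          rw [← ENNReal.coe_add, ← ENNReal.coe_add]
          congr 1
          calc S + δ / 2 + (S' - S + δ / 2) = (S + (S' - S)) + (δ / 2 + δ / 2) := by ring
            _ = _ := by rw [hD, add_halves]
  calc _ ≤ ∫⁻ ω, liminf (fun l => G l ω) atTop ∂P := lintegral_mono hpt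
    _ ≤ liminf (fun l => ∫⁻ ω, G l ω ∂P) atTop := lintegral_liminf_le hGm
    _ ≤ _ := liminf_le_of_le (by isBoundedDefault) fun b hb => by
        obtain ⟨l, hl⟩ := hb.exists
        exact hl.trans (hGint l)

/-- A strong Markov inequality for the Laplace transform of the hitting times. -/
theorem lintegral_expNeg_hitTime_succ_le [IsProbabilityMeasure P] (hB : IsBrownianMotion B P)
    (hc : 0 ≤ c) (hρε : ρ < ε) (hε : 0 < ε) (n : ℕ) :
    ∫⁻ ω, expNeg c (hitTime B ε (n + 1) ω) ∂P ≤
      (∫⁻ ω, expNeg c (hitTime B ε n ω) ∂P) *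
        ∫⁻ ω, expNeg c (passageTime ρ fun t => B t ω) ∂P := by
  have hlim : Tendsto (fun x : ℝ≥0 => (∫⁻ ω, expNeg c (hitTime B ε (n + 1) ω) ∂P) *
      ENNReal.ofReal (Real.exp (-(c * x)))) (𝓝[>] 0)
      (𝓝 ((∫⁻ ω, expNeg c (hitTime B ε (n + 1) ω) ∂P) * ENNReal.ofReal (Real.exp (-(c * 0))))) := by
    refine ENNReal.Tendsto.const_mul ?_ (Or.inl (by simp))
    refine (ENNReal.continuous_ofReal.tendsto _).comp ?_
    refine Tendsto.mono_left ?_ nhdsWithin_le_nhds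
    exact (by fun_prop : Continuous fun x : ℝ≥0 => Real.exp (-(c * x))).tendsto' 0 _ (by simp)
  rw [mul_zero, neg_zero, Real.exp_zero, ENNReal.ofReal_one, mul_one] at hlim
  refine le_of_tendsto hlim ?_
  filter_upwards [self_mem_nhdsWithin] with x hx
  refine le_trans (le_of_eq ?_) (lintegral_expNeg_add_le hB hc hρε hε n hx)
  simp_rw [expNeg_add]
  rw [lintegral_mul_const _ (by
    exact (measurable_expNeg hc).comp
      (measurable_hitTime hB.measurable hB.continuous_path hε _)), expNeg_of_ne_top (by simp)]
  rfl

theorem lintegral_expNeg_hitTime_le [IsProbabilityMeasure P] (hB : IsBrownianMotion B P)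
    (hc : 0 ≤ c) (hρ : 0 < ρ) (hρε : ρ < ε) (n : ℕ) :
    ∫⁻ ω, expNeg c (hitTime B ε n ω) ∂P ≤
      (∫⁻ ω, expNeg (c * ρ ^ 2) (hitTime B 1 1 ω) ∂P) ^ n := by
  induction n with
  | zero => simp [hitTime, expNeg_zero]
  | succ n ih =>
    rw [pow_succ]
    exact (lintegral_expNeg_hitTime_succ_le hB hc hρε (hρ.trans hρε) n).trans
      (mul_le_mul' ih (lintegral_expNeg_passageTime_le hB hc hρ))

/-- Integrated, this bounds the mean of a random time by the sum of the tails `P(T > n)`. -/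
theorem ENNReal_le_tsum_indicator (x : ℝ≥0∞) :
    x ≤ ∑' n : ℕ, {y : ℝ≥0∞ | (n : ℝ≥0∞) < y}.indicator (fun _ => 1) x := by
  have hmin : ∀ N : ℕ, min x N ≤
      ∑ n ∈ Finset.range N, {y : ℝ≥0∞ | (n : ℝ≥0∞) < y}.indicator (fun _ => (1 : ℝ≥0∞)) x := by
    intro N
    induction N with
    | zero => simp
    | succ N ih =>
      rw [Finset.sum_range_succ]
      rcases le_or_gt x N with h | h
      · refine le_trans ?_ (ih.trans le_self_add)
        rw [min_eq_left h]
        exact min_le_left _ _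
      · rw [Set.indicator_of_mem (by exact h)]
        rw [min_eq_right h.le] at ih
        refine (min_le_right _ _).trans ?_
        push_cast
        gcongr
  by_cases hx : x = ⊤
  · subst hx
    have : ∀ n : ℕ, {y : ℝ≥0∞ | (n : ℝ≥0∞) < y}.indicator (fun _ => (1 : ℝ≥0∞)) ⊤ = 1 := fun n =>
      Set.indicator_of_mem (by simp) _
    simp_rw [this]
    rw [ENNReal.tsum_const_eq_top_of_ne_zero one_ne_zero]
  · obtain ⟨N, hN⟩ := ENNReal.exists_nat_gt hx
    have := hmin N
    rw [min_eq_left hN.le] at this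
    exact this.trans (ENNReal.sum_le_tsum _)

/-- Before `T_1` the path stays within `1` of its start, so on `{T_1 > n}` the first `n` unit
increments are at most `2`, an event of geometrically small probability. -/
theorem lintegral_hitTime_one_ne_top [IsProbabilityMeasure P] (hd : 0 < d)
    (hB : IsBrownianMotion B P) : ∫⁻ ω, hitTime B 1 1 ω ∂P ≠ ⊤ := by
  have hm := measurable_hitTime hB.measurable hB.continuous_path one_pos 1
  have hset : ∀ n : ℕ, MeasurableSet {ω | (n : ℝ≥0∞) < hitTime B 1 1 ω} := fun n =>
    hm measurableSet_Ioi
  have hle : ∫⁻ ω, hitTime B 1 1 ω ∂P ≤ ∑' n : ℕ, P {ω | |B 1 ω ⟨0, hd⟩| ≤ 2} ^ n := by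
    calc _ ≤ ∫⁻ ω, ∑' n : ℕ, {ω | (n : ℝ≥0∞) < hitTime B 1 1 ω}.indicator (fun _ => 1) ω ∂P :=
          lintegral_mono fun ω => ENNReal_le_tsum_indicator _
      _ = ∑' n : ℕ, P {ω | (n : ℝ≥0∞) < hitTime B 1 1 ω} := by
          rw [lintegral_tsum fun n => (measurable_const.indicator (hset n)).aemeasurable]
          exact tsum_congr fun n => lintegral_indicator_one (hset n)
      _ ≤ _ := by
          refine ENNReal.tsum_le_tsum fun n => ?_
          rw [← measure_increments_le_two hd hB n]
          refine measure_mono fun ω (hω : (n : ℝ≥0∞) < hitTime B 1 1 ω) i hi => ?_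
          have key : ∀ j : ℕ, j ≤ n → |B j ω ⟨0, hd⟩ - B 0 ω ⟨0, hd⟩| < 1 := fun j hj => by
            have h1 := norm_sub_hitTime_lt (n := 0) (t := j) (hB.continuous_path ω) one_pos
              (by simp [hitTime]) (lt_of_le_of_lt (by simpa using hj) hω)
            refine lt_of_le_of_lt ?_ h1
            have h2 := norm_le_pi_norm (B j ω - B (hitTime B 1 0 ω).toNNReal ω) ⟨0, hd⟩
            simpa [hitTime] using h2
          have h1 := key i hi.le
          have h2 := key (i + 1) hi
          push_cast at h2
          rw [abs_lt] at h1 h2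
          rw [abs_le]
          constructor <;> linarith [h1.1, h1.2, h2.1, h2.2]
  refine ne_top_of_le_ne_top ?_ hle
  rw [ENNReal.tsum_geometric]
  exact ENNReal.inv_ne_top.2 (tsub_pos_of_lt (measure_abs_le_two_lt_one hd hB)).ne'

/-- The maximum norm first reaches `1` when some component does. This identifies `χ_d` with the mean
of `T_1` at mesh `1`. -/
theorem iInf_exitTime_eq (hB : IsBrownianMotion B P) {ω : Ω} (h0 : B 0 ω = 0) :
    ⨅ j, exitTime B j ω = hitTime B 1 1 ω := by
  have hc := hB.continuous_path ω
  refine le_antisymm ?_ (le_iInf fun j => le_sInf ?_)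
  · by_cases htop : hitTime B 1 1 ω = ⊤
    · simp [htop]
    obtain ⟨hlt, heq⟩ := hitTime_succ_mem (n := 0) hc one_pos htop
    simp only [zero_add, hitTime_zero, ENNReal.toNNReal_zero, h0, sub_zero] at heq hlt
    obtain ⟨j, hj⟩ : ∃ j, 1 ≤ ‖B (hitTime B 1 1 ω).toNNReal ω j‖ := by
      by_contra! hcon
      exact absurd ((pi_norm_lt_iff one_pos).2 hcon) (not_lt.2 heq.ge)
    refine (iInf_le _ j).trans (sInf_le ⟨(hitTime B 1 1 ω).toNNReal, ⟨?_, ?_⟩, ?_⟩)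
    · exact ENNReal.toNNReal_pos hlt.ne' htop
    · exact le_antisymm ((norm_le_pi_norm _ j).trans_eq heq) hj
    · exact ENNReal.coe_toNNReal htop
  · rintro _ ⟨t, ⟨ht0, ht⟩, rfl⟩
    by_contra! hcon
    have h1 := norm_sub_hitTime_lt (n := 0) hc one_pos (by simp [hitTime]) hcon
    simp only [hitTime, ENNReal.toNNReal_zero, h0, sub_zero] at h1
    have h2 := norm_le_pi_norm (B t ω) j
    rw [Real.norm_eq_abs, ht] at h2
    exact absurd h1 (not_lt.2 h2)

theorem chi_eq (hB : IsBrownianMotion B P) :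
    chi B P = (∫⁻ ω, hitTime B 1 1 ω ∂P).toReal := by
  rw [chi]
  congr 1
  refine lintegral_congr_ae ?_
  filter_upwards [ae_eval_zero hB] with ω h0 using iInf_exitTime_eq hB h0

theorem chi_pos [IsProbabilityMeasure P] (hd : 0 < d) (hB : IsBrownianMotion B P) :
    0 < chi B P := by
  rw [chi_eq hB]
  refine ENNReal.toReal_pos (fun h => ?_) (lintegral_hitTime_one_ne_top hd hB)
  rw [lintegral_eq_zero_iff (measurable_hitTime hB.measurable hB.continuous_path one_pos 1)] at h
  obtain ⟨ω, hω⟩ := h.exists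
  have : hitTime B 1 0 ω < hitTime B 1 1 ω :=
    hitTime_lt_succ (n := 0) (hB.continuous_path ω) one_pos (by simp [hitTime])
  rw [hω] at this
  exact not_lt_bot this

/-- By dominated convergence with dominating function `τ = T_1`, `(1 - E e^{-hτ}) / h` tends to `E τ
= χ` as `h ↓ 0`. For small `h` this gives `E e^{-hτ} ≤ 1 - hχ' ≤ e^{-hχ'}`. -/
theorem exists_lintegral_expNeg_le [IsProbabilityMeasure P] (hd : 0 < d)
    (hB : IsBrownianMotion B P) {χ' : ℝ} (hχ : χ' < chi B P) :
    ∃ h₀ > 0, ∀ h, 0 < h → h < h₀ →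
      ∫⁻ ω, expNeg h (hitTime B 1 1 ω) ∂P ≤ ENNReal.ofReal (Real.exp (-(h * χ'))) := by
  have hm := measurable_hitTime hB.measurable hB.continuous_path one_pos 1
  have hfin := lintegral_hitTime_one_ne_top hd hB
  have hint : Integrable (fun ω => (hitTime B 1 1 ω).toReal) P :=
    integrable_toReal_of_lintegral_ne_top hm.aemeasurable hfin
  have hae : ∀ᵐ ω ∂P, hitTime B 1 1 ω < ⊤ := ae_lt_top hm hfin
  have hchi : chi B P = ∫ ω, (hitTime B 1 1 ω).toReal ∂P := by
    rw [chi_eq hB, integral_toReal hm.aemeasurable hae]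
  have hexpm : ∀ h : ℝ, Measurable fun ω => Real.exp (-(h * (hitTime B 1 1 ω).toReal)) := fun h =>
    (hm.ennreal_toReal.const_mul h).neg.exp
  have hexpi : ∀ h : ℝ, 0 < h →
      Integrable (fun ω => Real.exp (-(h * (hitTime B 1 1 ω).toReal))) P := fun h hh =>
    Integrable.of_bound (hexpm h).aestronglyMeasurable 1 (Eventually.of_forall fun ω => by
      rw [Real.norm_of_nonneg (Real.exp_pos _).le]
      exact Real.exp_le_one_iff.2 (neg_nonpos.2 (by positivity)))
  have hlim : Tendsto (fun h : ℝ => ∫ ω, (1 - Real.exp (-(h * (hitTime B 1 1 ω).toReal))) / h ∂P)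
      (𝓝[>] 0) (𝓝 (chi B P)) := by
    rw [hchi]
    refine tendsto_integral_filter_of_dominated_convergence
      (fun ω => (hitTime B 1 1 ω).toReal) ?_ ?_ hint ?_
    · exact Eventually.of_forall fun h =>
        (((hexpm h).const_sub 1).div_const h).aestronglyMeasurable
    · filter_upwards [self_mem_nhdsWithin] with h (hh : 0 < h)
      refine Eventually.of_forall fun ω => ?_
      have h1 : Real.exp (-(h * (hitTime B 1 1 ω).toReal)) ≤ 1 :=
        Real.exp_le_one_iff.2 (neg_nonpos.2 (by positivity))
      have h2 := Real.add_one_le_exp (-(h * (hitTime B 1 1 ω).toReal))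
      rw [Real.norm_of_nonneg (div_nonneg (by linarith) hh.le), div_le_iff₀ hh]
      linarith
    · refine Eventually.of_forall fun ω => ?_
      set x := (hitTime B 1 1 ω).toReal
      have hd : HasDerivAt (fun h : ℝ => -Real.exp (-(h * x))) x 0 := by
        have h1 : HasDerivAt (fun h : ℝ => -(h * x)) (-x) 0 := by
          simpa using ((hasDerivAt_id (0 : ℝ)).mul_const x).fun_neg
        simpa using h1.exp.fun_neg
      have h2 := hd.tendsto_slope.mono_left (nhdsWithin_mono 0
        (fun y (hy : 0 < y) => hy.ne'))
      refine h2.congr fun h => ?_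
      simp [slope_def_field]
      ring
  have hev := (hlim.eventually_const_lt hχ).and self_mem_nhdsWithin
  obtain ⟨h₀, hh₀, hsub⟩ := mem_nhdsGT_iff_exists_Ioo_subset.1 hev
  refine ⟨h₀, hh₀, fun h hpos hlt => ?_⟩
  have h1 : χ' < ∫ ω, (1 - Real.exp (-(h * (hitTime B 1 1 ω).toReal))) / h ∂P :=
    (hsub ⟨hpos, hlt⟩).1
  rw [integral_div, integral_sub (integrable_const _) (hexpi h hpos), lt_div_iff₀ hpos] at h1
  simp only [integral_const, probReal_univ, smul_eq_mul, mul_one] at h1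
  have h2 := Real.add_one_le_exp (-(h * χ'))
  have h3 : ∫⁻ ω, expNeg h (hitTime B 1 1 ω) ∂P =
      ENNReal.ofReal (∫ ω, Real.exp (-(h * (hitTime B 1 1 ω).toReal)) ∂P) := by
    rw [ofReal_integral_eq_lintegral_ofReal (hexpi h hpos)
      (Eventually.of_forall fun ω => (Real.exp_pos _).le)]
    refine lintegral_congr_ae ?_
    filter_upwards [hae] with ω hω
    exact expNeg_of_ne_top hω.ne
  rw [h3]
  exact ENNReal.ofReal_le_ofReal (by linarith)

/-- The time covered by `⌈ε⁻² T / χ⌉` steps of the skeleton is asymptotically at least `T`. -/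
theorem exists_measure_hitTime_numSteps_lt_le [IsProbabilityMeasure P] (hd : 0 < d)
    (hB : IsBrownianMotion B P) {T t : ℝ≥0} (ht : t < T) {δ : ℝ} (hδ : 0 < δ) :
    ∃ ε₀ > 0, ∀ ε, 0 < ε → ε < ε₀ →
      P {ω | hitTime B ε (numSteps B ε P T) ω < t} ≤ ENNReal.ofReal δ := by
  have hχ := chi_pos hd hB
  have hT : (0 : ℝ) < T := by exact_mod_cast zero_le.trans_lt ht
  have ht' : (t : ℝ) < T := by exact_mod_cast ht
  -- Three factors `θ` are lost: two from the radius `ρ = θε`, which enters squared, and one from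
  -- `χ' = θχ`.
  obtain ⟨θ, hθ0, hθ1, hθ⟩ : ∃ θ : ℝ, 0 < θ ∧ θ < 1 ∧ (t : ℝ) < θ ^ 3 * T := by
    have hcont : Continuous fun θ : ℝ => θ ^ 3 * T := by fun_prop
    have hev : ∀ᶠ θ in 𝓝[<] (1 : ℝ), (t : ℝ) < θ ^ 3 * T :=
      nhdsWithin_le_nhds (hcont.continuousAt.eventually_const_lt (by simpa using ht'))
    obtain ⟨θ, h1, h2⟩ := (hev.and (Ioo_mem_nhdsLT (zero_lt_one' ℝ))).exists
    exact ⟨θ, h2.1, h2.2, h1⟩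
  -- The Chernoff parameter is fixed before `ε`. The threshold `√(h₀ / c)` then keeps `cρ²` within
  -- the range of the Laplace estimate.
  obtain ⟨c, hc0, hc⟩ : ∃ c : ℝ, 0 < c ∧ Real.exp (-(c * (θ ^ 3 * T - t))) ≤ δ := by
    have h1 : Tendsto (fun c : ℝ => Real.exp (-(c * (θ ^ 3 * T - t)))) atTop (𝓝 0) :=
      Real.tendsto_exp_atBot.comp (tendsto_neg_atTop_atBot.comp
        (tendsto_id.atTop_mul_const (sub_pos.2 hθ)))
    obtain ⟨c, h2, h3⟩ := ((h1.eventually_le_const hδ).and (eventually_gt_atTop 0)).exists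
    exact ⟨c, h3, h2⟩
  obtain ⟨h₀, hh₀, hL⟩ := exists_lintegral_expNeg_le hd hB (χ' := θ * chi B P)
    (by nlinarith)
  refine ⟨√(h₀ / c), Real.sqrt_pos.2 (by positivity), fun ε hε hεlt => ?_⟩
  set N := numSteps B ε P T with hN
  have hNle : (ε ^ 2)⁻¹ * T / chi B P ≤ N := Nat.le_ceil _
  have hε2 : c * (θ * ε) ^ 2 < h₀ := by
    have h1 : ε ^ 2 < h₀ / c := by
      rw [← Real.lt_sqrt hε.le]
      exact hεlt
    rw [lt_div_iff₀ hc0] at h1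
    have h2 : θ ^ 2 ≤ 1 := pow_le_one₀ hθ0.le hθ1.le
    nlinarith [mul_pos hc0 (pow_pos hε 2)]
  have h1 := (lintegral_expNeg_hitTime_le hB hc0.le (ρ := θ * ε) (by positivity)
    (by nlinarith : θ * ε < ε) N).trans (pow_le_pow_left' (hL (c * (θ * ε) ^ 2) (by positivity) hε2) N)
  rw [← ENNReal.ofReal_pow (Real.exp_pos _).le, ← Real.exp_nat_mul] at h1
  have h2 : (N : ℝ) * -(c * (θ * ε) ^ 2 * (θ * chi B P)) ≤ -(c * (θ ^ 3 * T)) := by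
    rw [div_le_iff₀ hχ, inv_mul_le_iff₀ (by positivity)] at hNle
    nlinarith [mul_le_mul_of_nonneg_left hNle (by positivity : 0 ≤ c * θ ^ 3)]
  have hm := measurable_hitTime hB.measurable hB.continuous_path hε N
  have h3 := mul_meas_ge_le_lintegral (μ := P) ((measurable_expNeg hc0.le).comp hm) (expNeg c t)
  have h4 : P {ω | hitTime B ε N ω < t} ≤
      P {ω | expNeg c t ≤ (expNeg c ∘ hitTime B ε N) ω} :=
    measure_mono fun ω (hω : hitTime B ε N ω < t) => expNeg_antitone hc0.le hω.le
  rw [expNeg_of_ne_top (by simp), ENNReal.coe_toReal] at h3 h4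
  calc P {ω | hitTime B ε N ω < t}
      = ENNReal.ofReal (Real.exp (c * t)) * (ENNReal.ofReal (Real.exp (-(c * t))) *
          P {ω | hitTime B ε N ω < t}) := by
        rw [← mul_assoc, ← ENNReal.ofReal_mul (Real.exp_pos _).le, ← Real.exp_add]
        simp
    _ ≤ ENNReal.ofReal (Real.exp (c * t)) * ENNReal.ofReal (Real.exp (-(c * (θ ^ 3 * T)))) := by
        gcongr
        refine (mul_le_mul_right h4 _).trans (h3.trans (h1.trans ?_))
        exact ENNReal.ofReal_le_ofReal (Real.exp_le_exp.2 h2)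
    _ = ENNReal.ofReal (Real.exp (-(c * (θ ^ 3 * T - t)))) := by
        rw [← ENNReal.ofReal_mul (Real.exp_pos _).le, ← Real.exp_add]
        congr 2
        ring
    _ ≤ _ := ENNReal.ofReal_le_ofReal hc

end Skeleton

end WienerControl

end

noncomputable section

namespace WienerControl

/-! ### Predictable processes as functionals of the past of the Brownian motion -/

theorem stronglyMeasurable_limUnder_seq {S E : Type*} (𝒢 : MeasurableSpace S) [TopologicalSpace E]
    [TopologicalSpace.IsCompletelyMetrizableSpace E] [Nonempty E] {f : ℕ → S → E}
    (hf : ∀ n, StronglyMeasurable (f n)) :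
    StronglyMeasurable fun x => limUnder atTop fun n => f n x :=
  StronglyMeasurable.limUnder hf

/-- Null modifications pass from sets to functions: piecewise functions use the `𝒢`-measurable
representative of the set, and pointwise limits use `limUnder` of the representatives, which is
measurable even where no limit exists. -/
theorem aestronglyMeasurable_of_eventuallyMeasurableSpace {S E : Type*} {𝒢 m₀ : MeasurableSpace S}
    {ν : Measure[m₀] S} [TopologicalSpace E] [TopologicalSpace.IsCompletelyMetrizableSpace E] [Nonempty E]
    {f : S → E} (hf : StronglyMeasurable[eventuallyMeasurableSpace 𝒢 (ae ν)] f) :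
    AEStronglyMeasurable[𝒢] f ν := by
  classical
  refine @StronglyMeasurable.induction' S E (eventuallyMeasurableSpace 𝒢 (ae ν)) _ _
    (fun f _ => AEStronglyMeasurable[𝒢] f ν) ?_ ?_ ?_ f hf
  · intro c
    exact aestronglyMeasurable_const
  · rintro f g s - - ⟨t, ht, hst⟩ ⟨f', hf', hff'⟩ ⟨g', hg', hgg'⟩
    refine ⟨t.piecewise f' g', hf'.piecewise ht hg', ?_⟩
    filter_upwards [hst, hff', hgg'] with x h1 h2 h3
    have h1' : x ∈ s ↔ x ∈ t := iff_of_eq h1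
    by_cases hx : x ∈ t
    · rw [Set.piecewise_eq_of_mem _ _ _ hx, Set.piecewise_eq_of_mem _ _ _ (h1'.2 hx), h2]
    · rw [Set.piecewise_eq_of_notMem _ _ _ hx,
        Set.piecewise_eq_of_notMem _ _ _ (fun h => hx (h1'.1 h)), h3]
  · intro f g _ _ hf hlim
    choose f' hf' hff' using hf
    refine ⟨_, stronglyMeasurable_limUnder_seq 𝒢 hf', ?_⟩
    filter_upwards [ae_all_iff.2 hff'] with x hx
    simp_rw [← hx]
    exact (hlim x).limUnder_eq.symm

section History

variable {Ω : Type*} {m : MeasurableSpace Ω} {P : Measure Ω} {d : ℕ} {B : ℝ≥0 → Ω → Fin d → ℝ}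
  {T : ℝ≥0}

/-- The current time, together with the path of `B` stopped at the current time, observed along a
countable dense set of times. -/
def history (B : ℝ≥0 → Ω → Fin d → ℝ) (p : Ω × ℝ) : ℝ≥0 × (ℕ → Fin d → ℝ) :=
  (p.2.toNNReal, fun i => B (min (TopologicalSpace.denseSeq ℝ≥0 i) p.2.toNNReal) p.1)

/-- The product of `P` and of the Lebesgue measure on `(0, T]`. -/
def timeProd (P : Measure Ω) (T : ℝ≥0) : Measure (Ω × ℝ) :=
  P.prod (volume.restrict (Set.Ioc 0 (T : ℝ)))

instance [IsProbabilityMeasure P] : IsFiniteMeasure (timeProd P T) := by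
  unfold timeProd
  infer_instance

theorem ae_timeProd_mem [SFinite P] : ∀ᵐ p ∂(timeProd P T), p.2 ∈ Set.Ioc 0 (T : ℝ) :=
  Measure.quasiMeasurePreserving_snd.ae (ae_restrict_mem measurableSet_Ioc)

theorem measurable_eval_min_toNNReal (hB : IsBrownianMotion B P) (s : ℝ≥0) :
    Measurable fun p : Ω × ℝ => B (min s p.2.toNNReal) p.1 :=
  (measurable_uncurry_of_continuous_of_measurable hB.continuous_path hB.measurable).comp
    ((measurable_const.min measurable_snd.real_toNNReal).prodMk measurable_fst)

theorem measurable_history (hB : IsBrownianMotion B P) : Measurable (history B) :=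
  measurable_snd.real_toNNReal.prodMk
    (measurable_pi_lambda _ fun _ => measurable_eval_min_toNNReal hB _)

theorem measurable_comap_history_eval_min (hB : IsBrownianMotion B P) (s : ℝ≥0) :
    Measurable[MeasurableSpace.comap (history B) inferInstance]
      fun p : Ω × ℝ => B (min s p.2.toNNReal) p.1 := by
  have hs : s ∈ closure (Set.range (TopologicalSpace.denseSeq ℝ≥0)) :=
    TopologicalSpace.denseRange_denseSeq ℝ≥0 s
  obtain ⟨x, hx, hlim⟩ := mem_closure_iff_seq_limit.1 hs
  choose i hi using hx
  have hm : ∀ l, Measurable[MeasurableSpace.comap (history B) inferInstance]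
      fun p : Ω × ℝ => B (min (x l) p.2.toNNReal) p.1 := fun l => by
    have h1 : Measurable fun z : ℝ≥0 × (ℕ → Fin d → ℝ) => z.2 (i l) := by fun_prop
    have h2 := h1.comp (comap_measurable (history B))
    simp only [Function.comp_def, history, hi] at h2
    exact h2
  refine @measurable_of_tendsto_metrizable _ _ (MeasurableSpace.comap (history B) inferInstance)
    _ _ _ _ _ _ hm ?_
  rw [tendsto_pi_nhds]
  intro p
  exact ((hB.continuous_path p.1).tendsto _).comp (hlim.min tendsto_const_nhds)

/-- When `r < t`, the path up to `r` is not affected by stopping at `t`, so the history at `t`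
determines every event of the natural σ-algebra at `r`. -/
theorem measurableSet_comap_history (hB : IsBrownianMotion B P) (r : ℝ≥0) {A : Set Ω}
    (hA : MeasurableSet[(Filtration.natural B fun t => (hB.measurable t).stronglyMeasurable) r] A) :
    MeasurableSet[MeasurableSpace.comap (history B) inferInstance]
      {p : Ω × ℝ | r < p.2.toNNReal ∧ p.1 ∈ A} := by
  have hR : MeasurableSet[MeasurableSpace.comap (history B) inferInstance]
      {p : Ω × ℝ | r < p.2.toNNReal} :=
    ⟨{z | r < z.1}, measurable_fst measurableSet_Ioi, rfl⟩
  suffices h : (Filtration.natural B fun t => (hB.measurable t).stronglyMeasurable) r ≤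
      traceSigma (MeasurableSpace.comap (history B) inferInstance) _ Prod.fst hR from h A hA
  refine iSup₂_le fun j hj => ?_
  rintro _ ⟨S, hS, rfl⟩
  have hS' : MeasurableSet S := by
    borelize (Fin d → ℝ)
    exact hS
  change MeasurableSet[MeasurableSpace.comap (history B) inferInstance]
    ({p : Ω × ℝ | r < p.2.toNNReal} ∩ Prod.fst ⁻¹' (B j ⁻¹' S))
  convert hR.inter (measurable_comap_history_eval_min hB j hS') using 1
  ext p
  simp only [Set.mem_inter_iff, Set.mem_ofPred_eq, Set.mem_preimage]
  refine and_congr_right fun hp => ?_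
  rw [min_eq_left (hj.trans hp.le)]

theorem exists_measurableSet_natural_ae_eq (hB : IsBrownianMotion B P) (r : ℝ≥0) {A : Set Ω}
    (hA : MeasurableSet[(Filtration.natural B fun t => (hB.measurable t).stronglyMeasurable) r ⊔
      nullSigma P (⨆ s, (Filtration.natural B fun t => (hB.measurable t).stronglyMeasurable) s)] A) :
    ∃ A', MeasurableSet[(Filtration.natural B
      fun t => (hB.measurable t).stronglyMeasurable) r] A' ∧ A =ᵐ[P] A' := by
  suffices h : (Filtration.natural B fun t => (hB.measurable t).stronglyMeasurable) r ⊔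
      nullSigma P (⨆ s, (Filtration.natural B fun t => (hB.measurable t).stronglyMeasurable) s) ≤
      eventuallyMeasurableSpace ((Filtration.natural B
        fun t => (hB.measurable t).stronglyMeasurable) r) (ae P) from h A hA
  refine sup_le le_eventuallyMeasurableSpace (MeasurableSpace.generateFrom_le ?_)
  rintro s ⟨-, t, -, ht, hst⟩
  exact ⟨∅, @MeasurableSet.empty _ (_), ae_eq_empty.2 (measure_mono_null hst ht)⟩

/-- The augmentation costs only null sets. Right-continuity is harmless because `(i, ∞)` is the
union of `(i + 1/(l+1), ∞)`, so a set of `𝓕_{i+}` can be used at the later times `i + 1/(l+1)`.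
Rectangles at time `0` are null, as time is restricted to `(0, T]`. -/
theorem predictable_le_map [SFinite P] (hB : IsBrownianMotion B P) :
    (brownianFiltration hB).predictable ≤ MeasurableSpace.map
      (fun p : Ω × ℝ => (p.2.toNNReal, p.1)) (eventuallyMeasurableSpace
        (MeasurableSpace.comap (history B) inferInstance) (ae (timeProd P T))) := by
  refine measurableSpace_le_predictable_of_measurableSet ?_ ?_
  · intro A _
    refine ⟨∅, @MeasurableSet.empty _ (_), ?_⟩
    rw [ae_eq_empty]
    refine measure_mono_null (t := {p : Ω × ℝ | p.2 ∈ Set.Ioc 0 (T : ℝ)}ᶜ) ?_ ae_timeProd_mem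
    rintro p ⟨hp, -⟩ hmem
    have : p.2.toNNReal = 0 := hp
    rw [Real.toNNReal_eq_zero] at this
    exact absurd hmem.1 (not_lt.2 this)
  · intro i A hA
    have hA' : ∀ j > i, MeasurableSet[(Filtration.natural B
        fun t => (hB.measurable t).stronglyMeasurable) j ⊔ nullSigma P (⨆ s, (Filtration.natural B
          fun t => (hB.measurable t).stronglyMeasurable) s)] A := by
      intro j hj
      have h1 : brownianFiltration hB i ≤ _ :=
        (Filtration.rightCont_eq _ i).le.trans (iInf₂_le j hj)
      exact h1 A hA
    have hlim : Tendsto (fun l : ℕ => i + 1 / ((l : ℝ≥0) + 1)) atTop (𝓝 i) := by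
      simpa using tendsto_one_div_add_atTop_nhds_zero_nat (𝕜 := ℝ≥0) |>.const_add i
    have hU : (fun p : Ω × ℝ => (p.2.toNNReal, p.1)) ⁻¹' (Set.Ioi i ×ˢ A) =
        ⋃ l : ℕ, {p : Ω × ℝ | i + 1 / ((l : ℝ≥0) + 1) < p.2.toNNReal ∧ p.1 ∈ A} := by
      ext p
      simp only [Set.mem_preimage, Set.mem_prod, Set.mem_Ioi, Set.mem_iUnion, Set.mem_ofPred_eq]
      constructor
      · rintro ⟨h1, h2⟩
        obtain ⟨l, hl⟩ := (hlim.eventually_lt_const h1).exists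
        exact ⟨l, hl, h2⟩
      · rintro ⟨l, h1, h2⟩
        exact ⟨lt_of_le_of_lt le_self_add h1, h2⟩
    rw [MeasurableSpace.map_def, hU]
    refine MeasurableSet.iUnion fun l => ?_
    obtain ⟨A', hA'm, hAA'⟩ := exists_measurableSet_natural_ae_eq hB _
      (hA' (i + 1 / ((l : ℝ≥0) + 1)) (lt_add_of_pos_right i (by positivity)))
    refine ⟨_, measurableSet_comap_history hB _ hA'm, ?_⟩
    have h1 : (Prod.fst ⁻¹' A : Set (Ω × ℝ)) =ᵐ[timeProd P T] Prod.fst ⁻¹' A' :=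
      Measure.quasiMeasurePreserving_fst.preimage_ae_eq hAA'
    exact (EventuallyEq.refl _ {p : Ω × ℝ | i + 1 / ((l : ℝ≥0) + 1) < p.2.toNNReal}).inter h1

theorem exists_eq_comp_history [SFinite P] (hB : IsBrownianMotion B P) {r : ℕ}
    {u : ℝ≥0 → Ω → EuclideanSpace ℝ (Fin r)}
    (hu : IsStronglyPredictable (brownianFiltration hB) u) :
    ∃ h : ℝ≥0 × (ℕ → Fin d → ℝ) → EuclideanSpace ℝ (Fin r), StronglyMeasurable h ∧
      (fun p : Ω × ℝ => u p.2.toNNReal p.1) =ᵐ[timeProd P T] h ∘ history B := by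
  have h1 : StronglyMeasurable[eventuallyMeasurableSpace
      (MeasurableSpace.comap (history B) inferInstance) (ae (timeProd P T))]
      fun p : Ω × ℝ => u p.2.toNNReal p.1 :=
    StronglyMeasurable.comp_measurable (g := fun p : Ω × ℝ => (p.2.toNNReal, p.1)) hu
      (fun s hs => predictable_le_map hB s hs)
  obtain ⟨g, hg, hug⟩ := aestronglyMeasurable_of_eventuallyMeasurableSpace h1
  obtain ⟨h, hh, rfl⟩ := hg.exists_eq_measurable_comp
  exact ⟨h, hh, hug⟩

end History

/-! ### The action space -/

section ActionSpace

variable {r : ℕ} {a : ℝ}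

/-- The projection onto the action space. -/
def clampAction (a : ℝ) (x : EuclideanSpace ℝ (Fin r)) : EuclideanSpace ℝ (Fin r) :=
  WithLp.toLp 2 fun i => max (-a) (min a (x i))

theorem continuous_clampAction : Continuous (clampAction (r := r) a) := by
  unfold clampAction
  fun_prop

theorem clampAction_mem (ha : 0 ≤ a) (x : EuclideanSpace ℝ (Fin r)) :
    clampAction a x ∈ actionSpace r a := by
  intro i
  simp only [clampAction]
  rw [abs_le]
  exact ⟨le_max_left _ _, max_le (by linarith) (min_le_left _ _)⟩

/-- Clamping is 1-Lipschitz in each coordinate and fixes the action space, so approximants may be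
forced into it without increasing the error. -/
theorem norm_sub_clampAction_le {x y : EuclideanSpace ℝ (Fin r)}
    (hy : y ∈ actionSpace r a) : ‖y - clampAction a x‖ ≤ ‖y - x‖ := by
  rw [EuclideanSpace.norm_eq, EuclideanSpace.norm_eq]
  refine Real.sqrt_le_sqrt (Finset.sum_le_sum fun i _ => ?_)
  have h1 := abs_le.1 (hy i)
  simp only [PiLp.sub_apply, clampAction, Real.norm_eq_abs]
  refine pow_le_pow_left₀ (abs_nonneg _) ?_ 2
  have h2 : max (-a) (min a (y i)) = y i := by rw [min_eq_right h1.2, max_eq_right h1.1]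
  calc |y i - max (-a) (min a (x i))| = |max (-a) (min a (y i)) - max (-a) (min a (x i))| := by
        rw [h2]
    _ ≤ |min a (y i) - min a (x i)| := by
        refine (abs_max_sub_max_le_max _ _ _ _).trans ?_
        simp
    _ ≤ |y i - x i| := by
        refine (abs_min_sub_min_le_max _ _ _ _).trans ?_
        simp

theorem enorm_sub_sq_le {x y : EuclideanSpace ℝ (Fin r)} (hx : x ∈ actionSpace r a)
    (hy : y ∈ actionSpace r a) : ‖x - y‖ₑ ^ 2 ≤ ENNReal.ofReal (r * (2 * a) ^ 2) := by
  rw [← ofReal_norm, ← ENNReal.ofReal_pow (norm_nonneg _)]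
  refine ENNReal.ofReal_le_ofReal ?_
  rw [EuclideanSpace.norm_sq_eq]
  calc _ ≤ ∑ i : Fin r, (2 * a) ^ 2 := by
        refine Finset.sum_le_sum fun i _ => ?_
        rw [PiLp.sub_apply, Real.norm_eq_abs]
        refine pow_le_pow_left₀ (abs_nonneg _) ?_ 2
        have h1 := hx i
        have h2 := hy i
        exact (abs_sub _ _).trans (by linarith)
    _ = _ := by simp

end ActionSpace

/-! ### Approximation by continuous functionals of the history. -/

section Density

variable {Ω : Type*} {m : MeasurableSpace Ω} {P : Measure Ω} {d r : ℕ} {B : ℝ≥0 → Ω → Fin d → ℝ}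
  {T : ℝ≥0} {a : ℝ}

theorem measurable_control (hB : IsBrownianMotion B P)
    {u : ℝ≥0 → Ω → EuclideanSpace ℝ (Fin r)}
    (hu : u ∈ controls (brownianFiltration hB) r a T) :
    Measurable fun p : Ω × ℝ => u p.2.toNNReal p.1 := by
  have h1 : Measurable[(brownianFiltration hB).predictable] (Function.uncurry u) := hu.1.measurable
  have h2 : (brownianFiltration hB).predictable ≤ Prod.instMeasurableSpace := by
    refine measurableSpace_le_predictable_of_measurableSet ?_ ?_
    · exact fun A hA => (measurableSet_singleton _).prod (Filtration.le _ _ _ hA)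
    · exact fun i A hA => measurableSet_Ioi.prod (Filtration.le _ _ _ hA)
  exact (h1.mono h2 le_rfl).comp (measurable_snd.real_toNNReal.prodMk measurable_fst)

theorem exists_continuous_lintegral_sub_history_le [IsProbabilityMeasure P]
    (hB : IsBrownianMotion B P) (ha : 0 ≤ a) {u : ℝ≥0 → Ω → EuclideanSpace ℝ (Fin r)}
    (hu : u ∈ controls (brownianFiltration hB) r a T) {η : ℝ≥0∞} (hη : η ≠ 0) :
    ∃ g : ℝ≥0 × (ℕ → Fin d → ℝ) → EuclideanSpace ℝ (Fin r), Continuous g ∧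
      (∀ z, g z ∈ actionSpace r a) ∧
      ∫⁻ p, ‖u p.2.toNNReal p.1 - g (history B p)‖ₑ ^ 2 ∂(timeProd P T) ≤ η := by
  obtain ⟨h, hhm, huh⟩ := exists_eq_comp_history (T := T) hB hu.1
  have hZ := measurable_history hB
  have hfin : IsFiniteMeasure ((timeProd P T).map (history B)) :=
    Measure.isFiniteMeasure_map _ _
  have hmem : MemLp h 2 ((timeProd P T).map (history B)) := by
    rw [memLp_map_measure_iff hhm.aestronglyMeasurable hZ.aemeasurable, ← memLp_congr_ae huh]
    refine MemLp.of_bound (measurable_control hB hu).aestronglyMeasurable (√(r * (2 * a) ^ 2))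
      (Eventually.of_forall fun p => ?_)
    have h1 := enorm_sub_sq_le (hu.2.1 p.2.toNNReal p.1) (zero_mem_actionSpace (r := r) ha)
    rw [sub_zero, ← ofReal_norm, ← ENNReal.ofReal_pow (norm_nonneg _),
      ENNReal.ofReal_le_ofReal_iff (by positivity)] at h1
    exact Real.le_sqrt_of_sq_le h1
  obtain ⟨ζ, hζ0, hζ⟩ : ∃ ζ : ℝ≥0∞, ζ ≠ 0 ∧ ζ ^ 2 ≤ η := by
    refine ⟨η ^ (1 / 2 : ℝ), ?_, ?_⟩
    · simp [hη]
    · rw [← ENNReal.rpow_natCast, ← ENNReal.rpow_mul]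
      simp
  obtain ⟨g, hg, -⟩ := hmem.exists_boundedContinuous_eLpNorm_sub_le (by simp) hζ0
  refine ⟨fun z => clampAction a (g z), continuous_clampAction.comp g.continuous,
    fun z => clampAction_mem ha _, ?_⟩
  have h2 : eLpNorm (h - ⇑g) 2 ((timeProd P T).map (history B)) ^ 2 =
      ∫⁻ p, ‖h (history B p) - g (history B p)‖ₑ ^ 2 ∂(timeProd P T) := by
    rw [eLpNorm_eq_lintegral_rpow_enorm_toReal (by simp) (by simp), ← ENNReal.rpow_natCast,
      ← ENNReal.rpow_mul]
    simp only [ENNReal.toReal_ofNat, Nat.cast_ofNat, one_div, ne_eq, OfNat.ofNat_ne_zero,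
      not_false_eq_true, inv_mul_cancel₀, ENNReal.rpow_one, ENNReal.rpow_ofNat, Pi.sub_apply]
    rw [lintegral_map ?_ hZ]
    exact ((hhm.measurable.sub g.continuous.measurable).enorm.pow_const 2)
  calc _ ≤ ∫⁻ p, ‖h (history B p) - g (history B p)‖ₑ ^ 2 ∂(timeProd P T) := by
        refine lintegral_mono_ae ?_
        filter_upwards [huh] with p hp
        have hp' : u p.2.toNNReal p.1 = h (history B p) := hp
        rw [← hp']
        gcongr
        rw [← ofReal_norm, ← ofReal_norm]
        exact ENNReal.ofReal_le_ofReal (norm_sub_clampAction_le (hu.2.1 _ _))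
    _ ≤ ζ ^ 2 := by
        rw [← h2]
        exact pow_le_pow_left' hg 2
    _ ≤ η := hζ

end Density

end WienerControl

end

noncomputable section

namespace WienerControl

/-! ### Approximation of controls by discrete controls -/

section Approximation

variable {Ω : Type*} {m : MeasurableSpace Ω} {P : Measure Ω} {d r : ℕ} {B : ℝ≥0 → Ω → Fin d → ℝ}
  {T : ℝ≥0} {a : ℝ} {ε : ℕ → ℝ}

/-- If `T_j ≤ b < t` for a small mesh, the path stays within `ε` of `B(T_j)` on `(b, t)`. Two dense
times there with distinct values of `B` exclude this as soon as `2ε` is below their distance. -/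
theorem tendsto_toNNReal_hitTime {ω : Ω} (hc : Continuous fun t => B t ω)
    (hne : ∀ i l, TopologicalSpace.denseSeq ℝ≥0 i ≠ TopologicalSpace.denseSeq ℝ≥0 l →
      B (TopologicalSpace.denseSeq ℝ≥0 i) ω ≠ B (TopologicalSpace.denseSeq ℝ≥0 l) ω)
    (hε_pos : ∀ k, 0 < ε k) (hε : Tendsto ε atTop (𝓝 0)) {t : ℝ≥0} {j : ℕ → ℕ}
    (h1 : ∀ k, hitTime B (ε k) (j k) ω < t) (h2 : ∀ k, t ≤ hitTime B (ε k) (j k + 1) ω) :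
    Tendsto (fun k => (hitTime B (ε k) (j k) ω).toNNReal) atTop (𝓝 t) := by
  have hlt : ∀ k, (hitTime B (ε k) (j k) ω).toNNReal < t := fun k => by
    rw [← ENNReal.coe_lt_coe, ENNReal.coe_toNNReal (h1 k).ne_top]
    exact h1 k
  refine tendsto_order.2 ⟨fun b hb => ?_, fun b hb => Eventually.of_forall fun k =>
    (hlt k).trans hb⟩
  obtain ⟨i, hi1, hi2, -⟩ := exists_denseSeq_mem isOpen_univ (Set.mem_univ b) hb
  obtain ⟨l, hl1, hl2, -⟩ := exists_denseSeq_mem isOpen_univ (Set.mem_univ _) hi2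
  have hpos : 0 < ‖B (TopologicalSpace.denseSeq ℝ≥0 i) ω -
      B (TopologicalSpace.denseSeq ℝ≥0 l) ω‖ / 2 := by
    have := norm_pos_iff.2 (sub_ne_zero.2 (hne i l hl1.ne))
    linarith
  filter_upwards [hε.eventually_lt_const hpos] with k hk
  by_contra! hcon
  have hle : hitTime B (ε k) (j k) ω ≤ b := by
    rw [← ENNReal.coe_toNNReal (h1 k).ne_top]
    exact_mod_cast hcon
  have key : ∀ s : ℝ≥0, b < s → s < t →
      ‖B s ω - B (hitTime B (ε k) (j k) ω).toNNReal ω‖ < ε k := fun s hs hst =>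
    norm_sub_hitTime_lt hc (hε_pos k) (hle.trans (by exact_mod_cast hs.le))
      (lt_of_lt_of_le (by exact_mod_cast hst) (h2 k))
  have k1 := key _ hi1 hi2
  have k2 := key _ (hi1.trans hl1) hl2
  have k3 := norm_sub_le_norm_sub_add_norm_sub (B (TopologicalSpace.denseSeq ℝ≥0 i) ω)
    (B (hitTime B (ε k) (j k) ω).toNNReal ω) (B (TopologicalSpace.denseSeq ℝ≥0 l) ω)
  rw [norm_sub_rev (B (hitTime B (ε k) (j k) ω).toNNReal ω)] at k3
  linarith

theorem tendsto_skeleton_history {ω : Ω} (hc : Continuous fun t => B t ω) (h0 : B 0 ω = 0)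
    (hne : ∀ i l, TopologicalSpace.denseSeq ℝ≥0 i ≠ TopologicalSpace.denseSeq ℝ≥0 l →
      B (TopologicalSpace.denseSeq ℝ≥0 i) ω ≠ B (TopologicalSpace.denseSeq ℝ≥0 l) ω)
    (hε_pos : ∀ k, 0 < ε k) (hε : Tendsto ε atTop (𝓝 0)) {t : ℝ≥0} {j : ℕ → ℕ}
    (h1 : ∀ k, hitTime B (ε k) (j k) ω < t) (h2 : ∀ k, t ≤ hitTime B (ε k) (j k + 1) ω) :
    Tendsto (fun k => ((hitTime B (ε k) (j k) ω).toNNReal, fun i : ℕ =>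
      jumpProcess B (ε k) (min (TopologicalSpace.denseSeq ℝ≥0 i : ℝ≥0∞)
        (hitTime B (ε k) (j k) ω)).toNNReal ω)) atTop
      (𝓝 (t, fun i => B (min (TopologicalSpace.denseSeq ℝ≥0 i) t) ω)) := by
  refine (tendsto_toNNReal_hitTime hc hne hε_pos hε h1 h2).prodMk_nhds
    (tendsto_pi_nhds.2 fun i => ?_)
  rw [tendsto_iff_norm_sub_tendsto_zero]
  refine squeeze_zero (fun _ => norm_nonneg _) (fun k => ?_) (by simpa using hε.const_mul 2)
  have := norm_jumpProcess_min_hitTime_sub_le hc (hε_pos k) (h1 k) (h2 k)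
    (TopologicalSpace.denseSeq ℝ≥0 i)
  rwa [h0, sub_zero] at this

theorem tendsto_measure_hitTime_numSteps_lt [IsProbabilityMeasure P] (hd : 0 < d)
    (hB : IsBrownianMotion B P) (hε_pos : ∀ k, 0 < ε k) (hε : Tendsto ε atTop (𝓝 0)) {t : ℝ≥0}
    (ht : t < T) :
    Tendsto (fun k => P {ω | hitTime B (ε k) (numSteps B (ε k) P T) ω < t}) atTop (𝓝 0) := by
  rw [ENNReal.tendsto_nhds_zero]
  intro δ hδ
  obtain ⟨x, hx0, hx⟩ := ENNReal.lt_iff_exists_nnreal_btwn.1 hδ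
  obtain ⟨ε₀, hε₀, h⟩ := exists_measure_hitTime_numSteps_lt_le hd hB ht
    (δ := x) (by exact_mod_cast hx0)
  filter_upwards [hε.eventually_lt_const hε₀] with k hk
  refine (h _ (hε_pos k) hk).trans ?_
  rw [ENNReal.ofReal_coe_nnreal]
  exact hx.le

theorem measurable_hitTime_fst (hB : IsBrownianMotion B P) {e : ℝ} (he : 0 < e) (n : ℕ) :
    Measurable fun p : Ω × ℝ => hitTime B e n p.1 :=
  (measurable_hitTime hB.measurable hB.continuous_path he n).comp measurable_fst

/-- Controls the times after the last step, where the discrete control is `0`. The probability that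
`T_N < s` tends to `0` for each `s < T`, and dominated convergence in `s` concludes, the endpoint `s
= T` being null. -/
theorem tendsto_lintegral_hitTime_lt [IsProbabilityMeasure P] (hd : 0 < d)
    (hB : IsBrownianMotion B P) (hε_pos : ∀ k, 0 < ε k) (hε : Tendsto ε atTop (𝓝 0)) {M : ℝ≥0∞}
    (hM : M ≠ ⊤) :
    Tendsto (fun k => ∫⁻ p, {p : Ω × ℝ | hitTime B (ε k) (numSteps B (ε k) P T) p.1 <
      p.2.toNNReal}.indicator (fun _ => M) p ∂(timeProd P T)) atTop (𝓝 0) := by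
  have hS : ∀ k, MeasurableSet {p : Ω × ℝ | hitTime B (ε k) (numSteps B (ε k) P T) p.1 <
      p.2.toNNReal} := fun k =>
    measurableSet_lt (measurable_hitTime_fst hB (hε_pos k) _)
      measurable_snd.real_toNNReal.coe_nnreal_ennreal
  have hm : ∀ k, Measurable ({p : Ω × ℝ | hitTime B (ε k) (numSteps B (ε k) P T) p.1 <
      p.2.toNNReal}.indicator fun _ => M) := fun k => measurable_const.indicator (hS k)
  have hinner : ∀ k (s : ℝ), ∫⁻ ω, {p : Ω × ℝ | hitTime B (ε k) (numSteps B (ε k) P T) p.1 <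
      p.2.toNNReal}.indicator (fun _ => M) (ω, s) ∂P =
      M * P {ω | hitTime B (ε k) (numSteps B (ε k) P T) ω < s.toNNReal} := fun k s => by
    rw [← lintegral_indicator_const]
    · rfl
    · exact (measurable_hitTime hB.measurable hB.continuous_path (hε_pos k) _) measurableSet_Iio
  have heq : ∀ k, ∫⁻ p, {p : Ω × ℝ | hitTime B (ε k) (numSteps B (ε k) P T) p.1 <
      p.2.toNNReal}.indicator (fun _ => M) p ∂(timeProd P T) =
      ∫⁻ s in Set.Ioc 0 (T : ℝ), ∫⁻ ω, {p : Ω × ℝ | hitTime B (ε k) (numSteps B (ε k) P T) p.1 <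
        p.2.toNNReal}.indicator (fun _ => M) (ω, s) ∂P := fun k =>
    lintegral_prod_symm' _ (hm k)
  simp_rw [heq]
  rw [← lintegral_zero (μ := volume.restrict (Set.Ioc 0 (T : ℝ)))]
  refine tendsto_lintegral_of_dominated_convergence (fun _ => M)
    (fun k => (hm k).lintegral_prod_left') ?_ ?_ ?_
  · intro k
    refine Eventually.of_forall fun s => ?_
    simp only [hinner]
    exact mul_le_of_le_one_right' prob_le_one
  · simp [hM, ENNReal.mul_eq_top]
  · have hT : ∀ᵐ s : ℝ ∂(volume.restrict (Set.Ioc 0 (T : ℝ))), s ≠ T :=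
      ae_restrict_of_ae (by simp [ae_iff])
    filter_upwards [ae_restrict_mem measurableSet_Ioc, hT] with s hs hsT
    have hlt : s.toNNReal < T := by
      rw [Real.toNNReal_lt_iff_lt_coe hs.1.le]
      exact lt_of_le_of_ne hs.2 hsT
    simp only [hinner]
    have := ENNReal.Tendsto.const_mul
      (tendsto_measure_hitTime_numSteps_lt hd hB hε_pos hε hlt) (Or.inr hM)
    simpa using this

theorem enorm_sub_sq_le_two_mul {E : Type*} [NormedAddCommGroup E] (x y z : E) :
    ‖x - z‖ₑ ^ 2 ≤ 2 * (‖x - y‖ₑ ^ 2 + ‖y - z‖ₑ ^ 2) := by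
  calc ‖x - z‖ₑ ^ 2 ≤ (‖x - y‖ₑ + ‖y - z‖ₑ) ^ 2 := by
        gcongr
        rw [← sub_add_sub_cancel x y z]
        exact enorm_add_le _ _
    _ ≤ _ := by
        generalize ‖x - y‖ₑ = b
        generalize ‖y - z‖ₑ = c
        rcases eq_or_ne b ∞ with rfl | hb
        · simp
        rcases eq_or_ne c ∞ with rfl | hc
        · simp
        lift b to ℝ≥0 using hb
        lift c to ℝ≥0 using hc
        exact_mod_cast (add_sq_le : (b + c) ^ 2 ≤ 2 * (b ^ 2 + c ^ 2))

/-- Admissible controls can be approximated by discrete controls. -/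
theorem eventually_exists_discreteControl [IsProbabilityMeasure P] (hd : 0 < d)
    (hB : IsBrownianMotion B P) (hT : 0 < T) (ha : 0 ≤ a) (hε_pos : ∀ k, 0 < ε k)
    (hε : Tendsto ε atTop (𝓝 0)) {u : ℝ≥0 → Ω → EuclideanSpace ℝ (Fin r)}
    (hu : u ∈ controls (brownianFiltration hB) r a T) {η : ℝ≥0∞} (hη : η ≠ 0) :
    ∀ᶠ k in atTop, ∃ v ∈ discreteControls B (ε k) P (numSteps B (ε k) P T) r a,
      ∫⁻ ω, (∫⁻ s : ℝ in Set.Ioc 0 (T : ℝ),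
        ‖ controlProcess B (ε k) T v s.toNNReal ω - u s.toNNReal ω‖ₑ ^ 2) ∂P ≤ η := by
  -- The inequality `‖x - z‖² ≤ 2(‖x - y‖² + ‖y - z‖²)` doubles the errors. One quarter of `η` is
  -- for replacing `u` by `g(history)`, one for the discretisation and the uncovered times together.
  have hη4 : η / 4 ≠ 0 := by simp [ENNReal.div_eq_zero_iff, hη]
  obtain ⟨g, hgc, hga, hg⟩ := exists_continuous_lintegral_sub_history_le hB ha hu hη4
  choose R hRm hR using fun k j =>
    exists_measurable_eq_hitTime hB.continuous_path (hε_pos k) P j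
  set A : ∀ (k j : ℕ), Ω → ℕ → Fin d → ℝ := fun k j ω i => jumpProcess B (ε k)
    (min (TopologicalSpace.denseSeq ℝ≥0 i : ℝ≥0∞) (hitTime B (ε k) j ω)).toNNReal ω with hA
  set v : ∀ k, Fin (numSteps B (ε k) P T) → Ω → EuclideanSpace ℝ (Fin r) :=
    fun k j ω => g (R k j ω, A k j ω) with hv
  have hvm : ∀ k, v k ∈ discreteControls B (ε k) P (numSteps B (ε k) P T) r a := by
    intro k j
    refine ⟨?_, fun ω => hga _⟩
    have hAm : Measurable[skeletonSigma B (ε k) P j] (A k j) := by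
      refine @measurable_pi_lambda _ _ _ (skeletonSigma B (ε k) P j) _ _ fun i => ?_
      exact Measurable.mono (comap_measurable _) (le_trans (le_iSup (fun s : ℝ≥0 =>
        MeasurableSpace.comap (fun ω => jumpProcess B (ε k)
          (min (s : ℝ≥0∞) (hitTime B (ε k) j ω)).toNNReal ω) inferInstance) _) le_sup_left) le_rfl
    exact hgc.measurable.comp ((hRm k j).prodMk hAm)
  have hφ : ∀ k, controlProcess B (ε k) T (v k) ∈ controls (brownianFiltration hB) r a T :=
    fun k => controlProcess_mem_controls hB (hε_pos k) ha hT (hvm k)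
  have hφm := fun k => measurable_control hB (hφ k)
  have hum := measurable_control hB hu
  have hgm : Measurable fun p : Ω × ℝ => g (history B p) :=
    hgc.measurable.comp (measurable_history hB)
  set M : ℝ≥0∞ := ENNReal.ofReal (r * (2 * a) ^ 2)
  set D : ℕ → Ω × ℝ → ℝ≥0∞ := fun k p =>
    ‖ controlProcess B (ε k) T (v k) p.2.toNNReal p.1 - g (history B p)‖ₑ ^ 2 with hD
  have hDm : ∀ k, Measurable (D k) := fun k => ((hφm k).sub hgm).enorm.pow_const 2
  have hDM : ∀ k p, D k p ≤ M := fun k p => enorm_sub_sq_le ((hφ k).2.1 _ _) (hga _)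
  set S : ℕ → Set (Ω × ℝ) := fun k => {p : Ω × ℝ |
    hitTime B (ε k) (numSteps B (ε k) P T) p.1 < p.2.toNNReal} with hS
  have hSm : ∀ k, MeasurableSet (S k) := fun k =>
    measurableSet_lt (measurable_hitTime_fst hB (hε_pos k) _)
      measurable_snd.real_toNNReal.coe_nnreal_ennreal
  have hE : Tendsto (fun k => ∫⁻ p, (S k)ᶜ.indicator (D k) p ∂(timeProd P T)) atTop (𝓝 0) := by
    rw [← lintegral_zero (μ := timeProd P T)]
    refine tendsto_lintegral_of_dominated_convergence (fun _ => M)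
      (fun k => (hDm k).indicator (hSm k).compl) ?_ ?_ ?_
    · exact fun k => Eventually.of_forall fun p =>
        (Set.indicator_le_self _ _ _).trans (hDM k p)
    · rw [lintegral_const]
      exact ENNReal.mul_ne_top ENNReal.ofReal_ne_top (measure_ne_top _ _)
    · have hae : ∀ᵐ ω ∂P, B 0 ω = 0 ∧ ∀ i l, TopologicalSpace.denseSeq ℝ≥0 i ≠
          TopologicalSpace.denseSeq ℝ≥0 l → B (TopologicalSpace.denseSeq ℝ≥0 i) ω ≠
            B (TopologicalSpace.denseSeq ℝ≥0 l) ω := by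
        refine (ae_eval_zero hB).and (ae_all_iff.2 fun i => ae_all_iff.2 fun l => ?_)
        by_cases hil : TopologicalSpace.denseSeq ℝ≥0 i = TopologicalSpace.denseSeq ℝ≥0 l
        · exact Eventually.of_forall fun ω h => absurd hil h
        · filter_upwards [ae_eval_ne hd hB hil] with ω h _ using h
      have hae' : ∀ᵐ p ∂(timeProd P T), B 0 p.1 = 0 ∧ ∀ i l, TopologicalSpace.denseSeq ℝ≥0 i ≠
          TopologicalSpace.denseSeq ℝ≥0 l → B (TopologicalSpace.denseSeq ℝ≥0 i) p.1 ≠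
            B (TopologicalSpace.denseSeq ℝ≥0 l) p.1 :=
        Measure.quasiMeasurePreserving_fst.ae hae
      filter_upwards [hae', ae_timeProd_mem] with p ⟨h0, hne⟩ hp
      have ht : 0 < p.2.toNNReal := Real.toNNReal_pos.2 hp.1
      have htT : p.2.toNNReal ≤ T := Real.toNNReal_le_iff_le_coe.2 hp.2
      have hc := hB.continuous_path p.1
      choose j hj1 hj2 using fun k => exists_hitTime_lt_le hc (hε_pos k) ht
      have hlim := (hgc.tendsto _).comp (tendsto_skeleton_history hc h0 hne hε_pos hε hj1 hj2)
      have hlim2 : Tendsto (fun k => ‖g ((hitTime B (ε k) (j k) p.1).toNNReal,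
          A k (j k) p.1) - g (history B p)‖ₑ ^ 2) atTop (𝓝 0) := by
        have h1 := ENNReal.Tendsto.pow (n := 2) (hlim.sub_const (g (history B p))).enorm
        simpa [history] using h1
      refine tendsto_of_tendsto_of_tendsto_of_le_of_le tendsto_const_nhds hlim2
        (fun _ => zero_le) fun k => ?_
      by_cases hpS : p ∈ S k
      · rw [Set.indicator_of_notMem (by simpa using hpS)]
        exact zero_le
      · rw [Set.indicator_of_mem (by simpa using hpS)]
        have hle : (p.2.toNNReal : ℝ≥0∞) ≤ hitTime B (ε k) (numSteps B (ε k) P T) p.1 :=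
          not_lt.1 hpS
        -- Outside `S k` the time is covered by the `N` steps, so the interval containing it carries
        -- a coefficient of the discrete control.
        have hjN : j k < numSteps B (ε k) P T := by
          by_contra! hcon
          exact absurd ((hj1 k).trans_le hle)
            (not_lt.2 (hitTime_monotone (B := B) (ε := ε k) (ω := p.1) hcon))
        have hRk : R k (j k) p.1 = (hitTime B (ε k) (j k) p.1).toNNReal := by
          rw [← hR k (j k) p.1 (hj1 k).ne_top, ENNReal.toNNReal_coe]
        simp only [hD]
        rw [controlProcess_eq ⟨j k, hjN⟩ (hj1 k) (hj2 k) htT]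
        simp only [hv, hRk]
        exact le_rfl
  have hF := tendsto_lintegral_hitTime_lt (T := T) hd hB hε_pos hε (M := M) ENNReal.ofReal_ne_top
  have hEF := hE.add hF
  rw [add_zero] at hEF
  filter_upwards [hEF.eventually_le_const (pos_iff_ne_zero.2 hη4)] with k hk
  refine ⟨v k, hvm k, ?_⟩
  have hmeas : Measurable fun p : Ω × ℝ => ‖ controlProcess B (ε k) T (v k) p.2.toNNReal p.1 -
      u p.2.toNNReal p.1‖ₑ ^ 2 := ((hφm k).sub hum).enorm.pow_const 2
  have hFm : Measurable ((S k).indicator fun _ => M) := measurable_const.indicator (hSm k)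
  have hEm : Measurable ((S k)ᶜ.indicator (D k)) := (hDm k).indicator (hSm k).compl
  calc _ = ∫⁻ p, ‖ controlProcess B (ε k) T (v k) p.2.toNNReal p.1 - u p.2.toNNReal p.1‖ₑ ^ 2
        ∂(timeProd P T) := (lintegral_prod _ hmeas.aemeasurable).symm
    _ ≤ ∫⁻ p, 2 * (((S k)ᶜ.indicator (D k) p + (S k).indicator (fun _ => M) p) +
        ‖u p.2.toNNReal p.1 - g (history B p)‖ₑ ^ 2) ∂(timeProd P T) := by
        refine lintegral_mono fun p => (enorm_sub_sq_le_two_mul _ (g (history B p)) _).trans ?_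
        rw [enorm_sub_rev (g (history B p))]
        gcongr
        by_cases hpS : p ∈ S k
        · rw [Set.indicator_of_notMem (by simpa using hpS), Set.indicator_of_mem hpS, zero_add]
          exact hDM k p
        · rw [Set.indicator_of_mem (by simpa using hpS), Set.indicator_of_notMem hpS, add_zero]
    _ = 2 * ((∫⁻ p, (S k)ᶜ.indicator (D k) p ∂(timeProd P T) +
        ∫⁻ p, (S k).indicator (fun _ => M) p ∂(timeProd P T)) +
        ∫⁻ p, ‖u p.2.toNNReal p.1 - g (history B p)‖ₑ ^ 2 ∂(timeProd P T)) := by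
        rw [lintegral_const_mul' _ _ (by simp), lintegral_add_left (by exact hEm.add hFm),
          lintegral_add_left hEm]
    _ ≤ 2 * (η / 4 + η / 4) := by gcongr
    _ = η := by
        rw [ENNReal.div_eq_inv_mul, ← add_mul, ← mul_assoc]
        have : (2 : ℝ≥0∞) * (4⁻¹ + 4⁻¹) = 1 := by
          rw [← two_mul, ← mul_assoc]
          norm_num
          exact ENNReal.mul_inv_cancel (by simp) (by simp)
        rw [this, one_mul]

end Approximation

end WienerControl

end

noncomputable section

namespace WienerControl

/-! ### Càdlàg paths and the uniform norm -/

section Paths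

variable {Ω : Type*} {m : MeasurableSpace Ω} {P : Measure Ω} {d r n : ℕ}
  {B : ℝ≥0 → Ω → Fin d → ℝ} {T : ℝ≥0} {ξ : Path n T → ℝ} {K γ : ℝ}

theorem mem_cadlag_of_continuous {f : Path n T} (hf : Continuous f) : f ∈ cadlag n T :=
  fun t => ⟨hf.continuousWithinAt, f t, (hf.tendsto t).mono_left nhdsWithin_le_nhds⟩

theorem _root_.IsLowerSet.eventually_mem_iff_nhdsGE {α : Type*} [LinearOrder α]
    [TopologicalSpace α] {s : Set α} (hs : IsLowerSet s) (ho : IsOpen s) (x : α) :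
    ∀ᶠ t in 𝓝[≥] x, (t ∈ s ↔ x ∈ s) := by
  by_cases hx : x ∈ s
  · filter_upwards [nhdsWithin_le_nhds (ho.mem_nhds hx)] with t ht using by simp [ht, hx]
  · filter_upwards [self_mem_nhdsWithin] with t ht
    exact ⟨fun h => hs ht h, fun h => absurd h hx⟩

theorem _root_.IsLowerSet.exists_eventually_mem_iff_nhdsLT {α : Type*} [LinearOrder α]
    [TopologicalSpace α] [OrderTopology α] {s : Set α} (hs : IsLowerSet s) (x : α) :
    ∃ p : Prop, ∀ᶠ t in 𝓝[<] x, (t ∈ s ↔ p) := by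
  by_cases h : ∀ y < x, y ∈ s
  · refine ⟨True, ?_⟩
    filter_upwards [self_mem_nhdsWithin] with t ht using by simp [h t ht]
  · push Not at h
    obtain ⟨y, hy, hys⟩ := h
    refine ⟨False, ?_⟩
    filter_upwards [Ioo_mem_nhdsLT hy] with t ht
    simpa using fun h => hys (hs ht.1.le h)

/-- The clock `h` is continuous and nondecreasing, so `{h < b}` and `{h < c}` are open initial
segments. Their indicators are right-continuous with left limits. -/
theorem indicator_comp_mem_cadlag {h : Set.Icc (0 : ℝ≥0) T → ℝ≥0∞} (hm : Monotone h)
    (hc : Continuous h) (b c : ℝ≥0∞) (z : EuclideanSpace ℝ (Fin n)) :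
    (fun t => Set.indicator {s : ℝ≥0∞ | b ≤ s ∧ s < c} (fun _ => z) (h t)) ∈ cadlag n T := by
  classical
  have hl : ∀ c, IsLowerSet {t | h t < c} := fun c s t hts hs => (hm hts).trans_lt hs
  have ho : ∀ c, IsOpen {t | h t < c} := fun c => isOpen_lt hc continuous_const
  have heq : ∀ t, Set.indicator {s : ℝ≥0∞ | b ≤ s ∧ s < c} (fun _ => z) (h t) =
      if t ∉ {t | h t < b} ∧ t ∈ {t | h t < c} then z else 0 := fun t => by
    simp [Set.indicator_apply]
  simp only [heq]
  intro x
  constructor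
  · refine (tendsto_const_nhds).congr' ?_
    filter_upwards [(hl b).eventually_mem_iff_nhdsGE (ho b) x,
      (hl c).eventually_mem_iff_nhdsGE (ho c) x] with t h1 h2
    simp only [h1, h2]
  · obtain ⟨p, hp⟩ := (hl b).exists_eventually_mem_iff_nhdsLT x
    obtain ⟨q, hq⟩ := (hl c).exists_eventually_mem_iff_nhdsLT x
    refine ⟨if ¬ p ∧ q then z else 0, (tendsto_const_nhds).congr' ?_⟩
    filter_upwards [hp, hq] with t h1 h2
    simp only [h1, h2]

theorem sum_mem_cadlag {ι : Type*} (s : Finset ι) {f : ι → Path n T}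
    (hf : ∀ i ∈ s, f i ∈ cadlag n T) : (fun t => ∑ i ∈ s, f i t) ∈ cadlag n T := by
  intro x
  refine ⟨tendsto_finsetSum s fun i hi => (hf i hi x).1, ?_⟩
  choose! l hl using fun i hi => (hf i hi x).2
  exact ⟨∑ i ∈ s, l i, tendsto_finsetSum s hl⟩

theorem stepPath_mem_cadlag (ε : ℝ) (N : ℕ) (z : ℕ → Ω → EuclideanSpace ℝ (Fin n)) (ω : Ω) :
    stepPath B ε T N z ω ∈ cadlag n T := by
  refine sum_mem_cadlag _ fun i _ => indicator_comp_mem_cadlag (fun s t hst => ?_) ?_ _ _ _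
  · exact min_le_min_right _ (by exact_mod_cast hst)
  · fun_prop

theorem supNorm_stepPath_lt_top (ε : ℝ) (N : ℕ) (z : ℕ → Ω → EuclideanSpace ℝ (Fin n)) (ω : Ω) :
    supNorm (stepPath B ε T N z ω) < ∞ := by
  refine lt_of_le_of_lt (iSup_le fun t => (enorm_sum_le _ _).trans
    (Finset.sum_le_sum fun i _ => enorm_indicator_le_enorm_self _ _)) ?_
  exact ENNReal.sum_lt_top.2 fun i _ => enorm_lt_top

theorem enorm_payoff_sub_le (hξ : HolderPayoff ξ K γ) (hK : 0 < K) (hγ : 0 < γ)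
    {f g : Path n T} (hf : f ∈ cadlag n T) (hg : g ∈ cadlag n T) :
    ‖ξ f - ξ g‖ₑ ≤ ENNReal.ofReal K * supNorm (f - g) ^ γ := by
  rw [← ofReal_norm, Real.norm_eq_abs]
  refine (ENNReal.ofReal_le_ofReal (hξ f hf g hg)).trans ?_
  rw [ENNReal.ofReal_mul hK.le, ← ENNReal.ofReal_rpow_of_nonneg ENNReal.toReal_nonneg hγ.le]
  gcongr
  exact ENNReal.ofReal_toReal_le

theorem supNorm_toFun_sub (f g : C(Set.Icc (0 : ℝ≥0) T, EuclideanSpace ℝ (Fin n))) :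
    supNorm (⇑f - ⇑g) = edist f g := by
  rw [ContinuousMap.edist_eq_iSup]
  simp [supNorm, edist_eq_enorm_sub]

theorem continuous_payoff_comp (hξ : HolderPayoff ξ K γ) (hK : 0 < K) (hγ : 0 < γ) :
    Continuous fun f : C(Set.Icc (0 : ℝ≥0) T, EuclideanSpace ℝ (Fin n)) => ξ f := by
  have : HolderWith K.toNNReal γ.toNNReal
      fun f : C(Set.Icc (0 : ℝ≥0) T, EuclideanSpace ℝ (Fin n)) => ξ f := fun f g => by
    rw [edist_eq_enorm_sub, ← supNorm_toFun_sub, Real.coe_toNNReal _ hγ.le]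
    exact enorm_payoff_sub_le hξ hK hγ (mem_cadlag_of_continuous f.continuous)
      (mem_cadlag_of_continuous g.continuous)
  exact this.continuous (Real.toNNReal_pos.2 hγ)

/-- Every open set is a countable union of balls. Applied to continuous paths, this makes the state
a random element of a separable space on which the payoff is continuous, so measurability of the
payoff comes from its Hölder bound alone. -/
theorem measurable_of_edist {E : Type*} [PseudoEMetricSpace E] [SecondCountableTopology E]
    [MeasurableSpace E] [BorelSpace E] {F : Ω → E}
    (hF : ∀ x, Measurable fun ω => edist (F ω) x) : Measurable F := by
  refine measurable_of_isOpen fun O hO => ?_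
  choose! δ hδ hO' using fun x hx => EMetric.isOpen_iff.1 hO x hx
  obtain ⟨t, htO, htc, ht⟩ := TopologicalSpace.isOpen_biUnion_countable O
    (fun x => Metric.eball x (δ x)) fun x _ => Metric.isOpen_eball
  have : O = ⋃ x ∈ t, Metric.eball x (δ x) := by
    rw [ht]
    exact Set.Subset.antisymm
      (fun x hx => Set.mem_iUnion₂.2 ⟨x, hx, Metric.mem_eball_self (hδ x hx)⟩)
      (Set.iUnion₂_subset hO')
  rw [this, Set.preimage_iUnion₂]
  exact MeasurableSet.biUnion htc fun x _ => measurableSet_lt (hF x) measurable_const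

theorem measurable_supNorm {Y : Ω → Path n T} (hY : ∀ t, Measurable fun ω => Y ω t)
    (hc : ∀ ω, Continuous (Y ω)) : Measurable fun ω => supNorm (Y ω) := by
  have : Nonempty (Set.Icc (0 : ℝ≥0) T) := ⟨⟨0, le_rfl, zero_le⟩⟩
  have heq : (fun ω => supNorm (Y ω)) =
      fun ω => ⨆ i, ‖Y ω (TopologicalSpace.denseSeq (Set.Icc (0 : ℝ≥0) T) i)‖ₑ := by
    funext ω
    refine le_antisymm (iSup_le fun t => ?_) (iSup_le fun i => le_iSup (fun t => ‖Y ω t‖ₑ) _)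
    have hcl : IsClosed {t | ‖Y ω t‖ₑ ≤
        ⨆ i, ‖Y ω (TopologicalSpace.denseSeq (Set.Icc (0 : ℝ≥0) T) i)‖ₑ} :=
      isClosed_le (hc ω).enorm continuous_const
    have hsub := hcl.closure_subset_iff.2 (Set.range_subset_iff.2 fun i =>
      le_iSup (fun i => ‖Y ω (TopologicalSpace.denseSeq (Set.Icc (0 : ℝ≥0) T) i)‖ₑ) i)
    exact hsub (TopologicalSpace.denseRange_denseSeq _ t)
  rw [heq]
  exact Measurable.iSup fun i => (hY _).enorm

theorem measurable_payoff (hξ : HolderPayoff ξ K γ) (hK : 0 < K) (hγ : 0 < γ)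
    {Y : Ω → Path n T} (hY : ∀ t, Measurable fun ω => Y ω t) (hc : ∀ ω, Continuous (Y ω)) :
    Measurable fun ω => ξ (Y ω) := by
  borelize C(Set.Icc (0 : ℝ≥0) T, EuclideanSpace ℝ (Fin n))
  have hF : Measurable fun ω =>
      (⟨Y ω, hc ω⟩ : C(Set.Icc (0 : ℝ≥0) T, EuclideanSpace ℝ (Fin n))) := by
    refine measurable_of_edist fun g => ?_
    simp only [← supNorm_toFun_sub]
    exact measurable_supNorm (fun t => (hY t).sub_const _) fun ω => (hc ω).sub g.continuous
  exact (continuous_payoff_comp hξ hK hγ).measurable.comp hF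

theorem integrable_payoff [IsProbabilityMeasure P] (hξ : HolderPayoff ξ K γ) (hK : 0 < K)
    (hγ : 0 < γ) {Y : Ω → Path n T} (hY : ∀ ω, Y ω ∈ cadlag n T)
    (hm : AEStronglyMeasurable (fun ω => ξ (Y ω)) P)
    (hint : ∫⁻ ω, supNorm (Y ω) ^ γ ∂P < ∞) : Integrable (fun ω => ξ (Y ω)) P := by
  refine ⟨hm, ?_⟩
  have h0 : (0 : Path n T) ∈ cadlag n T := mem_cadlag_of_continuous continuous_zero
  calc ∫⁻ ω, ‖ξ (Y ω)‖ₑ ∂P ≤ ∫⁻ ω, (‖ξ 0‖ₑ + ENNReal.ofReal K * supNorm (Y ω) ^ γ) ∂P := by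
        refine lintegral_mono fun ω => ?_
        have h1 := enorm_payoff_sub_le hξ hK hγ (hY ω) h0
        rw [sub_zero] at h1
        calc ‖ξ (Y ω)‖ₑ = ‖ξ 0 + (ξ (Y ω) - ξ 0)‖ₑ := by rw [add_sub_cancel]
          _ ≤ _ := (enorm_add_le _ _).trans (by gcongr)
    _ = ‖ξ 0‖ₑ + ENNReal.ofReal K * ∫⁻ ω, supNorm (Y ω) ^ γ ∂P := by
        rw [lintegral_add_left measurable_const, lintegral_const_mul' _ _ ENNReal.ofReal_ne_top]
        simp
    _ < ∞ := ENNReal.add_lt_top.2 ⟨enorm_lt_top, ENNReal.mul_lt_top ENNReal.ofReal_lt_top hint⟩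

theorem enorm_integral_payoff_sub_le (hξ : HolderPayoff ξ K γ) (hK : 0 < K) (hγ : 0 < γ)
    {Y Z : Ω → Path n T} (hY : ∀ ω, Y ω ∈ cadlag n T) (hZ : ∀ ω, Z ω ∈ cadlag n T)
    (hYi : Integrable (fun ω => ξ (Y ω)) P) (hZi : Integrable (fun ω => ξ (Z ω)) P) :
    ‖∫ ω, ξ (Y ω) ∂P - ∫ ω, ξ (Z ω) ∂P‖ₑ ≤
      ENNReal.ofReal K * ∫⁻ ω, supNorm (Y ω - Z ω) ^ γ ∂P := by
  rw [← integral_sub hYi hZi, ← lintegral_const_mul' _ _ ENNReal.ofReal_ne_top]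
  exact (enorm_integral_le_lintegral_enorm _).trans
    (lintegral_mono fun ω => enorm_payoff_sub_le hξ hK hγ (hY ω) (hZ ω))

end Paths

/-- The threshold is `κ = e^{1/γ}` and `L = κ^{γ-2}`: below it `x^γ ≤ e`, above it `x^{γ-2} ≤
κ^{γ-2}` as `γ < 2`. This trades the Hölder exponent for the second moment, which the state
assumption controls. -/
theorem exists_rpow_le_add_mul_sq {γ : ℝ} (hγ0 : 0 < γ) (hγ1 : γ ≤ 1) {e : ℝ≥0} (he : 0 < e) :
    ∃ L : ℝ≥0, ∀ x : ℝ≥0∞, x ^ γ ≤ e + L * x ^ 2 := by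
  have hκ : 0 < e ^ γ⁻¹ := NNReal.rpow_pos he
  refine ⟨(e ^ γ⁻¹) ^ (γ - 2), fun x => ?_⟩
  rcases eq_or_ne x ∞ with rfl | hx
  · simp [ENNReal.mul_top, (NNReal.rpow_pos hκ).ne']
  lift x to ℝ≥0 using hx
  rw [← ENNReal.coe_rpow_of_nonneg _ hγ0.le]
  norm_cast
  rcases le_or_gt x (e ^ γ⁻¹) with h | h
  · refine le_add_right ?_
    rwa [NNReal.le_rpow_inv_iff hγ0] at h
  · refine le_add_left ?_
    have hx : x ≠ 0 := (hκ.trans h).ne'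
    calc x ^ γ = x ^ (γ - 2) * x ^ 2 := by
          rw [← NNReal.rpow_natCast x 2, ← NNReal.rpow_add hx]
          simp
      _ ≤ _ := mul_le_mul_left (NNReal.rpow_le_rpow_of_nonpos hκ h.le (by linarith)) _

/-! ### Comparison of the values -/

section Values

variable {Ω : Type*} {m : MeasurableSpace Ω} {P : Measure Ω} {d r n : ℕ}
  {B : ℝ≥0 → Ω → Fin d → ℝ} {T : ℝ≥0} {ξ : Path n T → ℝ} {K γ a : ℝ} {𝓕 : Filtration ℝ≥0 m}
  {X : (ℝ≥0 → Ω → EuclideanSpace ℝ (Fin r)) →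
    Set.Icc (0 : ℝ≥0) T → Ω → EuclideanSpace ℝ (Fin n)}
  {u v : ℝ≥0 → Ω → EuclideanSpace ℝ (Fin r)}

theorem zero_mem_controls (ha : 0 ≤ a) :
    (0 : ℝ≥0 → Ω → EuclideanSpace ℝ (Fin r)) ∈ controls 𝓕 r a T :=
  ⟨stronglyMeasurable_const, fun _ _ => zero_mem_actionSpace ha, fun _ _ _ => rfl,
    fun _ => ⟨0, tendsto_const_nhds⟩⟩

variable [IsProbabilityMeasure P]

theorem integrable_payoff_controlled (hξ : HolderPayoff ξ K γ) (hK : 0 < K) (hγ0 : 0 < γ)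
    (hγ1 : γ ≤ 1) (hX : IsControlledWiener P 𝓕 a X) (hu : u ∈ controls 𝓕 r a T) :
    Integrable (fun ω => ξ (fun t => X u t ω)) P := by
  have hm : ∀ t, Measurable fun ω => X u t ω := fun t =>
    (hX.adapted u hu t).mono (𝓕.le _) le_rfl
  refine integrable_payoff hξ hK hγ0
    (fun ω => mem_cadlag_of_continuous (hX.continuous_path u hu ω))
    (measurable_payoff hξ hK hγ0 hm (hX.continuous_path u hu)).aestronglyMeasurable ?_
  obtain ⟨L, hL⟩ := exists_rpow_le_add_mul_sq hγ0 hγ1 one_pos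
  refine (lintegral_mono fun ω => hL _).trans_lt ?_
  rw [lintegral_add_left measurable_const, lintegral_const_mul' _ _ ENNReal.coe_ne_top]
  simpa using ENNReal.mul_lt_top ENNReal.coe_lt_top (hX.sq_integrable u hu)

theorem exists_enorm_value_sub_le (hξ : HolderPayoff ξ K γ) (hK : 0 < K) (hγ0 : 0 < γ)
    (hγ1 : γ ≤ 1) (hX : IsControlledWiener P 𝓕 a X) {C : ℝ≥0} (hC : LipschitzState P 𝓕 a X C)
    {e : ℝ≥0} (he : 0 < e) :
    ∃ L : ℝ≥0, ∀ u ∈ controls 𝓕 r a T, ∀ v ∈ controls 𝓕 r a T,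
      ‖value P ξ X u - value P ξ X v‖ₑ ≤ e + L * ∫⁻ ω, (∫⁻ s : ℝ in Set.Ioc 0 (T : ℝ),
        ‖u s.toNNReal ω - v s.toNNReal ω‖ₑ ^ 2) ∂P := by
  have hK' : 0 < K.toNNReal := Real.toNNReal_pos.2 hK
  -- The error `e / K` becomes `e` after multiplication by the Hölder constant.
  obtain ⟨L, hL⟩ := exists_rpow_le_add_mul_sq hγ0 hγ1 (div_pos he hK')
  refine ⟨K.toNNReal * (L * C), fun u hu v hv => ?_⟩
  refine (enorm_integral_payoff_sub_le hξ hK hγ0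
    (fun ω => mem_cadlag_of_continuous (hX.continuous_path u hu ω))
    (fun ω => mem_cadlag_of_continuous (hX.continuous_path v hv ω))
    (integrable_payoff_controlled hξ hK hγ0 hγ1 hX hu)
    (integrable_payoff_controlled hξ hK hγ0 hγ1 hX hv)).trans ?_
  calc _ ≤ (K.toNNReal : ℝ≥0∞) * ∫⁻ ω, (((e / K.toNNReal : ℝ≥0) : ℝ≥0∞) +
        L * supNorm (fun t => X u t ω - X v t ω) ^ 2) ∂P := by
        gcongr with ω
        · exact le_rfl
        · exact hL _
    _ = e + K.toNNReal * (L * ∫⁻ ω, supNorm (fun t => X u t ω - X v t ω) ^ 2 ∂P) := by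
        rw [lintegral_add_left measurable_const, lintegral_const_mul' _ _ ENNReal.coe_ne_top,
          lintegral_const, measure_univ, mul_one, mul_add, ← ENNReal.coe_mul,
          mul_div_cancel₀ _ hK'.ne']
    _ ≤ _ := by
        rw [ENNReal.coe_mul, ENNReal.coe_mul, mul_assoc, mul_assoc]
        gcongr
        exact hC u hu v hv

/-- Every admissible control is compared with the zero control, from which it has bounded `L²`
distance because the action space is bounded. -/
theorem bddAbove_value (hξ : HolderPayoff ξ K γ) (hK : 0 < K) (hγ0 : 0 < γ) (hγ1 : γ ≤ 1)
    (ha : 0 ≤ a) (hX : IsControlledWiener P 𝓕 a X) {C : ℝ≥0} (hC : LipschitzState P 𝓕 a X C) :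
    BddAbove (value P ξ X '' controls 𝓕 r a T) := by
  obtain ⟨L, hL⟩ := exists_enorm_value_sub_le hξ hK hγ0 hγ1 hX hC one_pos
  set M : ℝ≥0∞ := 1 + L * (ENNReal.ofReal (r * (2 * a) ^ 2) * volume (Set.Ioc 0 (T : ℝ))) with hM
  have hMtop : M ≠ ∞ := by simp [hM, ENNReal.mul_eq_top]
  refine ⟨value P ξ X 0 + M.toReal, ?_⟩
  rintro _ ⟨u, hu, rfl⟩
  have hle : ‖value P ξ X u - value P ξ X 0‖ₑ ≤ M := by
    refine (hL u hu 0 (zero_mem_controls ha)).trans ?_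
    rw [hM, ENNReal.coe_one]
    gcongr
    refine (lintegral_mono fun ω => lintegral_mono fun s => enorm_sub_sq_le (hu.2.1 _ _)
      (zero_mem_actionSpace ha)).trans_eq ?_
    simp
  have := ENNReal.toReal_mono hMtop hle
  rw [toReal_enorm, Real.norm_eq_abs] at this
  linarith [le_abs_self (value P ξ X u - value P ξ X 0)]

theorem lintegral_supNorm_stepPath_rpow_le (hγ0 : 0 < γ) (hγ1 : γ ≤ 1) {ε : ℝ} {N : ℕ}
    (z : ℕ → Ω → EuclideanSpace ℝ (Fin n)) :
    ∫⁻ ω, supNorm (stepPath B ε T N z ω) ^ γ ∂P ≤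
      1 + eLpNorm (fun ω => (supNorm (stepPath B ε T N z ω)).toReal) 1 P := by
  rw [eLpNorm_one_eq_lintegral_enorm]
  calc _ ≤ ∫⁻ ω, (1 + ‖(supNorm (stepPath B ε T N z ω)).toReal‖ₑ) ∂P := by
        refine lintegral_mono fun ω => ?_
        rw [Real.enorm_eq_ofReal ENNReal.toReal_nonneg,
          ENNReal.ofReal_toReal (supNorm_stepPath_lt_top _ _ _ _).ne]
        rcases le_total (supNorm (stepPath B ε T N z ω)) 1 with h | h
        · exact le_add_right (ENNReal.rpow_le_one h hγ0.le)
        · exact le_add_left ((ENNReal.rpow_le_rpow_of_exponent_le h hγ1).trans_eq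
            (ENNReal.rpow_one _))
    _ = _ := by rw [lintegral_add_left measurable_const]; simp

theorem discrete_payoff (hξ : HolderPayoff ξ K γ) (hK : 0 < K) (hγ0 : 0 < γ) (hγ1 : γ ≤ 1)
    {ε : ℝ} {N : ℕ}
    {Y : (Fin N → Ω → EuclideanSpace ℝ (Fin r)) → ℕ → Ω → EuclideanSpace ℝ (Fin n)}
    (hmeas : ∀ v ∈ discreteControls B ε P N r a,
      AEStronglyMeasurable (fun ω => ξ (stepPath B ε T N (Y v) ω)) P)
    (hY : UniformIntegrable (fun (v : discreteControls B ε P N r a) ω =>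
      (supNorm (stepPath B ε T N (Y v) ω)).toReal) 1 P) :
    (∀ v ∈ discreteControls B ε P N r a,
      Integrable (fun ω => ξ (stepPath B ε T N (Y v) ω)) P) ∧
    BddAbove (discreteValue B ε P ξ Y '' discreteControls B ε P N r a) := by
  obtain ⟨M, hM⟩ := hY.2.2
  have hbd : ∀ v ∈ discreteControls B ε P N r a,
      ∫⁻ ω, supNorm (stepPath B ε T N (Y v) ω) ^ γ ∂P ≤ 1 + M := fun v hv =>
    (lintegral_supNorm_stepPath_rpow_le hγ0 hγ1 _).trans (by gcongr; exact hM ⟨v, hv⟩)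
  have hM_top : (1 + M : ℝ≥0∞) < ∞ := by simp
  have hint : ∀ v ∈ discreteControls B ε P N r a,
      Integrable (fun ω => ξ (stepPath B ε T N (Y v) ω)) P := fun v hv =>
    integrable_payoff hξ hK hγ0 (fun ω => stepPath_mem_cadlag _ _ _ _) (hmeas v hv)
      ((hbd v hv).trans_lt hM_top)
  refine ⟨hint, ξ 0 + (ENNReal.ofReal K * (1 + M)).toReal, ?_⟩
  rintro _ ⟨v, hv, rfl⟩
  have h1 := enorm_integral_payoff_sub_le (P := P) hξ hK hγ0
    (fun ω => stepPath_mem_cadlag (B := B) ε N (Y v) ω)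
    (Z := fun _ => 0) (fun _ => mem_cadlag_of_continuous continuous_zero) (hint v hv)
    (integrable_const _)
  simp only [sub_zero, integral_const, probReal_univ, one_smul] at h1
  have h2 := ENNReal.toReal_mono (ENNReal.mul_ne_top ENNReal.ofReal_ne_top hM_top.ne)
    (h1.trans (mul_le_mul_right (hbd v hv) _))
  rw [toReal_enorm, Real.norm_eq_abs] at h2
  change ∫ ω, ξ (stepPath B ε T N (Y v) ω) ∂P ≤ _
  linarith [le_abs_self (∫ ω, ξ (stepPath B ε T N (Y v) ω) ∂P - ξ 0)]

end Values

end WienerControl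

end

/-! ### Convergence of the values and transfer of near-optimal controls. -/

open WienerControl in
theorem proposition4p2 {Ω : Type*} [m : MeasurableSpace Ω] (P : Measure Ω) [IsProbabilityMeasure P]
    {d r n : ℕ} (hd : 0 < d) (B : ℝ≥0 → Ω → Fin d → ℝ) (hB : IsBrownianMotion B P)
    (T : ℝ≥0) (hT : 0 < T) (a : ℝ) (ha : 0 < a)
    (ε : ℕ → ℝ) (hε_pos : ∀ k, 0 < ε k) (hε_anti : Antitone ε) (hε : Tendsto ε atTop (𝓝 0))
    (ξ : Path n T → ℝ) (K γ : ℝ) (hK : 0 < K) (hγ0 : 0 < γ) (hγ1 : γ ≤ 1)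
    (hξ : HolderPayoff ξ K γ)
    (X : (ℝ≥0 → Ω → EuclideanSpace ℝ (Fin r)) →
      Set.Icc (0 : ℝ≥0) T → Ω → EuclideanSpace ℝ (Fin n))
    (Xk : ∀ k, (Fin (numSteps B (ε k) P T) → Ω → EuclideanSpace ℝ (Fin r)) →
      ℕ → Ω → EuclideanSpace ℝ (Fin n))
    (hX : IsStronglyControlled hB ε a γ X Xk)
    (C : ℝ≥0) (hC : LipschitzState P (brownianFiltration hB) a X C)
    (hmeas : ∀ k, ∀ v ∈ discreteControls B (ε k) P (numSteps B (ε k) P T) r a,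
      AEStronglyMeasurable
        (fun ω => ξ (stepPath B (ε k) T (numSteps B (ε k) P T) (Xk k v) ω)) P) :
    -- all expectations exist and all suprema are finite
    (∀ u ∈ controls (brownianFiltration hB) r a T, Integrable (fun ω => ξ (fun t => X u t ω)) P) ∧
    BddAbove (value P ξ X '' controls (brownianFiltration hB) r a T) ∧
    (∀ k, (∀ v ∈ discreteControls B (ε k) P (numSteps B (ε k) P T) r a,
        Integrable (fun ω => ξ (stepPath B (ε k) T (numSteps B (ε k) P T) (Xk k v) ω)) P) ∧
      BddAbove (discreteValue B (ε k) P ξ (Xk k) ''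
        discreteControls B (ε k) P (numSteps B (ε k) P T) r a)) ∧
    -- convergence of the discrete optimal values
    Tendsto (fun k => |discreteOptimalValue B (ε k) P a ξ (Xk k) -
      optimalValue P (brownianFiltration hB) a ξ X|) atTop (𝓝 0) ∧
    -- near-optimal discrete controls are near-optimal for the original problem
    ∀ δ η : ℝ, 0 ≤ δ → δ < η → ∃ k₀, ∀ k ≥ k₀,
      ∀ v ∈ discreteControls B (ε k) P (numSteps B (ε k) P T) r a,
        discreteOptimalValue B (ε k) P a ξ (Xk k) - δ ≤ discreteValue B (ε k) P ξ (Xk k) v →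
        IsOptimalControl P (brownianFiltration hB) a ξ X η (controlProcess B (ε k) T v) := by
  have hW := hX.controlled
  have hu_int : ∀ u ∈ controls (brownianFiltration hB) r a T,
      Integrable (fun ω => ξ (fun t => X u t ω)) P :=
    fun u hu => integrable_payoff_controlled hξ hK hγ0 hγ1 hW hu
  have hbdd : BddAbove (value P ξ X '' controls (brownianFiltration hB) r a T) :=
    bddAbove_value hξ hK hγ0 hγ1 ha.le hW hC
  have hdisc : ∀ k, (∀ v ∈ discreteControls B (ε k) P (numSteps B (ε k) P T) r a,
        Integrable (fun ω => ξ (stepPath B (ε k) T (numSteps B (ε k) P T) (Xk k v) ω)) P) ∧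
      BddAbove (discreteValue B (ε k) P ξ (Xk k) ''
        discreteControls B (ε k) P (numSteps B (ε k) P T) r a) := fun k =>
    discrete_payoff hξ hK hγ0 hγ1 (hmeas k) (hX.uniformIntegrable k)
  refine ⟨hu_int, hbdd, hdisc, ?_⟩
  set V := optimalValue P (brownianFiltration hB) a ξ X with hV
  set W := fun k => discreteOptimalValue B (ε k) P a ξ (Xk k) with hWdef
  have hmem : ∀ k, ∀ v ∈ discreteControls B (ε k) P (numSteps B (ε k) P T) r a,
      controlProcess B (ε k) T v ∈ controls (brownianFiltration hB) r a T := fun k v hv =>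
    controlProcess_mem_controls hB (hε_pos k) ha.le hT hv
  have hval : ∀ u ∈ controls (brownianFiltration hB) r a T, value P ξ X u ≤ V := fun u hu =>
    le_csSup (by rwa [Set.image_eq_range] at hbdd) ⟨⟨u, hu⟩, rfl⟩
  have hdval : ∀ k, ∀ v ∈ discreteControls B (ε k) P (numSteps B (ε k) P T) r a,
      discreteValue B (ε k) P ξ (Xk k) v ≤ W k := fun k v hv =>
    le_csSup (by have := (hdisc k).2; rwa [Set.image_eq_range] at this) ⟨⟨v, hv⟩, rfl⟩
  -- the discrete payoff is close to the payoff of the same control, uniformly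
  have hclose : ∀ e > 0, ∀ᶠ k in atTop,
      ∀ v ∈ discreteControls B (ε k) P (numSteps B (ε k) P T) r a,
        |discreteValue B (ε k) P ξ (Xk k) v - value P ξ X (controlProcess B (ε k) T v)| ≤ e := by
    intro e he
    have h1 := ENNReal.Tendsto.const_mul hX.tendsto
      (Or.inr (ENNReal.ofReal_ne_top : ENNReal.ofReal K ≠ ⊤))
    rw [mul_zero] at h1
    filter_upwards [h1.eventually_le_const (ENNReal.ofReal_pos.2 he)] with k hk v hv
    have h2 := enorm_integral_payoff_sub_le (P := P) hξ hK hγ0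
      (fun ω => stepPath_mem_cadlag (B := B) (ε k) (numSteps B (ε k) P T) (Xk k v) ω)
      (fun ω => mem_cadlag_of_continuous (hW.continuous_path _ (hmem k v hv) ω))
      ((hdisc k).1 v hv) (hu_int _ (hmem k v hv))
    have h3 : ‖discreteValue B (ε k) P ξ (Xk k) v -
        value P ξ X (controlProcess B (ε k) T v)‖ₑ ≤ ENNReal.ofReal e := by
      refine h2.trans (le_trans ?_ hk)
      gcongr
      exact le_iSup (fun v : discreteControls B (ε k) P (numSteps B (ε k) P T) r a =>
        ∫⁻ ω, supNorm (fun t => stepPath B (ε k) T (numSteps B (ε k) P T) (Xk k v) ω t -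
          X (controlProcess B (ε k) T v.1) t ω) ^ γ ∂P) ⟨v, hv⟩
    rwa [← ofReal_norm, Real.norm_eq_abs, ENNReal.ofReal_le_ofReal_iff he.le] at h3
  -- every control is approximated by discrete controls
  have happrox : ∀ u ∈ controls (brownianFiltration hB) r a T, ∀ e > 0, ∀ᶠ k in atTop,
      ∃ v ∈ discreteControls B (ε k) P (numSteps B (ε k) P T) r a,
        |value P ξ X (controlProcess B (ε k) T v) - value P ξ X u| ≤ e := by
    intro u hu e he
    obtain ⟨L, hL⟩ := exists_enorm_value_sub_le hξ hK hγ0 hγ1 hW hC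
      (Real.toNNReal_pos.2 (half_pos he))
    -- `L + 1` replaces `L` so that the quotient is meaningful also for `L = 0`.
    have hη : ENNReal.ofReal (e / 2) / (L + 1 : ℝ≥0) ≠ 0 :=
      ENNReal.div_ne_zero.2 ⟨by simpa using he, ENNReal.coe_ne_top⟩
    filter_upwards [eventually_exists_discreteControl hd hB hT ha.le hε_pos hε hu hη]
      with k ⟨v, hv, hvu⟩
    refine ⟨v, hv, ?_⟩
    have h3 : ‖value P ξ X (controlProcess B (ε k) T v) - value P ξ X u‖ₑ ≤ ENNReal.ofReal e := by
      refine (hL _ (hmem k v hv) u hu).trans ?_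
      calc _ ≤ ENNReal.ofReal (e / 2) +
            ((L + 1 : ℝ≥0) : ℝ≥0∞) * (ENNReal.ofReal (e / 2) / (L + 1 : ℝ≥0)) := by
            refine add_le_add le_rfl (mul_le_mul' ?_ hvu)
            exact ENNReal.coe_le_coe.2 (le_add_of_nonneg_right zero_le_one)
        _ = ENNReal.ofReal e := by
            rw [ENNReal.mul_div_cancel (by simp) ENNReal.coe_ne_top,
              ← ENNReal.ofReal_add (half_pos he).le (half_pos he).le, add_halves]
    rwa [← ofReal_norm, Real.norm_eq_abs, ENNReal.ofReal_le_ofReal_iff he.le] at h3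
  have hne : Nonempty (controls (brownianFiltration hB) r a T) := ⟨⟨0, zero_mem_controls ha.le⟩⟩
  -- For the lower bound one `e` is lost in each of three choices: a near-optimal `u`, its discrete
  -- approximation, and the passage from `X` to `X^k`.
  have hlim : ∀ e > 0, ∀ᶠ k in atTop, |W k - V| ≤ 3 * e := by
    intro e he
    obtain ⟨⟨u, hu⟩, hVu⟩ := exists_lt_of_lt_ciSup
      (show V - e < ⨆ u : controls (brownianFiltration hB) r a T, value P ξ X u from
        sub_lt_self V he)
    filter_upwards [hclose e he, happrox u hu e he] with k hk ⟨v, hv, hvu⟩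
    have h1 := abs_le.1 (hk v hv)
    have h2 := abs_le.1 hvu
    have h3 := hdval k v hv
    have h4 : W k ≤ V + e := by
      have : Nonempty (discreteControls B (ε k) P (numSteps B (ε k) P T) r a) := ⟨⟨v, hv⟩⟩
      refine ciSup_le fun w => ?_
      have h5 := abs_le.1 (hk w w.2)
      have h6 := hval _ (hmem k w w.2)
      linarith
    exact abs_le.2 ⟨by linarith, by linarith⟩
  refine ⟨?_, fun δ η hδ hδη => ?_⟩
  · refine Metric.tendsto_atTop'.2 fun e he => ?_
    obtain ⟨k₀, hk₀⟩ := eventually_atTop.1 (hlim (e / 4) (by linarith))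
    refine ⟨k₀, fun k hk => ?_⟩
    rw [Real.dist_0_eq_abs, abs_abs]
    have := hk₀ k hk.le
    linarith
  -- With `e = (η - δ) / 4` the loss is `3e` from comparing optimal values, `δ` from near-optimality
  -- and `e` from comparing payoffs: exactly `η` in total.
  · have he : 0 < (η - δ) / 4 := by linarith
    obtain ⟨k₀, hk₀⟩ := eventually_atTop.1 ((hlim _ he).and (hclose _ he))
    refine ⟨k₀, fun k hk v hv hvδ => ⟨hmem k v hv, ?_⟩⟩
    have h1 := abs_le.1 (hk₀ k hk).1
    have h2 := abs_le.1 ((hk₀ k hk).2 v hv)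
    change W k - δ ≤ _ at hvδ
    change V - η ≤ _
    linarith
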